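/- **Theorem.** (Torpid mixing of simulated tempering for the mean-field Blume--Emery--Griffiths model.) *Model.* For $N\ge 1$, $K>0$ let $\Omega=\{-1,0,1\}^N$, $H(\sigma)=-\sum_{j}\sigma_j^2+\frac KN\big(\sum_j\sigma_j\big)^2$, and $\pi_\beta(\sigma)=e^{\beta H(\sigma)}/\sum_{\tau}e^{\beta H(\tau)}$. Let $\mathcal K_{gen}$ be the chain on $\Omega$ with $\mathcal K_{gen}(x,x)=\frac12$, $\mathcal K_{gen}(x,y)=\frac1{4N}$ if $x,y$ differ in exactly one coordinate, and $0$ otherwise. Let $T_\beta$ be its Metropolis chain for $\pi_\beta$: for $x\ne y$, $T_\beta(x,y)=\mathcal K_{gen}(x,y)$ if $H(y)\ge H(x)$, $T_\beta(x,y)=\mathcal K_{gen}(x,y)\,\pi_\beta(y)/\pi_\beta(x)$ otherwise, and $T_\beta(x,x)=1-\sum_{z\ne x}T_\beta(x,z)$. *Simulated tempering.* For $M\ge1$ put $\beta_i=\frac iM\beta$ and $\pi_i=\pi_{\beta_i}$ $(0\le i\le M)$. On $\Omega\times\{0,\dots,M\}$ let $\pi(\sigma,i)=\pi_i(\sigma)/(M+1)$,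 let $P_{st}((\sigma,i),(\sigma',i))=T_{\beta_i}(\sigma,\sigma')$, and let $Q((\sigma,i),(\sigma,j))=\frac1{2(M+1)}\min\{1,\pi_j(\sigma)/\pi_i(\sigma)\}$ if $|i-j|=1$, $Q((\sigma,i),(\sigma,i))=1-\sum_{k\neq i}Q((\sigma,i),(\sigma,k))$; all other entries of $P_{st}$ and $Q$ are $0$. The simulated tempering chain is $QP_{st}Q$. For a transition matrix $P$ let $\operatorname{Gap}(P)=1-\max\{|\lambda|:\lambda\ne1\text{ an eigenvalue of }P\}$. *Critical values.* Let $\mathcal E_{\beta,K}$ be the set of maximizers of $f_\beta(a)=\beta\big(-a_{-1}-a_1+K(a_1-a_{-1})^2\big)-\sum_i a_i\log a_i$ over probability vectors $a=(a_{-1},a_0,a_1)$; call $(\beta,K)$ multimodal if $\mathcal E_{\beta,K}$ has more than one element. For $\beta>\log 4$ let $K_c^{(1)}(\beta)=\inf\{K>0:(\beta,K)\text{ multimodal}\}$, and let $K_{\rm low}=\lim_{\beta\to\infty}K_c^{(1)}(\beta)$. Let $K_c=K_c^{(2)}(\log 4)$ with $K_c^{(2)}(\beta)=\frac1{4\beta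 e^{-\beta}}+\frac1{2\beta}$. For $K_{\rm low}<K<K_c$ let $\beta_c^{(1)}(K)=\inf\{\beta>0:(\beta,K)\text{ multimodal}\}$ (the point of the first-order phase transition). *Claim.* Let $K_{\rm low}<K<K_c$. There is a constant $c>0$, depending only on $K$, such that for every $\beta>\beta_c^{(1)}(K)$: 1. there is $N_0$ such that for all $N\ge N_0$ and all $M\ge1$, $$\operatorname{Gap}(QP_{st}Q)\le e^{-cN};$$ 2. for every choice of numbers $M=M(N)\ge1$, the simulated tempering algorithm is torpidly mixing: with $\tau_N(\varepsilon)$ the least $n$ such that, from every starting state, the law of the chain $QP_{st}Q$ at time $n$ is within total variation distance $\varepsilon$ of $\pi$, there is no polynomial $p$ with $\tau_N(\varepsilon)\le p(\varepsilon^{-1},N)$ for all $N\ge1$ and all $0<\varepsilon<1$. -/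

import Mathlib

open scoped BigOperators

namespace BEG

noncomputable section

/-! ### Finite Markov chains: spectral gap, total variation, mixing times -/

section Markov

variable {Ω : Type*} [Fintype Ω] [DecidableEq Ω]

/-- Spectral gap `1 - max {|μ| : μ an eigenvalue of P, μ ≠ 1}` of a transition matrix `P`.
(Over the field `ℝ` and for a finite matrix, the spectrum is the finite set of real eigenvalues;
all eigenvalues of a reversible chain are real.) -/
def spectralGap (P : Matrix Ω Ω ℝ) : ℝ :=
  1 - sSup ((fun μ : ℝ => |μ|) '' (spectrum ℝ P \ {1}))

/-- Total variation distance `sup_A |μ(A) - ν(A)|` of two distributions on a finite set, given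
by their weights. -/
def dTV (μ ν : Ω → ℝ) : ℝ :=
  ⨆ A : Finset Ω, |∑ x ∈ A, μ x - ∑ x ∈ A, ν x|

/-- Mixing time: the least `n` such that, from every starting state, the distribution at time `n`
is within total variation distance `ε` of `π`; it is `⊤` if there is no such `n`. -/
def mixingTime (P : Matrix Ω Ω ℝ) (π : Ω → ℝ) (ε : ℝ) : ℕ∞ :=
  ⨅ n ∈ {n : ℕ | ∀ x : Ω, dTV (fun y => (P ^ n) x y) π ≤ ε}, (n : ℕ∞)

/-- The matrix with the off-diagonal entries of `R` and with diagonal entries such that every row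
sums to one. -/
def completeDiag (R : Ω → Ω → ℝ) : Matrix Ω Ω ℝ :=
  fun x y => if x = y then 1 - ∑ z ∈ Finset.univ.erase x, R x z else R x y

/-- Gibbs measure of the energy function `H` (sign convention `exp (+ β H)`). -/
def gibbs (H : Ω → ℝ) (β : ℝ) (σ : Ω) : ℝ :=
  Real.exp (β * H σ) / ∑ τ, Real.exp (β * H τ)

/-- Metropolis-Hastings chain for the Gibbs measure at inverse temperature `β`, with base
chain `B`. -/
def metropolis (B : Matrix Ω Ω ℝ) (H : Ω → ℝ) (β : ℝ) : Matrix Ω Ω ℝ :=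
  completeDiag fun x y => if H x ≤ H y then B x y else B x y * (gibbs H β y / gibbs H β x)

/-! ### Simulated tempering on `Ω × {0, …, M}` -/

/-- The inverse temperatures `β_i = (i / M) β`. -/
def temp (β : ℝ) (M : ℕ) (i : Fin (M + 1)) : ℝ := ((i : ℕ) : ℝ) / (M : ℝ) * β

/-- The equilibrium measure `π(σ, i) = π_{β_i}(σ) / (M + 1)`. -/
def temperingMeasure (H : Ω → ℝ) (β : ℝ) (M : ℕ) (x : Ω × Fin (M + 1)) : ℝ :=
  gibbs H (temp β M x.2) x.1 / ((M : ℝ) + 1)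

/-- The move `P_st`: a Metropolis step at the current temperature. -/
def temperingP (B : Matrix Ω Ω ℝ) (H : Ω → ℝ) (β : ℝ) (M : ℕ) :
    Matrix (Ω × Fin (M + 1)) (Ω × Fin (M + 1)) ℝ :=
  fun x y => if x.2 = y.2 then metropolis B H (temp β M x.2) x.1 y.1 else 0

/-- The temperature proposal: nearest neighbour walk on `{0, …, M}` with
probability `1 / (2 (M + 1))` for each possible step. -/
def levelProposal (M : ℕ) : Matrix (Fin (M + 1)) (Fin (M + 1)) ℝ :=
  completeDiag fun i j =>
    if (i : ℕ) + 1 = (j : ℕ) ∨ (j : ℕ) + 1 = (i : ℕ) then 1 / (2 * ((M : ℝ) + 1)) else 0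

/-- The Metropolis chain on the temperatures for a fixed state `σ`. -/
def levelChain (H : Ω → ℝ) (β : ℝ) (M : ℕ) (σ : Ω) : Matrix (Fin (M + 1)) (Fin (M + 1)) ℝ :=
  completeDiag fun i j =>
    if gibbs H (temp β M i) σ ≤ gibbs H (temp β M j) σ then levelProposal M i j
    else levelProposal M i j * (gibbs H (temp β M j) σ / gibbs H (temp β M i) σ)

/-- The move `Q`: a temperature step at the current state. -/
def temperingQ (H : Ω → ℝ) (β : ℝ) (M : ℕ) :
    Matrix (Ω × Fin (M + 1)) (Ω × Fin (M + 1)) ℝ :=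
  fun x y => if x.1 = y.1 then levelChain H β M x.1 x.2 y.2 else 0

/-- The simulated tempering chain `Q P_st Q`. -/
def temperingChain (B : Matrix Ω Ω ℝ) (H : Ω → ℝ) (β : ℝ) (M : ℕ) :
    Matrix (Ω × Fin (M + 1)) (Ω × Fin (M + 1)) ℝ :=
  temperingQ H β M * temperingP B H β M * temperingQ H β M

end Markov

/-- A family of chains `P N` with equilibrium measures `π N`, indexed by the problem size `N ≥ 1`,
is rapidly mixing if its mixing time is bounded by a polynomial in `ε⁻¹` and `N`. -/
def RapidlyMixing {Ω : ℕ → Type} [∀ N, Fintype (Ω N)] [∀ N, DecidableEq (Ω N)]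
    (P : ∀ N, Matrix (Ω N) (Ω N) ℝ) (π : ∀ N, Ω N → ℝ) : Prop :=
  ∃ p : MvPolynomial (Fin 2) ℝ, ∀ N : ℕ, 1 ≤ N → ∀ ε : ℝ, 0 < ε → ε < 1 →
    ∃ n : ℕ, mixingTime (P N) (π N) ε = (n : ℕ∞) ∧
      (n : ℝ) ≤ MvPolynomial.eval ![ε⁻¹, (N : ℝ)] p

/-- Torpidly mixing means not rapidly mixing. -/
def TorpidlyMixing {Ω : ℕ → Type} [∀ N, Fintype (Ω N)] [∀ N, DecidableEq (Ω N)]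
    (P : ∀ N, Matrix (Ω N) (Ω N) ℝ) (π : ∀ N, Ω N → ℝ) : Prop :=
  ¬ RapidlyMixing P π

/-! ### The mean-field Blume-Emery-Griffiths model -/

/-- Configurations: `{-1, 0, 1}^N`. -/
abbrev Config (N : ℕ) : Type := Fin N → SignType

/-- `H(σ) = - ∑ σ_j ^ 2 + (K / N) (∑ σ_j) ^ 2`. -/
def hamiltonian (K : ℝ) (N : ℕ) (σ : Config N) : ℝ :=
  -∑ j, ((σ j : SignType) : ℝ) ^ 2 + K / (N : ℝ) * (∑ j, ((σ j : SignType) : ℝ)) ^ 2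

/-- The base chain: stay with probability `1 / 2`, and move to each configuration that differs in
exactly one spin with probability `1 / (4 N)`. -/
def baseChain (N : ℕ) : Matrix (Config N) (Config N) ℝ :=
  fun x y =>
    if x = y then 1 / 2
    else if (Finset.univ.filter fun i => x i ≠ y i).card = 1 then 1 / (4 * (N : ℝ)) else 0

/-- The simulated tempering chain `Q P_st Q` of the BEG model, with `M + 1` temperatures. -/
def begChain (K β : ℝ) (M N : ℕ) :
    Matrix (Config N × Fin (M + 1)) (Config N × Fin (M + 1)) ℝ :=
  temperingChain (baseChain N) (hamiltonian K N) β M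

/-- Its equilibrium measure. -/
def begMeasure (K β : ℝ) (M N : ℕ) : Config N × Fin (M + 1) → ℝ :=
  temperingMeasure (hamiltonian K N) β M

/-! ### Macrostates and critical values -/

/-- The function
`f_β(a) = β (-a₋₁ - a₁ + K (a₁ - a₋₁)²) - ∑ aᵢ log aᵢ` (with `0 log 0 = 0`). -/
def landscape (β K : ℝ) (a : SignType → ℝ) : ℝ :=
  β * (-a (-1) - a 1 + K * (a 1 - a (-1)) ^ 2) - ∑ i, a i * Real.log (a i)

/-- The set `𝓔_{β,K}` of equilibrium macrostates: the maximizers of `f_β` over all probability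
vectors on `{-1, 0, 1}`. -/
def macrostates (β K : ℝ) : Set (SignType → ℝ) :=
  {a | a ∈ stdSimplex ℝ SignType ∧ IsMaxOn (landscape β K) (stdSimplex ℝ SignType) a}

/-- The model has a phase coexistence: more than one equilibrium macrostate.  (There is always at
least one, since `f_β` is continuous on a compact set.) -/
def Multimodal (β K : ℝ) : Prop := (macrostates β K).Nontrivial

/-- `K_c^{(1)}(β)`: the critical `K` at fixed `β > log 4`, at which the model stops being
unimodal. -/
def criticalK (β : ℝ) : ℝ := sInf {K : ℝ | 0 < K ∧ Multimodal β K}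

/-- `K_low`, the limit of `K_c^{(1)}(β)` as `β → ∞`. -/
def Klow : ℝ := Filter.limUnder Filter.atTop criticalK

/-- `K_c^{(2)}(β) = 1 / (4 β e^{-β}) + 1 / (2 β)`. -/
def secondOrderK (β : ℝ) : ℝ := 1 / (4 * β * Real.exp (-β)) + 1 / (2 * β)

/-- The tricritical value `K_c = K_c^{(2)}(log 4)`. -/
def Kc : ℝ := secondOrderK (Real.log 4)

/-- The critical inverse temperature at fixed `K`, at which the model stops being unimodal as `β`
increases from `0`.  For `Klow < K < Kc` this is `β_c^{(1)}(K)`. -/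
def criticalBeta (K : ℝ) : ℝ := sInf {β : ℝ | 0 < β ∧ Multimodal β K}

end

end BEG

/-! The two critical values are explicit: `Klow = 1` (`Klow_eq`) and `Kc = 3 / (2 log 4)` (`Kc_eq`).
The order parameter is the total spin S. Linearizing the term b K S² / N at S = N m turns the Gibbs
weight into a product weight in the field t = 2bKm and produces the free energy F_b(m) = log(1 +
2e^{-b} cosh t) - bKm². Multimodality means exactly that some m ≠ 0 does at least as well as m = 0
(`multimodal_iff_ordered`).

The obstruction to mixing is the cut A = {|S| ≤ δN}, taken at all temperatures at once. Temperature
moves do not change S, so the flow of Q P Q through A is that of P (`cutFlow_mul_mul`), and it is at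
most the weight of a layer of width 2 outside A. The flow bounds the gap times π(A) π(Aᶜ)
(`spectralGap_mul_le_cutFlow`), and n times the flow bounds what can cross in n steps
(`mul_sub_le_of_dTV_le`). It remains to choose δ so that the layer is exponentially light at every
temperature, while both sides of the cut have at least inverse polynomial weight (`exists_cut`). Hot
levels have their free energy maximum at m = 0, inside the cut; cold levels have one at some m ≥ 2δ,
outside it; a fixed fraction of the levels is of each kind, for every M.

Such a δ exists because the transition is of first order. Put q = 2/(e^b + 2). For K < Kc the
transition lies above b = log 4 (`criticalBeta_properties`), where q < 1/3. There log(1 + q(cosh t -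
1))/t² increases for small t, so a nonzero maximizer of F_b has its field bounded away from 0
(`exists_field_bound`). Compactness in b, and a direct comparison with m = 1 for large b, which
needs K > 1, give a deficit c valid for all b ≥ 0 (`exists_shell`). Hence c depends on K only; β
enters only through the fractions of hot and cold levels.

That all b above the critical value are ordered is the hard analytic point (`Ordered.mono`). In
terms of the field, order means t² ≤ 4Kb(log Z_b(t) - log Z_b(0)) for some t ≠ 0, and the right side
must increase in b at a maximizer. This reduces to the inequality `mul_log_lt_of_le` in b and t,
proved with Padé bounds and numerical estimates. -/

namespace BEG

set_option linter.unusedSectionVars false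

/-! ### Cuts in reversible Markov chains -/

section Cuts

open Matrix

variable {Ω : Type*} [Fintype Ω] [DecidableEq Ω]

/-- `P` is a transition matrix that is reversible with respect to the probability weights `π`. -/
structure IsReversible (P : Matrix Ω Ω ℝ) (π : Ω → ℝ) : Prop where
  nonneg : ∀ x y, 0 ≤ P x y
  row_sum : ∀ x, ∑ y, P x y = 1
  pos : ∀ x, 0 < π x
  sum_eq_one : ∑ x, π x = 1
  balance : ∀ x y, π x * P x y = π y * P y x

/-- The equilibrium flow from `A` to its complement. -/
def cutFlow (P : Matrix Ω Ω ℝ) (π : Ω → ℝ) (A : Finset Ω) : ℝ :=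
  ∑ x ∈ A, ∑ y ∈ Aᶜ, π x * P x y

theorem IsReversible.stationary {P : Matrix Ω Ω ℝ} {π : Ω → ℝ} (h : IsReversible P π) (y : Ω) :
    ∑ x, π x * P x y = π y := by
  simp_rw [h.balance _ y, ← Finset.mul_sum, h.row_sum, mul_one]

/-! ### The variational principle for the spectral gap -/

theorem mem_spectrum_of_mulVec_eq {P : Matrix Ω Ω ℝ} {u : Ω → ℝ} {μ : ℝ} (hu : u ≠ 0)
    (h : P *ᵥ u = μ • u) : μ ∈ spectrum ℝ P := by
  rw [← Matrix.spectrum_toLin']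
  exact Module.End.HasEigenvalue.mem_spectrum
    (Module.End.hasEigenvalue_of_hasEigenvector
      ⟨Module.End.mem_eigenspace_iff.2 (by simpa using h), hu⟩)

theorem abs_le_one_sub_spectralGap {P : Matrix Ω Ω ℝ} {μ : ℝ} (h : μ ∈ spectrum ℝ P)
    (h1 : μ ≠ 1) : |μ| ≤ 1 - spectralGap P := by
  -- Finiteness of the spectrum makes the set bounded above, so that `sSup` is a genuine supremum
  -- and not its default value.
  have hfin : ((fun μ : ℝ => |μ|) '' (spectrum ℝ P \ {1})).Finite :=
    ((Matrix.finite_real_spectrum (A := P)).subset Set.sdiff_subset).image _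
  have := le_csSup hfin.bddAbove (Set.mem_image_of_mem (fun μ : ℝ => |μ|)
    (show μ ∈ spectrum ℝ P \ {1} from ⟨h, h1⟩))
  unfold spectralGap
  have h2 : |μ| ≤ sSup ((fun μ : ℝ => |μ|) '' (spectrum ℝ P \ {1})) := this
  linarith

/-- The spectral expansion of the quadratic form of a symmetric matrix. -/
theorem exists_spectral_expansion {S : Matrix Ω Ω ℝ} (hS : S.IsHermitian) :
    ∃ (ev : Ω → ℝ) (e : Ω → Ω → ℝ), (∀ i, e i ≠ 0 ∧ S *ᵥ e i = ev i • e i) ∧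
      ∀ φ : Ω → ℝ, φ ⬝ᵥ φ = ∑ i, (e i ⬝ᵥ φ) ^ 2 ∧
        φ ⬝ᵥ S *ᵥ φ = ∑ i, ev i * (e i ⬝ᵥ φ) ^ 2 := by
  refine ⟨hS.eigenvalues, fun i => ⇑(hS.eigenvectorBasis i), fun i => ⟨?_, ?_⟩, fun φ => ?_⟩
  · intro h0
    have h1 : hS.eigenvectorBasis i ≠ 0 := hS.eigenvectorBasis.orthonormal.ne_zero i
    exact h1 (by ext j; exact congrFun h0 j)
  · exact hS.mulVec_eigenvectorBasis i
  · have key : ∀ ψ : Ω → ℝ, φ ⬝ᵥ ψ =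
        ∑ i, (⇑(hS.eigenvectorBasis i) ⬝ᵥ φ) * (⇑(hS.eigenvectorBasis i) ⬝ᵥ ψ) := by
      intro ψ
      have h := hS.eigenvectorBasis.sum_inner_mul_inner (WithLp.toLp 2 φ) (WithLp.toLp 2 ψ)
      simp only [EuclideanSpace.inner_eq_star_dotProduct, star_trivial] at h
      rw [dotProduct_comm, ← h]
      refine Finset.sum_congr rfl fun i _ => ?_
      rw [dotProduct_comm ψ]
    refine ⟨?_, ?_⟩
    · rw [key φ]
      exact Finset.sum_congr rfl fun i _ => by ring
    · rw [key (S *ᵥ φ)]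
      refine Finset.sum_congr rfl fun i _ => ?_
      have hT : Sᵀ = S := by
        rw [← conjTranspose_eq_transpose_of_trivial]; exact hS
      rw [dotProduct_mulVec, ← mulVec_transpose, hT, hS.mulVec_eigenvectorBasis i, smul_dotProduct,
        smul_eq_mul]
      ring

/-- Variational bound: the spectral gap is at most the Rayleigh quotient of a centred function. -/
theorem spectralGap_mul_le {P : Matrix Ω Ω ℝ} {π : Ω → ℝ} (h : IsReversible P π)
    (hirr : ∀ g : Ω → ℝ, P *ᵥ g = g → ∀ x y, g x = g y) (f : Ω → ℝ) (hf : ∑ x, π x * f x = 0) :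
    spectralGap P * ∑ x, π x * f x ^ 2 ≤
      ∑ x, π x * f x ^ 2 - ∑ x, ∑ y, π x * P x y * (f x * f y) := by
  -- By detailed balance, conjugation by √π turns P into a symmetric matrix S; an eigenvector e of S
  -- corresponds to the eigenfunction e/√π of P.
  set r : Ω → ℝ := fun x => Real.sqrt (π x) with hr
  have hr0 : ∀ x, 0 < r x := fun x => Real.sqrt_pos.2 (h.pos x)
  have hrr : ∀ x, r x * r x = π x := fun x => Real.mul_self_sqrt (h.pos x).le
  obtain ⟨S, hSdef⟩ : ∃ S : Matrix Ω Ω ℝ, ∀ x y, S x y = r x * P x y / r y :=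
    ⟨Matrix.of fun x y => r x * P x y / r y, fun _ _ => rfl⟩
  have hS : S.IsHermitian := by
    ext x y
    rw [conjTranspose_apply, star_trivial, hSdef, hSdef]
    rw [div_eq_div_iff (hr0 _).ne' (hr0 _).ne']
    have := h.balance x y
    rw [← hrr, ← hrr] at this
    linarith
  obtain ⟨ev, e, he, hexp⟩ := exists_spectral_expansion hS
  set φ : Ω → ℝ := fun x => r x * f x with hφ
  have hφφ : φ ⬝ᵥ φ = ∑ x, π x * f x ^ 2 := by
    refine Finset.sum_congr rfl fun x _ => ?_
    rw [← hrr x]; simp only [hφ]; ring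
  have hφS : φ ⬝ᵥ S *ᵥ φ = ∑ x, ∑ y, π x * P x y * (f x * f y) := by
    simp only [dotProduct, mulVec, Finset.mul_sum]
    refine Finset.sum_congr rfl fun x _ => Finset.sum_congr rfl fun y _ => ?_
    rw [← hrr x]; simp only [hφ, hSdef]
    have := (hr0 y).ne'
    field_simp
  have hharm : ∀ i, P *ᵥ (fun x => e i x / r x) = ev i • fun x => e i x / r x := by
    intro i
    ext x
    have h1 := congrFun (he i).2 x
    simp only [mulVec, dotProduct, hSdef, Pi.smul_apply, smul_eq_mul] at h1 ⊢
    have h2 : ∑ y, P x y * (e i y / r y) = (∑ y, r x * P x y / r y * e i y) / r x := by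
      rw [Finset.sum_div]
      refine Finset.sum_congr rfl fun y _ => ?_
      have := (hr0 x).ne'
      field_simp
    rw [h2, h1]; ring
  have hterm : ∀ i, ev i * (e i ⬝ᵥ φ) ^ 2 ≤ (1 - spectralGap P) * (e i ⬝ᵥ φ) ^ 2 := by
    intro i
    -- The gap says nothing about the eigenvalue 1. Its eigenfunctions are constant by `hirr`, hence
    -- orthogonal to the centred f.
    by_cases h1 : ev i = 1
    · have hc := hirr _ (by simpa [h1] using hharm i)
      have h0 : e i ⬝ᵥ φ = 0 := by
        obtain ⟨x₀, -⟩ := Function.ne_iff.1 (he i).1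
        have hval : ∀ x, e i x * φ x = e i x₀ / r x₀ * (π x * f x) := by
          intro x
          rw [← hc x x₀, ← hrr x]; simp only [hφ]
          have := (hr0 x).ne'
          field_simp
        simp only [dotProduct, hval, ← Finset.mul_sum, hf, mul_zero]
      simp [h0]
    · have hu : (fun x => e i x / r x) ≠ 0 := by
        intro h0
        apply (he i).1
        ext x
        have := congrFun h0 x
        simp only [Pi.zero_apply, div_eq_zero_iff, (hr0 x).ne', or_false] at this
        exact this
      have := abs_le_one_sub_spectralGap (mem_spectrum_of_mulVec_eq hu (hharm i)) h1
      gcongr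
      exact (le_abs_self _).trans this
  have hsum : φ ⬝ᵥ S *ᵥ φ ≤ (1 - spectralGap P) * (φ ⬝ᵥ φ) := by
    rw [(hexp φ).1, (hexp φ).2, Finset.mul_sum]
    exact Finset.sum_le_sum fun i _ => hterm i
  rw [hφS, hφφ] at hsum
  linarith

/-- The spectral gap is at most the flow through a cut divided by the weights of its sides. -/
theorem spectralGap_mul_le_cutFlow {P : Matrix Ω Ω ℝ} {π : Ω → ℝ} (h : IsReversible P π)
    (hirr : ∀ g : Ω → ℝ, P *ᵥ g = g → ∀ x y, g x = g y) (A : Finset Ω) :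
    spectralGap P * ((∑ x ∈ A, π x) * ∑ x ∈ Aᶜ, π x) ≤ cutFlow P π A := by
  set a : Ω → ℝ := fun x => if x ∈ A then 1 else 0 with ha
  set p := ∑ x ∈ A, π x with hp
  have hp1 : ∑ x ∈ Aᶜ, π x = 1 - p := by
    rw [← h.sum_eq_one, ← Finset.sum_add_sum_compl A π]; ring
  have hpa : ∑ x, π x * a x = p := by simp [ha, hp]
  have haa : ∀ x, a x ^ 2 = a x := fun x => by simp only [ha]; split_ifs <;> simp
  have hvar : ∑ x, π x * (a x - p) ^ 2 = p * (1 - p) := by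
    have : ∀ x, π x * (a x - p) ^ 2 = (1 - 2 * p) * (π x * a x) + p ^ 2 * π x := by
      intro x; linear_combination π x * haa x
    simp_rw [this, Finset.sum_add_distrib, ← Finset.mul_sum, hpa, h.sum_eq_one]
    ring
  have hcen : ∑ x, π x * (a x - p) = 0 := by
    simp_rw [mul_sub, Finset.sum_sub_distrib, hpa, ← Finset.sum_mul, h.sum_eq_one]; ring
  have hmain := spectralGap_mul_le h hirr (fun x => a x - p) hcen
  rw [hp1]
  rw [hvar] at hmain
  refine hmain.trans (le_of_eq ?_)
  have hflow : cutFlow P π A = ∑ x, ∑ y, π x * P x y * (a x * (1 - a y)) := by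
    unfold cutFlow
    rw [← Finset.sum_subset (Finset.subset_univ A)]
    · refine Finset.sum_congr rfl fun x hx => ?_
      rw [← Finset.sum_subset (Finset.subset_univ Aᶜ)]
      · refine Finset.sum_congr rfl fun y hy => ?_
        simp [ha, hx, Finset.mem_compl.1 hy]
      · intro y _ hy
        simp [ha, Finset.mem_compl] at hy ⊢
        simp [hy]
    · intro x _ hx
      simp [ha, hx]
  have h1 : ∑ x, ∑ y, π x * P x y * ((a x - p) * (a y - p)) =
      ∑ x, ∑ y, π x * P x y * (a x * a y) - p ^ 2 := by
    have e1 : ∑ x, ∑ y, π x * P x y * a x = p := by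
      rw [← hpa]
      refine Finset.sum_congr rfl fun x _ => ?_
      rw [← Finset.sum_mul, ← Finset.mul_sum, h.row_sum, mul_one]
    have e2 : ∑ x, ∑ y, π x * P x y * a y = p := by
      rw [Finset.sum_comm, ← hpa]
      refine Finset.sum_congr rfl fun y _ => ?_
      rw [← Finset.sum_mul, h.stationary]
    have e3 : ∑ x, ∑ y, π x * P x y = 1 := by
      rw [← h.sum_eq_one]
      refine Finset.sum_congr rfl fun x _ => ?_
      rw [← Finset.mul_sum, h.row_sum, mul_one]
    have e4 : ∀ x y, π x * P x y * ((a x - p) * (a y - p)) = π x * P x y * (a x * a y) -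
        p * (π x * P x y * a x) - p * (π x * P x y * a y) + p ^ 2 * (π x * P x y) := by
      intro x y; ring
    have hm : ∀ (k : ℝ) (F : Ω → Ω → ℝ), ∑ x, ∑ y, k * F x y = k * ∑ x, ∑ y, F x y :=
      fun k F => by simp only [Finset.mul_sum]
    simp_rw [e4, Finset.sum_add_distrib, Finset.sum_sub_distrib]
    rw [hm, hm, hm, e1, e2, e3]
    ring
  have h2 : ∑ x, ∑ y, π x * P x y * (a x * (1 - a y)) =
      p - ∑ x, ∑ y, π x * P x y * (a x * a y) := by
    have e1 : ∑ x, ∑ y, π x * P x y * a x = p := by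
      rw [← hpa]
      refine Finset.sum_congr rfl fun x _ => ?_
      rw [← Finset.sum_mul, ← Finset.mul_sum, h.row_sum, mul_one]
    have e4 : ∀ x y, π x * P x y * (a x * (1 - a y)) = π x * P x y * a x -
        π x * P x y * (a x * a y) := by
      intro x y; ring
    simp_rw [e4, Finset.sum_sub_distrib, e1]
  rw [hflow, h1, h2]
  ring

/-! ### Powers of the chain and mixing times -/

theorem IsReversible.pow_nonneg {P : Matrix Ω Ω ℝ} {π : Ω → ℝ} (h : IsReversible P π) (n : ℕ)
    (x y : Ω) : 0 ≤ (P ^ n) x y := by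
  induction n generalizing y with
  | zero => simp only [pow_zero, Matrix.one_apply]; split_ifs <;> simp
  | succ n ih =>
    rw [pow_succ, Matrix.mul_apply]
    exact Finset.sum_nonneg fun z _ => mul_nonneg (ih z) (h.nonneg z y)

theorem IsReversible.pow_stationary {P : Matrix Ω Ω ℝ} {π : Ω → ℝ} (h : IsReversible P π) (n : ℕ)
    (y : Ω) : ∑ x, π x * (P ^ n) x y = π y := by
  induction n generalizing y with
  | zero => simp [Matrix.one_apply]
  | succ n ih =>
    simp_rw [pow_succ, Matrix.mul_apply, Finset.mul_sum]
    rw [Finset.sum_comm]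
    simp_rw [← mul_assoc, ← Finset.sum_mul, ih, h.stationary]

/-- Mass started from π on A and found outside at time n + 1 was either outside at time n or crosses
in the last step. The mass present at z at time n is at most π z, by stationarity, so the last step
costs at most one flow. -/
theorem cutFlow_pow_le {P : Matrix Ω Ω ℝ} {π : Ω → ℝ} (h : IsReversible P π) (A : Finset Ω)
    (n : ℕ) : cutFlow (P ^ n) π A ≤ n * cutFlow P π A := by
  induction n with
  | zero =>
    simp only [pow_zero, Nat.cast_zero, zero_mul, cutFlow]
    refine le_of_eq (Finset.sum_eq_zero fun x hx => Finset.sum_eq_zero fun y hy => ?_)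
    have : x ≠ y := fun hxy => Finset.mem_compl.1 hy (hxy ▸ hx)
    simp [this]
  | succ n ih =>
    set w : Ω → ℝ := fun z => ∑ x ∈ A, π x * (P ^ n) x z with hw
    have hw0 : ∀ z, 0 ≤ w z := fun z =>
      Finset.sum_nonneg fun x _ => mul_nonneg (h.pos x).le (h.pow_nonneg n x z)
    have hwπ : ∀ z, w z ≤ π z := fun z => by
      rw [← h.pow_stationary n z]
      exact Finset.sum_le_sum_of_subset_of_nonneg (Finset.subset_univ A)
        fun x _ _ => mul_nonneg (h.pos x).le (h.pow_nonneg n x z)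
    have h1 : cutFlow (P ^ (n + 1)) π A = ∑ z, w z * ∑ y ∈ Aᶜ, P z y := by
      simp only [cutFlow, hw, pow_succ, Matrix.mul_apply]
      calc ∑ x ∈ A, ∑ y ∈ Aᶜ, π x * ∑ z, (P ^ n) x z * P z y
          = ∑ x ∈ A, ∑ z, ∑ y ∈ Aᶜ, π x * ((P ^ n) x z * P z y) := by
            refine Finset.sum_congr rfl fun x _ => ?_
            simp only [Finset.mul_sum]
            exact Finset.sum_comm
        _ = ∑ z, ∑ x ∈ A, ∑ y ∈ Aᶜ, π x * ((P ^ n) x z * P z y) := Finset.sum_comm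
        _ = _ := by
            refine Finset.sum_congr rfl fun z _ => ?_
            rw [Finset.sum_mul]
            refine Finset.sum_congr rfl fun x _ => ?_
            rw [Finset.mul_sum]
            exact Finset.sum_congr rfl fun y _ => by ring
    have h2 : cutFlow (P ^ n) π A = ∑ z ∈ Aᶜ, w z := by
      simp only [cutFlow, hw]
      exact Finset.sum_comm
    rw [h1, ← Finset.sum_add_sum_compl A]
    have h3 : ∑ z ∈ A, w z * ∑ y ∈ Aᶜ, P z y ≤ cutFlow P π A := by
      unfold cutFlow
      refine Finset.sum_le_sum fun z _ => ?_
      rw [← Finset.mul_sum]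
      exact mul_le_mul_of_nonneg_right (hwπ z) (Finset.sum_nonneg fun y _ => h.nonneg z y)
    have h4 : ∑ z ∈ Aᶜ, w z * ∑ y ∈ Aᶜ, P z y ≤ ∑ z ∈ Aᶜ, w z := by
      refine Finset.sum_le_sum fun z _ => ?_
      refine mul_le_of_le_one_right (hw0 z) ?_
      rw [← h.row_sum z]
      exact Finset.sum_le_sum_of_subset_of_nonneg (Finset.subset_univ _)
        fun y _ _ => h.nonneg z y
    push_cast
    linarith

theorem abs_sub_le_dTV (μ ν : Ω → ℝ) (A : Finset Ω) :
    |∑ x ∈ A, μ x - ∑ x ∈ A, ν x| ≤ dTV μ ν :=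
  le_ciSup (f := fun A : Finset Ω => |∑ x ∈ A, μ x - ∑ x ∈ A, ν x|)
    (Set.finite_range _).bddAbove A

/-- A chain that is within `ε` of equilibrium at time `n` has crossed every cut. -/
theorem mul_sub_le_of_dTV_le {P : Matrix Ω Ω ℝ} {π : Ω → ℝ} (h : IsReversible P π)
    (A : Finset Ω) {n : ℕ} {ε : ℝ} (hn : ∀ x, dTV (fun y => (P ^ n) x y) π ≤ ε) :
    (∑ x ∈ A, π x) * (∑ x ∈ Aᶜ, π x - ε) ≤ n * cutFlow P π A := by
  refine le_trans ?_ (cutFlow_pow_le h A n)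
  unfold cutFlow
  rw [Finset.sum_mul]
  refine Finset.sum_le_sum fun x _ => ?_
  rw [← Finset.mul_sum]
  refine mul_le_mul_of_nonneg_left ?_ (h.pos x).le
  have h1 := (abs_sub_le_dTV (fun y => (P ^ n) x y) π Aᶜ).trans (hn x)
  linarith [(abs_le.1 h1).1]

theorem dTV_le_of_mixingTime_eq {P : Matrix Ω Ω ℝ} {π : Ω → ℝ} {ε : ℝ} {n : ℕ}
    (h : mixingTime P π ε = (n : ℕ∞)) (x : Ω) : dTV (fun y => (P ^ n) x y) π ≤ ε := by
  classical
  unfold mixingTime at h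
  set S := {n : ℕ | ∀ x : Ω, dTV (fun y => (P ^ n) x y) π ≤ ε} with hS
  have hne : ∃ m, m ∈ S := by
    by_contra! h0
    have : (⨅ n ∈ S, (n : ℕ∞)) = ⊤ := by simp [h0]
    rw [this] at h
    exact ENat.top_ne_natCast n h
  have hfind : (⨅ n ∈ S, (n : ℕ∞)) = (Nat.find hne : ℕ∞) := by
    apply le_antisymm
    · exact iInf₂_le _ (Nat.find_spec hne)
    · exact le_iInf₂ fun m hm => Nat.cast_le.2 (Nat.find_min' hne hm)
  rw [hfind] at h
  have h1 : Nat.find hne = n := by exact_mod_cast h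
  have h2 := Nat.find_spec hne
  rw [h1] at h2
  exact h2 x

/-- A harmonic function of a reversible chain is constant along transitions. -/
theorem IsReversible.eq_of_mulVec_eq {P : Matrix Ω Ω ℝ} {π : Ω → ℝ} (h : IsReversible P π)
    {g : Ω → ℝ} (hg : P *ᵥ g = g) {x y : Ω} (hxy : 0 < P x y) : g x = g y := by
  have hg' : ∀ x, ∑ y, P x y * g y = g x := fun x => congrFun hg x
  -- Harmonicity and stationarity make the Dirichlet form of g vanish; its terms are nonnegative, so
  -- each of them is zero.
  have hzero : ∑ x, ∑ y, π x * P x y * (g x - g y) ^ 2 = 0 := by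
    have e : ∀ x y, π x * P x y * (g x - g y) ^ 2 = π x * P x y * g x ^ 2
        - 2 * (π x * g x * (P x y * g y)) + π x * P x y * g y ^ 2 := by intro x y; ring
    simp_rw [e, Finset.sum_add_distrib, Finset.sum_sub_distrib]
    have e1 : ∑ x, ∑ y, π x * P x y * g x ^ 2 = ∑ x, π x * g x ^ 2 := by
      refine Finset.sum_congr rfl fun x _ => ?_
      rw [← Finset.sum_mul, ← Finset.mul_sum, h.row_sum, mul_one]
    have e2 : ∑ x, ∑ y, π x * P x y * g y ^ 2 = ∑ x, π x * g x ^ 2 := by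
      rw [Finset.sum_comm]
      refine Finset.sum_congr rfl fun y _ => ?_
      rw [← Finset.sum_mul, h.stationary]
    have e3 : ∑ x, ∑ y, 2 * (π x * g x * (P x y * g y)) = 2 * ∑ x, π x * g x ^ 2 := by
      rw [Finset.mul_sum]
      refine Finset.sum_congr rfl fun x _ => ?_
      rw [← Finset.mul_sum, ← Finset.mul_sum, hg']; ring
    rw [e1, e2, e3]; ring
  have hnn : ∀ x y, 0 ≤ π x * P x y * (g x - g y) ^ 2 := fun x y =>
    mul_nonneg (mul_nonneg (h.pos x).le (h.nonneg x y)) (sq_nonneg _)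
  have h1 := (Finset.sum_eq_zero_iff_of_nonneg fun x _ =>
    Finset.sum_nonneg fun y _ => hnn x y).1 hzero x (Finset.mem_univ x)
  have h2 := (Finset.sum_eq_zero_iff_of_nonneg fun y _ => hnn x y).1 h1 y (Finset.mem_univ y)
  have h3 : (g x - g y) ^ 2 = 0 :=
    (mul_eq_zero.1 h2).resolve_left (mul_pos (h.pos x) hxy).ne'
  linarith [pow_eq_zero_iff (two_ne_zero) |>.1 h3]

/-- As a bilinear form, the flow lets the outer factors of a product of matrices act on the measure
and on the indicator separately. -/
theorem cutFlow_eq_dotProduct (P : Matrix Ω Ω ℝ) (π : Ω → ℝ) (A : Finset Ω) :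
    cutFlow P π A =
      (fun x => if x ∈ A then π x else 0) ⬝ᵥ P *ᵥ (fun y => if y ∈ A then 0 else 1) := by
  have h1 : ∀ x, ∑ y, P x y * (if y ∈ A then 0 else 1) = ∑ y ∈ Aᶜ, P x y := by
    intro x
    rw [← Finset.sum_add_sum_compl A, Finset.sum_eq_zero fun y hy => by simp [hy], zero_add]
    exact Finset.sum_congr rfl fun y hy => by simp [Finset.mem_compl.1 hy]
  simp only [dotProduct, mulVec, h1, ite_mul, zero_mul, Finset.sum_ite_mem, Finset.univ_inter,
    cutFlow]
  exact Finset.sum_congr rfl fun x _ => (Finset.mul_sum _ _ _).symm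

/-- The flow of `Q * T * Q` through a cut that `Q` does not cross is the flow of `T`. -/
theorem cutFlow_mul_mul {Q T : Matrix Ω Ω ℝ} {π : Ω → ℝ} (hQ : IsReversible Q π)
    (A : Finset Ω) (hA : ∀ x y, Q x y ≠ 0 → (x ∈ A ↔ y ∈ A)) :
    cutFlow (Q * T * Q) π A = cutFlow T π A := by
  -- Since Q does not cross the cut, π restricted to A is Q-invariant, and in `h2` the indicator of
  -- the complement is Q-harmonic.
  have h1 : (fun x => if x ∈ A then π x else 0) ᵥ* Q = fun x => if x ∈ A then π x else 0 := by
    ext u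
    have : ∀ x, (if x ∈ A then π x else 0) * Q x u = (if u ∈ A then 1 else 0) * (π x * Q x u) := by
      intro x
      by_cases h0 : Q x u = 0
      · simp [h0]
      · simp only [hA x u h0]; split_ifs <;> simp
    simp only [vecMul, dotProduct, this, ← Finset.mul_sum, hQ.stationary]
    split_ifs <;> simp
  have h2 : Q *ᵥ (fun y => if y ∈ A then (0 : ℝ) else 1) = fun y => if y ∈ A then 0 else 1 := by
    ext v
    have : ∀ y, Q v y * (if y ∈ A then 0 else 1) = (if v ∈ A then 0 else 1) * Q v y := by
      intro y
      by_cases h0 : Q v y = 0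
      · simp [h0]
      · simp only [hA v y h0]; split_ifs <;> simp
    simp only [mulVec, dotProduct, this, ← Finset.mul_sum, hQ.row_sum, mul_one]
  rw [cutFlow_eq_dotProduct, cutFlow_eq_dotProduct, ← mulVec_mulVec, ← mulVec_mulVec, h2,
    dotProduct_mulVec, h1]

/-- The flow through a cut is at most the weight of its outer boundary. -/
theorem cutFlow_le_of_boundary {T : Matrix Ω Ω ℝ} {π : Ω → ℝ} (hT : IsReversible T π)
    (A B : Finset Ω) (hB : ∀ x ∈ A, ∀ y ∉ A, T x y ≠ 0 → y ∈ B) :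
    cutFlow T π A ≤ ∑ y ∈ B, π y := by
  unfold cutFlow
  -- Summed by the point of arrival y: by stationarity, the mass entering y in one step is at most π
  -- y.
  rw [Finset.sum_comm]
  have h1 : ∀ y ∈ Aᶜ, y ∉ Aᶜ ∩ B → ∑ x ∈ A, π x * T x y = 0 := by
    intro y hy hyB
    refine Finset.sum_eq_zero fun x hx => ?_
    by_contra h0
    exact hyB (Finset.mem_inter.2 ⟨hy, hB x hx y (Finset.mem_compl.1 hy) (right_ne_zero_of_mul h0)⟩)
  rw [← Finset.sum_subset Finset.inter_subset_left h1]
  calc ∑ y ∈ Aᶜ ∩ B, ∑ x ∈ A, π x * T x y ≤ ∑ y ∈ Aᶜ ∩ B, π y := by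
        refine Finset.sum_le_sum fun y _ => ?_
        rw [← hT.stationary y]
        exact Finset.sum_le_sum_of_subset_of_nonneg (Finset.subset_univ A)
          fun x _ _ => mul_nonneg (hT.pos x).le (hT.nonneg x y)
    _ ≤ ∑ y ∈ B, π y :=
        Finset.sum_le_sum_of_subset_of_nonneg Finset.inter_subset_right fun y _ _ => (hT.pos y).le

/-- The product is a palindrome: transposing it against `diagonal π` moves each factor across and
restores the order. -/
theorem IsReversible.mul_mul {Q T : Matrix Ω Ω ℝ} {π : Ω → ℝ} (hQ : IsReversible Q π)
    (hT : IsReversible T π) : IsReversible (Q * T * Q) π where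
  nonneg x y := by
    simp only [Matrix.mul_apply]
    exact Finset.sum_nonneg fun v _ => mul_nonneg (Finset.sum_nonneg fun u _ =>
      mul_nonneg (hQ.nonneg x u) (hT.nonneg u v)) (hQ.nonneg v y)
  row_sum x := by
    have h1 : ∀ R : Matrix Ω Ω ℝ, (∀ x, ∑ y, R x y = 1) ↔ R *ᵥ 1 = 1 := by
      intro R
      simp [funext_iff, Matrix.mulVec, dotProduct]
    refine (h1 (Q * T * Q)).2 ?_ x
    rw [← Matrix.mulVec_mulVec, ← Matrix.mulVec_mulVec, (h1 Q).1 hQ.row_sum, (h1 T).1 hT.row_sum,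
      (h1 Q).1 hQ.row_sum]
  pos := hQ.pos
  sum_eq_one := hQ.sum_eq_one
  balance x y := by
    have hD : ∀ R : Matrix Ω Ω ℝ, (∀ x y, π x * R x y = π y * R y x) ↔
        Matrix.diagonal π * R = Rᵀ * Matrix.diagonal π := by
      intro R
      simp only [← Matrix.ext_iff, Matrix.diagonal_mul, Matrix.mul_diagonal, Matrix.transpose_apply]
      exact forall₂_congr fun x y => by rw [mul_comm (R y x)]
    refine (hD (Q * T * Q)).2 ?_ x y
    have hq := (hD Q).1 hQ.balance
    have ht := (hD T).1 hT.balance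
    calc Matrix.diagonal π * (Q * T * Q) = (Matrix.diagonal π * Q) * T * Q := by
          simp only [Matrix.mul_assoc]
      _ = Qᵀ * (Matrix.diagonal π * T) * Q := by rw [hq]; simp only [Matrix.mul_assoc]
      _ = Qᵀ * Tᵀ * (Matrix.diagonal π * Q) := by rw [ht]; simp only [Matrix.mul_assoc]
      _ = (Q * T * Q)ᵀ * Matrix.diagonal π := by
          rw [hq, Matrix.transpose_mul, Matrix.transpose_mul]; simp only [Matrix.mul_assoc]

theorem mul_mul_pos_of_pos {Q T : Matrix Ω Ω ℝ} (hQ : ∀ x y, 0 ≤ Q x y) (hT : ∀ x y, 0 ≤ T x y)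
    {x u v y : Ω} (h1 : 0 < Q x u) (h2 : 0 < T u v) (h3 : 0 < Q v y) :
    0 < (Q * T * Q) x y := by
  simp only [Matrix.mul_apply]
  have h4 : 0 < ∑ u, Q x u * T u v :=
    Finset.sum_pos' (fun u _ => mul_nonneg (hQ x u) (hT u v)) ⟨u, Finset.mem_univ u, mul_pos h1 h2⟩
  exact Finset.sum_pos' (fun v _ => mul_nonneg (Finset.sum_nonneg fun u _ =>
    mul_nonneg (hQ x u) (hT u v)) (hQ v y)) ⟨v, Finset.mem_univ v, mul_pos h4 h3⟩

/-! ### Completing a matrix on the diagonal -/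

theorem completeDiag_of_ne (R : Ω → Ω → ℝ) {x y : Ω} (h : x ≠ y) : completeDiag R x y = R x y :=
  if_neg h

theorem completeDiag_row_sum (R : Ω → Ω → ℝ) (x : Ω) : ∑ y, completeDiag R x y = 1 := by
  rw [← Finset.add_sum_erase _ _ (Finset.mem_univ x)]
  have : ∑ y ∈ Finset.univ.erase x, completeDiag R x y = ∑ y ∈ Finset.univ.erase x, R x y :=
    Finset.sum_congr rfl fun y hy => completeDiag_of_ne R (Finset.ne_of_mem_erase hy).symm
  rw [this]
  simp [completeDiag]

theorem half_le_completeDiag {R : Ω → Ω → ℝ} {x : Ω}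
    (h : ∑ z ∈ Finset.univ.erase x, R x z ≤ 1 / 2) : 1 / 2 ≤ completeDiag R x x := by
  simp only [completeDiag, if_true]
  linarith

theorem completeDiag_nonneg {R : Ω → Ω → ℝ} (hR : ∀ x y, x ≠ y → 0 ≤ R x y)
    (h : ∀ x, ∑ z ∈ Finset.univ.erase x, R x z ≤ 1 / 2) (x y : Ω) : 0 ≤ completeDiag R x y := by
  by_cases hxy : x = y
  · subst hxy; linarith [half_le_completeDiag (h x)]
  · rw [completeDiag_of_ne R hxy]; exact hR x y hxy

theorem completeDiag_balance {R : Ω → Ω → ℝ} {π : Ω → ℝ}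
    (h : ∀ x y, x ≠ y → π x * R x y = π y * R y x) (x y : Ω) :
    π x * completeDiag R x y = π y * completeDiag R y x := by
  by_cases hxy : x = y
  · rw [hxy]
  · rw [completeDiag_of_ne R hxy, completeDiag_of_ne R (Ne.symm hxy)]; exact h x y hxy

end Cuts

end BEG

namespace BEG

set_option linter.unusedSectionVars false

/-! ### Reversibility of the tempering chain -/

section Tempering

variable {Ω : Type*} [Fintype Ω] [DecidableEq Ω]

theorem gibbs_pos [Nonempty Ω] (H : Ω → ℝ) (b : ℝ) (x : Ω) : 0 < gibbs H b x :=
  div_pos (Real.exp_pos _) (Finset.sum_pos (fun _ _ => Real.exp_pos _) Finset.univ_nonempty)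

theorem sum_gibbs [Nonempty Ω] (H : Ω → ℝ) (b : ℝ) : ∑ x, gibbs H b x = 1 := by
  unfold gibbs
  rw [← Finset.sum_div]
  exact div_self (Finset.sum_pos (fun _ _ => Real.exp_pos _) Finset.univ_nonempty).ne'

theorem gibbs_le_gibbs [Nonempty Ω] {H : Ω → ℝ} {b : ℝ} (hb : 0 ≤ b) {x y : Ω} (h : H x ≤ H y) :
    gibbs H b x ≤ gibbs H b y := by
  unfold gibbs
  gcongr

/-- A base chain: symmetric, and moving with probability at most one half. -/
structure IsBaseChain (B : Matrix Ω Ω ℝ) : Prop where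
  nonneg : ∀ x y, 0 ≤ B x y
  symm : ∀ x y, B x y = B y x
  lazy : ∀ x, ∑ z ∈ Finset.univ.erase x, B x z ≤ 1 / 2

theorem metropolis_isReversible [Nonempty Ω] {B : Matrix Ω Ω ℝ} (hB : IsBaseChain B) (H : Ω → ℝ)
    {b : ℝ} (hb : 0 ≤ b) :
    IsReversible (metropolis B H b) (gibbs H b) ∧ ∀ x, 1 / 2 ≤ metropolis B H b x x := by
  have hpos := gibbs_pos H b
  have hnn : ∀ x y, 0 ≤ if H x ≤ H y then B x y else B x y * (gibbs H b y / gibbs H b x) := by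
    intro x y
    have := hB.nonneg x y
    have := hpos x
    have := hpos y
    split_ifs <;> positivity
  have hlazy : ∀ x, ∑ z ∈ Finset.univ.erase x,
      (if H x ≤ H z then B x z else B x z * (gibbs H b z / gibbs H b x)) ≤ 1 / 2 := by
    intro x
    refine le_trans (Finset.sum_le_sum fun z _ => ?_) (hB.lazy x)
    split_ifs with h
    · exact le_rfl
    · refine mul_le_of_le_one_right (hB.nonneg x z) ?_
      rw [div_le_one (hpos x)]
      exact gibbs_le_gibbs hb (not_le.1 h).le
  refine ⟨⟨completeDiag_nonneg (fun x y _ => hnn x y) hlazy, completeDiag_row_sum _, hpos,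
    sum_gibbs H b, completeDiag_balance fun x y _ => ?_⟩, fun x => half_le_completeDiag (hlazy x)⟩
  have hx := (hpos x).ne'
  have hy := (hpos y).ne'
  rcases lt_trichotomy (H x) (H y) with h | h | h
  · rw [if_pos h.le, if_neg (not_le.2 h), hB.symm y x]
    field_simp
  · rw [if_pos h.le, if_pos h.ge, hB.symm y x]
    unfold gibbs
    rw [h]
  · rw [if_neg (not_le.2 h), if_pos h.le, hB.symm y x]
    field_simp

theorem metropolis_pos [Nonempty Ω] {B : Matrix Ω Ω ℝ} (H : Ω → ℝ) {b : ℝ} {x y : Ω}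
    (hxy : x ≠ y) (h : 0 < B x y) : 0 < metropolis B H b x y := by
  unfold metropolis
  rw [completeDiag_of_ne _ hxy]
  have := gibbs_pos H b x
  have := gibbs_pos H b y
  split_ifs <;> positivity

theorem ne_zero_of_metropolis_ne_zero {B : Matrix Ω Ω ℝ} {H : Ω → ℝ} {b : ℝ} {x y : Ω}
    (hxy : x ≠ y) (h : metropolis B H b x y ≠ 0) : B x y ≠ 0 := by
  unfold metropolis at h
  rw [completeDiag_of_ne _ hxy] at h
  split_ifs at h
  · exact h
  · exact left_ne_zero_of_mul h

theorem temp_nonneg {β : ℝ} (hβ : 0 ≤ β) (M : ℕ) (i : Fin (M + 1)) : 0 ≤ temp β M i := by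
  unfold temp; positivity

theorem temperingMeasure_pos [Nonempty Ω] (H : Ω → ℝ) (β : ℝ) (M : ℕ) (x : Ω × Fin (M + 1)) :
    0 < temperingMeasure H β M x :=
  div_pos (gibbs_pos _ _ _) (by positivity)

theorem sum_temperingMeasure [Nonempty Ω] (H : Ω → ℝ) (β : ℝ) (M : ℕ) :
    ∑ x, temperingMeasure H β M x = 1 := by
  rw [Fintype.sum_prod_type_right]
  simp only [temperingMeasure, ← Finset.sum_div, sum_gibbs]
  have : (M : ℝ) + 1 ≠ 0 := by positivity
  simp [this]

theorem temperingP_isReversible [Nonempty Ω] {B : Matrix Ω Ω ℝ} (hB : IsBaseChain B) (H : Ω → ℝ)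
    {β : ℝ} (hβ : 0 ≤ β) (M : ℕ) :
    IsReversible (temperingP B H β M) (temperingMeasure H β M) where
  nonneg x y := by
    unfold temperingP
    split_ifs
    · exact (metropolis_isReversible hB H (temp_nonneg hβ M x.2)).1.nonneg _ _
    · exact le_rfl
  row_sum x := by
    rw [Fintype.sum_prod_type]
    simp only [temperingP, Finset.sum_ite_eq, Finset.mem_univ, if_true]
    exact (metropolis_isReversible hB H (temp_nonneg hβ M x.2)).1.row_sum _
  pos := temperingMeasure_pos H β M
  sum_eq_one := sum_temperingMeasure H β M
  balance x y := by
    unfold temperingP temperingMeasure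
    by_cases h : x.2 = y.2
    · rw [if_pos h, if_pos h.symm, ← h]
      have := (metropolis_isReversible hB H (temp_nonneg hβ M x.2)).1.balance x.1 y.1
      rw [div_mul_eq_mul_div, div_mul_eq_mul_div, this]
    · rw [if_neg h, if_neg (Ne.symm h)]; simp

theorem levelProposal_isBaseChain (M : ℕ) : IsBaseChain (levelProposal M) := by
  have hlazy : ∀ x : Fin (M + 1), ∑ z ∈ Finset.univ.erase x,
      (if (x : ℕ) + 1 = (z : ℕ) ∨ (z : ℕ) + 1 = (x : ℕ) then 1 / (2 * ((M : ℝ) + 1)) else 0) ≤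
        1 / 2 := by
    intro x
    calc _ ≤ ∑ z ∈ Finset.univ.erase x, 1 / (2 * ((M : ℝ) + 1)) := by
          refine Finset.sum_le_sum fun z _ => ?_
          split_ifs
          · exact le_rfl
          · positivity
      _ ≤ 1 / 2 := by
          rw [Finset.sum_const, Finset.card_erase_of_mem (Finset.mem_univ x), Finset.card_univ,
            Fintype.card_fin, Nat.add_sub_cancel, nsmul_eq_mul, mul_one_div,
            div_le_div_iff₀ (by positivity) (by positivity)]
          linarith
  refine ⟨completeDiag_nonneg (fun x y _ => ?_) hlazy, fun x y => ?_, fun x => ?_⟩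
  · split_ifs
    · positivity
    · exact le_rfl
  · have := completeDiag_balance (π := fun _ => (1 : ℝ)) (R := fun i j : Fin (M + 1) =>
      if (i : ℕ) + 1 = (j : ℕ) ∨ (j : ℕ) + 1 = (i : ℕ) then 1 / (2 * ((M : ℝ) + 1)) else 0)
      (fun x y _ => by simp only [or_comm]) x y
    simpa [levelProposal] using this
  · refine le_trans (Finset.sum_le_sum fun z hz => ?_) (hlazy x)
    exact le_of_eq (completeDiag_of_ne _ (Finset.ne_of_mem_erase hz).symm)

theorem levelProposal_pos {M : ℕ} {i j : Fin (M + 1)} (h : (i : ℕ) + 1 = (j : ℕ)) :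
    0 < levelProposal M i j := by
  unfold levelProposal
  rw [completeDiag_of_ne _ (fun hij => by subst hij; omega), if_pos (Or.inl h)]
  positivity

theorem levelChain_properties [Nonempty Ω] (H : Ω → ℝ) (β : ℝ) (M : ℕ) (σ : Ω) :
    (∀ i j, 0 ≤ levelChain H β M σ i j) ∧ (∀ i, ∑ j, levelChain H β M σ i j = 1) ∧
    (∀ i j, gibbs H (temp β M i) σ * levelChain H β M σ i j =
      gibbs H (temp β M j) σ * levelChain H β M σ j i) ∧
    (∀ i, 1 / 2 ≤ levelChain H β M σ i i) ∧
    ∀ i j, i ≠ j → 0 < levelProposal M i j → 0 < levelChain H β M σ i j := by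
  have hB := levelProposal_isBaseChain M
  have hpos : ∀ i, 0 < gibbs H (temp β M i) σ := fun i => gibbs_pos _ _ _
  have hlazy : ∀ i, ∑ j ∈ Finset.univ.erase i,
      (if gibbs H (temp β M i) σ ≤ gibbs H (temp β M j) σ then levelProposal M i j
        else levelProposal M i j * (gibbs H (temp β M j) σ / gibbs H (temp β M i) σ)) ≤ 1 / 2 := by
    intro i
    refine le_trans (Finset.sum_le_sum fun j _ => ?_) (hB.lazy i)
    split_ifs with h
    · exact le_rfl
    · refine mul_le_of_le_one_right (hB.nonneg i j) ?_
      rw [div_le_one (hpos i)]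
      exact (not_le.1 h).le
  refine ⟨completeDiag_nonneg (fun i j _ => ?_) hlazy, completeDiag_row_sum _,
    completeDiag_balance (π := fun i => gibbs H (temp β M i) σ) fun i j _ => ?_,
    fun i => half_le_completeDiag (hlazy i), fun i j hij h => ?_⟩
  · have := hB.nonneg i j
    have := hpos i
    have := hpos j
    split_ifs <;> positivity
  · have hx := (hpos i).ne'
    have hy := (hpos j).ne'
    rcases lt_trichotomy (gibbs H (temp β M i) σ) (gibbs H (temp β M j) σ) with h | h | h
    · rw [if_pos h.le, if_neg (not_le.2 h), hB.symm j i]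
      field_simp
    · rw [if_pos h.le, if_pos h.ge, hB.symm j i, h]
    · rw [if_neg (not_le.2 h), if_pos h.le, hB.symm j i]
      field_simp
  · unfold levelChain
    rw [completeDiag_of_ne _ hij]
    have := hpos i
    have := hpos j
    split_ifs <;> positivity

theorem temperingQ_isReversible [Nonempty Ω] (H : Ω → ℝ) (β : ℝ) (M : ℕ) :
    IsReversible (temperingQ H β M) (temperingMeasure H β M) where
  nonneg x y := by
    unfold temperingQ
    split_ifs
    · exact (levelChain_properties H β M x.1).1 _ _
    · exact le_rfl
  row_sum x := by
    rw [Fintype.sum_prod_type_right]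
    simp only [temperingQ, Finset.sum_ite_eq, Finset.mem_univ, if_true]
    exact (levelChain_properties H β M x.1).2.1 _
  pos := temperingMeasure_pos H β M
  sum_eq_one := sum_temperingMeasure H β M
  balance x y := by
    unfold temperingQ temperingMeasure
    by_cases h : x.1 = y.1
    · rw [if_pos h, if_pos h.symm, ← h]
      have := (levelChain_properties H β M x.1).2.2.1 x.2 y.2
      rw [div_mul_eq_mul_div, div_mul_eq_mul_div, this]
    · rw [if_neg h, if_neg (Ne.symm h)]; simp

theorem temperingChain_isReversible [Nonempty Ω] {B : Matrix Ω Ω ℝ} (hB : IsBaseChain B)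
    (H : Ω → ℝ) {β : ℝ} (hβ : 0 ≤ β) (M : ℕ) :
    IsReversible (temperingChain B H β M) (temperingMeasure H β M) :=
  (temperingQ_isReversible H β M).mul_mul (temperingP_isReversible hB H hβ M)

theorem temperingQ_self_pos [Nonempty Ω] (H : Ω → ℝ) (β : ℝ) (M : ℕ) (x : Ω × Fin (M + 1)) :
    0 < temperingQ H β M x x := by
  simp only [temperingQ, if_true]
  linarith [(levelChain_properties H β M x.1).2.2.2.1 x.2]

theorem temperingChain_pos_of_base [Nonempty Ω] {B : Matrix Ω Ω ℝ} (hB : IsBaseChain B)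
    (H : Ω → ℝ) {β : ℝ} (hβ : 0 ≤ β) (M : ℕ) {σ τ : Ω} (hστ : σ ≠ τ) (h : 0 < B σ τ)
    (i : Fin (M + 1)) : 0 < temperingChain B H β M (σ, i) (τ, i) := by
  refine mul_mul_pos_of_pos (temperingQ_isReversible H β M).nonneg
    (temperingP_isReversible hB H hβ M).nonneg (temperingQ_self_pos H β M _) (v := (τ, i)) ?_
    (temperingQ_self_pos H β M _)
  simp only [temperingP, if_true]
  exact metropolis_pos H hστ h

theorem temperingChain_pos_of_level [Nonempty Ω] {B : Matrix Ω Ω ℝ} (hB : IsBaseChain B)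
    (H : Ω → ℝ) {β : ℝ} (hβ : 0 ≤ β) (M : ℕ) (σ : Ω) {i j : Fin (M + 1)}
    (h : (i : ℕ) + 1 = (j : ℕ)) : 0 < temperingChain B H β M (σ, i) (σ, j) := by
  refine mul_mul_pos_of_pos (temperingQ_isReversible H β M).nonneg
    (temperingP_isReversible hB H hβ M).nonneg (u := (σ, j)) (v := (σ, j)) ?_ ?_
    (temperingQ_self_pos H β M _)
  · simp only [temperingQ, if_true]
    exact (levelChain_properties H β M σ).2.2.2.2 i j (fun hij => by subst hij; omega)
      (levelProposal_pos h)
  · simp only [temperingP, if_true]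
    linarith [(metropolis_isReversible hB H (temp_nonneg hβ M j)).2 σ]

/-- The flow of the tempering chain through a cut that depends on the configuration only. -/
theorem temperingChain_cutFlow_le [Nonempty Ω] {B : Matrix Ω Ω ℝ} (hB : IsBaseChain B)
    (H : Ω → ℝ) {β : ℝ} (hβ : 0 ≤ β) (M : ℕ) (p q : Ω → Prop) [DecidablePred p]
    [DecidablePred q] (hpq : ∀ σ τ, p σ → ¬p τ → B σ τ ≠ 0 → q τ) :
    cutFlow (temperingChain B H β M) (temperingMeasure H β M)
        (Finset.univ.filter fun x => p x.1) ≤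
      ∑ x ∈ Finset.univ.filter fun x : Ω × Fin (M + 1) => q x.1, temperingMeasure H β M x := by
  unfold temperingChain
  rw [cutFlow_mul_mul (temperingQ_isReversible H β M)]
  · refine cutFlow_le_of_boundary (temperingP_isReversible hB H hβ M) _ _ fun x hx y hy h => ?_
    simp only [Finset.mem_filter, Finset.mem_univ, true_and] at hx hy ⊢
    unfold temperingP at h
    have h2 : metropolis B H (temp β M x.2) x.1 y.1 ≠ 0 := by
      by_cases hxy : x.2 = y.2
      · rwa [if_pos hxy] at h
      · rw [if_neg hxy] at h; exact absurd rfl h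
    exact hpq _ _ hx hy (ne_zero_of_metropolis_ne_zero (fun e => hy (e ▸ hx)) h2)
  · intro x y h
    have : x.1 = y.1 := by
      by_contra hxy
      exact h (if_neg hxy)
    simp [this]

end Tempering

/-! ### The chain of the Blume-Emery-Griffiths model -/

section Model

/-- Each of the N coordinates has two other values. At 1/(4N) per move the base chain therefore
moves with probability at most 1/2. -/
theorem card_filter_differ_one_le {N : ℕ} (x : Config N) :
    (Finset.univ.filter fun y : Config N =>
      (Finset.univ.filter fun i => x i ≠ y i).card = 1).card ≤ N * 2 := by
  have hsub : (Finset.univ.filter fun y : Config N =>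
      (Finset.univ.filter fun i => x i ≠ y i).card = 1) ⊆
      Finset.univ.biUnion fun i : Fin N =>
        (Finset.univ.erase (x i)).image fun s => Function.update x i s := by
    intro y hy
    rw [Finset.mem_filter, Finset.card_eq_one] at hy
    obtain ⟨i, hi⟩ := hy.2
    have hmem : ∀ j, x j ≠ y j ↔ j = i := fun j => by
      have := Finset.ext_iff.1 hi j
      simpa using this
    simp only [Finset.mem_biUnion, Finset.mem_univ, true_and, Finset.mem_image, Finset.mem_erase]
    refine ⟨i, y i, ⟨fun h => (hmem i).2 rfl h.symm, trivial⟩, ?_⟩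
    ext1 j
    by_cases hj : j = i
    · subst hj; simp
    · rw [Function.update_of_ne hj]
      by_contra h
      exact hj ((hmem j).1 h)
  refine (Finset.card_le_card hsub).trans ?_
  refine (Finset.card_biUnion_le_card_mul _ _ 2 fun i _ => ?_).trans (by simp)
  refine Finset.card_image_le.trans ?_
  rw [Finset.card_erase_of_mem (Finset.mem_univ _)]
  exact le_of_eq rfl

theorem baseChain_isBaseChain (N : ℕ) : IsBaseChain (baseChain N) where
  nonneg x y := by unfold baseChain; split_ifs <;> positivity
  symm x y := by unfold baseChain; simp only [eq_comm, ne_comm]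
  lazy x := by
    have h1 : ∑ z ∈ Finset.univ.erase x, baseChain N x z ≤
        ∑ z : Config N,
          if (Finset.univ.filter fun i => x i ≠ z i).card = 1 then 1 / (4 * (N : ℝ)) else 0 := by
      refine le_trans (Finset.sum_le_sum fun z hz => ?_)
        (Finset.sum_le_sum_of_subset_of_nonneg (Finset.erase_subset _ _) fun z _ _ => ?_)
      · unfold baseChain
        rw [if_neg (Finset.ne_of_mem_erase hz).symm]
      · split_ifs <;> positivity
    refine h1.trans ?_
    rw [← Finset.sum_filter, Finset.sum_const, nsmul_eq_mul]
    have h2 : ((Finset.univ.filter fun y : Config N =>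
      (Finset.univ.filter fun i => x i ≠ y i).card = 1).card : ℝ) ≤ N * 2 := by
      exact_mod_cast card_filter_differ_one_le x
    rcases Nat.eq_zero_or_pos N with rfl | hN
    · simp
    · have hN' : (0 : ℝ) < N := by exact_mod_cast hN
      calc _ ≤ (N * 2 : ℝ) * (1 / (4 * (N : ℝ))) := by gcongr
        _ = 1 / 2 := by field_simp; norm_num

/-- The total spin. -/
def totalSpin {N : ℕ} (σ : Config N) : ℝ := ∑ j, ((σ j : SignType) : ℝ)

theorem abs_signType_le (s : SignType) : |(s : ℝ)| ≤ 1 := by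
  rcases s with _ | _ | _ <;> norm_num

/-- One spin changes by at most 2, so a move out of {|S| ≤ θ} lands in a layer of width 2. -/
theorem abs_totalSpin_sub_le {N : ℕ} {σ τ : Config N} (h : σ ≠ τ) (hB : baseChain N σ τ ≠ 0) :
    |totalSpin τ| ≤ |totalSpin σ| + 2 := by
  unfold baseChain at hB
  rw [if_neg h] at hB
  have hcard : (Finset.univ.filter fun i => σ i ≠ τ i).card = 1 := by
    by_contra h1
    rw [if_neg h1] at hB
    exact hB rfl
  obtain ⟨i, hi⟩ := Finset.card_eq_one.1 hcard
  have hmem : ∀ j, j ≠ i → σ j = τ j := fun j hj => by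
    by_contra h1
    have : j ∈ ({i} : Finset (Fin N)) := hi ▸ Finset.mem_filter.2 ⟨Finset.mem_univ j, h1⟩
    exact hj (Finset.mem_singleton.1 this)
  have hdiff : totalSpin τ - totalSpin σ = (τ i : ℝ) - (σ i : ℝ) := by
    unfold totalSpin
    rw [← Finset.sum_sub_distrib]
    refine Finset.sum_eq_single i (fun j _ hj => ?_) (by simp)
    rw [hmem j hj]; ring
  have h1 := abs_signType_le (σ i)
  have h2 := abs_signType_le (τ i)
  have h3 : |totalSpin τ - totalSpin σ| ≤ 2 := by
    rw [hdiff]; exact (abs_sub _ _).trans (by linarith)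
  have h4 := abs_sub_abs_le_abs_sub (totalSpin τ) (totalSpin σ)
  linarith

theorem begChain_isReversible (K : ℝ) {β : ℝ} (hβ : 0 ≤ β) (M N : ℕ) :
    IsReversible (begChain K β M N) (begMeasure K β M N) :=
  temperingChain_isReversible (baseChain_isBaseChain N) _ hβ M

/-- Irreducibility, which the gap bound needs because `spectralGap` discards the eigenvalue 1
whatever its multiplicity. Temperature steps connect the levels, and single-spin updates connect the
configurations at level 0. -/
theorem eq_of_begChain_mulVec_eq (K : ℝ) {β : ℝ} (hβ : 0 ≤ β) (M N : ℕ)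
    (g : Config N × Fin (M + 1) → ℝ) (hg : Matrix.mulVec (begChain K β M N) g = g)
    (x y : Config N × Fin (M + 1)) : g x = g y := by
  have hrev := begChain_isReversible K hβ M N
  have hB := baseChain_isBaseChain N
  have hlevel : ∀ σ (i : Fin (M + 1)), g (σ, i) = g (σ, 0) := by
    intro σ i
    induction i using Fin.induction with
    | zero => rfl
    | succ i ih =>
      rw [← ih]
      exact (hrev.eq_of_mulVec_eq hg
        (temperingChain_pos_of_level hB _ hβ M σ (by simp))).symm
  have hupdate : ∀ (σ : Config N) (i : Fin N) (s : SignType),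
      g (Function.update σ i s, 0) = g (σ, 0) := by
    intro σ i s
    by_cases hs : σ i = s
    · rw [← hs, Function.update_eq_self]
    · have hne : σ ≠ Function.update σ i s := fun h => hs (by
        have := congrFun h i; simpa using this)
      refine (hrev.eq_of_mulVec_eq hg (temperingChain_pos_of_base hB _ hβ M hne ?_ 0)).symm
      unfold baseChain
      rw [if_neg hne, if_pos]
      · have : (0 : ℝ) < N := by exact_mod_cast i.pos
        positivity
      · rw [Finset.card_eq_one]
        refine ⟨i, ?_⟩
        ext j
        by_cases hj : j = i
        · subst hj; simp [hs]
        · simp [hj]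
  have hpiece : ∀ (σ τ : Config N) (s : Finset (Fin N)),
      g (s.piecewise τ σ, 0) = g (σ, 0) := by
    intro σ τ s
    induction s using Finset.induction with
    | empty => simp
    | insert i s _ ih => rw [Finset.piecewise_insert, hupdate, ih]
  obtain ⟨σ, i⟩ := x
  obtain ⟨τ, j⟩ := y
  rw [hlevel σ i, hlevel τ j, ← hpiece σ τ Finset.univ, Finset.piecewise_univ]

/-- The flow through the cut at total spin `θ`. -/
theorem begChain_cutFlow_le (K : ℝ) {β : ℝ} (hβ : 0 ≤ β) (M N : ℕ) (θ : ℝ) :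
    cutFlow (begChain K β M N) (begMeasure K β M N)
        (Finset.univ.filter fun x => |totalSpin x.1| ≤ θ) ≤
      ∑ x ∈ Finset.univ.filter fun x : Config N × Fin (M + 1) =>
        θ ≤ |totalSpin x.1| ∧ |totalSpin x.1| ≤ θ + 2, begMeasure K β M N x := by
  refine temperingChain_cutFlow_le (baseChain_isBaseChain N) _ hβ M
    (fun σ => |totalSpin σ| ≤ θ) (fun σ => θ ≤ |totalSpin σ| ∧ |totalSpin σ| ≤ θ + 2)
    fun σ τ hσ hτ hB => ⟨(not_le.1 hτ).le, ?_⟩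
  have := abs_totalSpin_sub_le (fun e => hτ (by subst e; exact hσ)) hB
  linarith

end Model

end BEG

namespace BEG

/-! ### Partition functions -/

section Partition

open Real

/-- Logarithm of the one-spin partition function in the field `t`. -/
noncomputable def logZ (b t : ℝ) : ℝ := log (1 + 2 * exp (-b) * cosh t)

/-- Mean spin in the field `t`. -/
noncomputable def meanSpin (b t : ℝ) : ℝ := 2 * exp (-b) * sinh t / (1 + 2 * exp (-b) * cosh t)

/-- The free energy as a function of the magnetization. -/
noncomputable def freeEnergy (K b m : ℝ) : ℝ := logZ b (2 * b * K * m) - b * K * m ^ 2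

/-- The unnormalized weight of a spin in the field `t`. -/
noncomputable def spinWeight (b t : ℝ) (s : SignType) : ℝ := exp (-b * (s : ℝ) ^ 2 + t * (s : ℝ))

theorem one_add_pos (b t : ℝ) : 0 < 1 + 2 * exp (-b) * cosh t := by
  have := exp_pos (-b)
  have := cosh_pos t
  positivity

theorem exp_logZ (b t : ℝ) : exp (logZ b t) = 1 + 2 * exp (-b) * cosh t :=
  exp_log (one_add_pos b t)

theorem sum_signType (f : SignType → ℝ) : ∑ s, f s = f 0 + f (-1) + f 1 := by
  have : (Finset.univ : Finset SignType) = {0, -1, 1} := rfl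
  rw [this, Finset.sum_insert (by decide), Finset.sum_insert (by decide), Finset.sum_singleton]
  ring

theorem sum_spinWeight (b t : ℝ) : ∑ s, spinWeight b t s = exp (logZ b t) := by
  rw [sum_signType, exp_logZ, cosh_eq]
  simp only [spinWeight, SignType.coe_zero, SignType.coe_neg, SignType.coe_one]
  have h1 : exp (-b * (-1) ^ 2 + t * -1) = exp (-b) * exp (-t) := by rw [← exp_add]; ring_nf
  have h2 : exp (-b * 1 ^ 2 + t * 1) = exp (-b) * exp t := by rw [← exp_add]; ring_nf
  rw [h1, h2]
  norm_num
  ring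

theorem sum_prod_spinWeight (b t : ℝ) (N : ℕ) :
    ∑ σ : Config N, ∏ j, spinWeight b t (σ j) = exp (N * logZ b t) := by
  rw [← Fintype.sum_pow, sum_spinWeight, exp_nat_mul]

theorem prod_spinWeight {N : ℕ} (b t : ℝ) (σ : Config N) :
    ∏ j, spinWeight b t (σ j) = exp (-b * ∑ j, (σ j : ℝ) ^ 2 + t * totalSpin σ) := by
  simp only [spinWeight, totalSpin, ← exp_sum, Finset.mul_sum, Finset.sum_add_distrib]

/-- For any auxiliary field t, the weight is a product weight times a function of the total spin
alone. -/
theorem exp_hamiltonian {N : ℕ} (K b t : ℝ) (σ : Config N) :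
    exp (b * hamiltonian K N σ) = exp (b * K * totalSpin σ ^ 2 / N - t * totalSpin σ) *
      ∏ j, spinWeight b t (σ j) := by
  rw [prod_spinWeight, ← exp_add]
  congr 1
  unfold hamiltonian
  rw [← totalSpin]
  ring

theorem abs_totalSpin_le {N : ℕ} (σ : Config N) : |totalSpin σ| ≤ N := by
  unfold totalSpin
  refine (Finset.abs_sum_le_sum_abs _ _).trans ?_
  refine (Finset.sum_le_sum fun j _ => abs_signType_le (σ j)).trans ?_
  simp

theorem card_image_totalSpin_le {N : ℕ} (D : Finset (Config N)) :
    (D.image totalSpin).card ≤ 2 * N + 1 := by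
  have hsub : D.image totalSpin ⊆ (Finset.Icc (-(N : ℤ)) N).image (fun k : ℤ => (k : ℝ)) := by
    intro x hx
    obtain ⟨σ, -, rfl⟩ := Finset.mem_image.1 hx
    have hcast : totalSpin σ = ((∑ j, ((σ j : SignType) : ℤ) : ℤ) : ℝ) := by
      unfold totalSpin
      push_cast
      rfl
    refine Finset.mem_image.2 ⟨_, ?_, hcast.symm⟩
    have h := abs_totalSpin_le σ
    rw [hcast, abs_le] at h
    rw [Finset.mem_Icc]
    exact ⟨by exact_mod_cast h.1, by exact_mod_cast h.2⟩
  refine (Finset.card_le_card hsub).trans (Finset.card_image_le.trans ?_)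
  rw [Int.card_Icc]
  omega

/-- Upper bound for the weight of a set of configurations by its number of magnetizations. -/
theorem sum_exp_hamiltonian_le {N : ℕ} (hN : 1 ≤ N) {K b C : ℝ} (D : Finset (Config N))
    (h : ∀ σ ∈ D, ∃ t, N * (b * K * (totalSpin σ / N) ^ 2 - t * (totalSpin σ / N) + logZ b t) ≤ C) :
    ∑ σ ∈ D, exp (b * hamiltonian K N σ) ≤ (2 * N + 1) * exp C := by
  have hN0 : (0 : ℝ) < N := by exact_mod_cast hN
  rw [← Finset.sum_fiberwise_of_maps_to (t := D.image totalSpin) (g := totalSpin)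
    (fun σ hσ => Finset.mem_image_of_mem _ hσ)]
  calc _ ≤ ∑ s ∈ D.image totalSpin, exp C := by
        -- On a level set of S the quadratic factor is constant, so the field may be chosen level by
        -- level; the product weight is then summed over all configurations. There are at most 2N +
        -- 1 levels.
        refine Finset.sum_le_sum fun s hs => ?_
        obtain ⟨σ₀, hσ₀, rfl⟩ := Finset.mem_image.1 hs
        obtain ⟨t, ht⟩ := h σ₀ hσ₀
        have heq : ∀ σ ∈ D.filter (fun σ => totalSpin σ = totalSpin σ₀),
            exp (b * hamiltonian K N σ) =
              exp (b * K * totalSpin σ₀ ^ 2 / N - t * totalSpin σ₀) *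
                ∏ j, spinWeight b t (σ j) := by
          intro σ hσ
          rw [exp_hamiltonian K b t, (Finset.mem_filter.1 hσ).2]
        rw [Finset.sum_congr rfl heq, ← Finset.mul_sum]
        calc _ ≤ exp (b * K * totalSpin σ₀ ^ 2 / N - t * totalSpin σ₀) *
              ∑ σ : Config N, ∏ j, spinWeight b t (σ j) := by
              gcongr
              · exact fun σ _ _ => Finset.prod_nonneg fun j _ => (exp_pos _).le
              · exact Finset.subset_univ _
          _ ≤ exp C := by
              rw [sum_prod_spinWeight, ← exp_add]
              refine exp_le_exp.2 (le_trans (le_of_eq ?_) ht)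
              field_simp
    _ ≤ (2 * N + 1) * exp C := by
        rw [Finset.sum_const, nsmul_eq_mul]
        gcongr
        exact_mod_cast card_image_totalSpin_le D

/-- Lower bound for the weight of a set of configurations by its weight under a product measure. -/
theorem le_sum_exp_hamiltonian {N : ℕ} (hN : 1 ≤ N) {K b : ℝ} (hK : 0 ≤ K) (hb : 0 ≤ b) (m : ℝ)
    (D : Finset (Config N)) :
    exp (-(N * (b * K * m ^ 2))) * ∑ σ ∈ D, ∏ j, spinWeight b (2 * b * K * m) (σ j) ≤
      ∑ σ ∈ D, exp (b * hamiltonian K N σ) := by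
  have hN0 : (0 : ℝ) < N := by exact_mod_cast hN
  rw [Finset.mul_sum]
  refine Finset.sum_le_sum fun σ _ => ?_
  rw [exp_hamiltonian K b (2 * b * K * m)]
  refine mul_le_mul_of_nonneg_right (exp_le_exp.2 ?_)
    (Finset.prod_nonneg fun j _ => (exp_pos _).le)
  -- The convex quadratic lies above its tangent at N m, whose slope is the field 2bKm.
  have h1 : 0 ≤ b * K * (totalSpin σ - N * m) ^ 2 / N := by positivity
  have h2 : b * K * (totalSpin σ - N * m) ^ 2 / N =
      b * K * totalSpin σ ^ 2 / N - 2 * b * K * m * totalSpin σ + N * (b * K * m ^ 2) := by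
    field_simp; ring
  linarith

theorem exp_freeEnergy_le {N : ℕ} (hN : 1 ≤ N) {K b : ℝ} (hK : 0 ≤ K) (hb : 0 ≤ b) (m : ℝ) :
    exp (N * freeEnergy K b m) ≤ ∑ σ : Config N, exp (b * hamiltonian K N σ) := by
  refine le_trans (le_of_eq ?_) (le_sum_exp_hamiltonian hN hK hb m Finset.univ)
  rw [sum_prod_spinWeight, ← exp_add]
  unfold freeEnergy
  ring_nf

/-- The second moment of a sum of independent centred variables. -/
theorem sum_prod_mul_sq {p X : SignType → ℝ} (hp : ∑ s, p s = 1) (hX : ∑ s, p s * X s = 0)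
    (N : ℕ) (c : ℝ) :
    ∑ σ : Config N, (∏ j, p (σ j)) * (c + ∑ j, X (σ j)) ^ 2 =
      c ^ 2 + N * ∑ s, p s * X s ^ 2 := by
  -- The shift c is general so that the first spin can be absorbed into it.
  induction N generalizing c with
  | zero => simp
  | succ N ih =>
    rw [← (Fin.consEquiv fun _ : Fin (N + 1) => SignType).sum_comp, Fintype.sum_prod_type]
    have h1 : ∀ s : SignType, ∑ σ : Config N,
        (∏ j, p ((Fin.consEquiv fun _ : Fin (N + 1) => SignType) (s, σ) j)) *
          (c + ∑ j, X ((Fin.consEquiv fun _ : Fin (N + 1) => SignType) (s, σ) j)) ^ 2 =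
        p s * ((c + X s) ^ 2 + N * ∑ s, p s * X s ^ 2) := by
      intro s
      rw [← ih, Finset.mul_sum]
      refine Finset.sum_congr rfl fun σ _ => ?_
      rw [Fin.prod_univ_succ, Fin.sum_univ_succ]
      simp only [Fin.consEquiv_apply, Fin.cons_zero, Fin.cons_succ]
      ring
    simp only [h1]
    have h2 : ∀ s, p s * ((c + X s) ^ 2 + N * ∑ s, p s * X s ^ 2) =
        (c ^ 2 + N * ∑ s, p s * X s ^ 2) * p s + 2 * c * (p s * X s) + p s * X s ^ 2 := by
      intro s; ring
    simp only [h2, Finset.sum_add_distrib, ← Finset.mul_sum, hp, hX]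
    push_cast
    ring

/-- Chebyshev's inequality for the total spin under a product measure. -/
theorem sum_prod_far_le {p : SignType → ℝ} (hp0 : ∀ s, 0 ≤ p s) (hp : ∑ s, p s = 1) {μ : ℝ}
    (hμ : ∑ s, p s * (s : ℝ) = μ) {N : ℕ} (hN : 1 ≤ N) {η : ℝ} (hη : 0 < η) :
    ∑ σ ∈ Finset.univ.filter (fun σ : Config N => N * η ≤ |totalSpin σ - N * μ|), ∏ j, p (σ j) ≤
      1 / (N * η ^ 2) := by
  have hN0 : (0 : ℝ) < N := by exact_mod_cast hN
  have hX : ∑ s : SignType, p s * ((s : ℝ) - μ) = 0 := by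
    simp only [mul_sub, Finset.sum_sub_distrib, ← Finset.sum_mul, hp, hμ]; ring
  have hv : ∑ s : SignType, p s * ((s : ℝ) - μ) ^ 2 ≤ 1 := by
    have h1 : ∀ s : SignType, p s * ((s : ℝ) - μ) ^ 2 ≤ p s - 2 * μ * (p s * s) + μ ^ 2 * p s := by
      intro s
      have h2 : (s : ℝ) ^ 2 ≤ 1 := by
        rw [← sq_abs]; exact pow_le_one₀ (abs_nonneg _) (abs_signType_le s)
      nlinarith [hp0 s, mul_le_mul_of_nonneg_left h2 (hp0 s)]
    refine (Finset.sum_le_sum fun s _ => h1 s).trans ?_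
    simp only [Finset.sum_add_distrib, Finset.sum_sub_distrib, ← Finset.mul_sum, hp, hμ]
    nlinarith [sq_nonneg μ]
  have hmom := sum_prod_mul_sq hp hX N 0
  have hspin : ∀ σ : Config N, 0 + ∑ j, ((σ j : ℝ) - μ) = totalSpin σ - N * μ := by
    intro σ
    simp [totalSpin, Finset.sum_sub_distrib]
  simp only [hspin] at hmom
  have hprod : ∀ σ : Config N, 0 ≤ ∏ j, p (σ j) := fun σ => Finset.prod_nonneg fun j _ => hp0 _
  have h1 : (N * η) ^ 2 * ∑ σ ∈ Finset.univ.filter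
      (fun σ : Config N => N * η ≤ |totalSpin σ - N * μ|), ∏ j, p (σ j) ≤ N := by
    calc _ ≤ ∑ σ ∈ Finset.univ.filter (fun σ : Config N => N * η ≤ |totalSpin σ - N * μ|),
          (∏ j, p (σ j)) * (totalSpin σ - N * μ) ^ 2 := by
          rw [Finset.mul_sum]
          refine Finset.sum_le_sum fun σ hσ => ?_
          rw [mul_comm]
          refine mul_le_mul_of_nonneg_left ?_ (hprod σ)
          rw [← sq_abs (totalSpin σ - N * μ)]
          exact pow_le_pow_left₀ (by positivity) (Finset.mem_filter.1 hσ).2 2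
      _ ≤ ∑ σ : Config N, (∏ j, p (σ j)) * (totalSpin σ - N * μ) ^ 2 :=
          Finset.sum_le_sum_of_subset_of_nonneg (Finset.filter_subset _ _)
            fun σ _ _ => mul_nonneg (hprod σ) (sq_nonneg _)
      _ ≤ N := by
          rw [hmom]
          nlinarith
  rw [le_div_iff₀ (by positivity)]
  have h2 : N * (N * η ^ 2 * ∑ σ ∈ Finset.univ.filter
      (fun σ : Config N => N * η ≤ |totalSpin σ - N * μ|), ∏ j, p (σ j)) ≤ N * 1 := by
    linarith [h1]
  linarith [le_of_mul_le_mul_left h2 hN0]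

/-- A neighbourhood of the mean spin carries half of the product measure. -/
theorem half_exp_freeEnergy_le {N : ℕ} (hN : 1 ≤ N) {K b η : ℝ} (hK : 0 ≤ K) (hb : 0 ≤ b) (m : ℝ)
    (hη : 0 < η) (hNη : 2 ≤ N * η ^ 2) (D : Finset (Config N))
    (hD : ∀ σ, |totalSpin σ - N * meanSpin b (2 * b * K * m)| < N * η → σ ∈ D) :
    exp (N * freeEnergy K b m) / 2 ≤ ∑ σ ∈ D, exp (b * hamiltonian K N σ) := by
  set t := 2 * b * K * m with ht
  set Z := exp (logZ b t) with hZ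
  have hZ0 : 0 < Z := exp_pos _
  set p : SignType → ℝ := fun s => spinWeight b t s / Z with hpdef
  have hp0 : ∀ s, 0 ≤ p s := fun s => div_nonneg (exp_pos _).le hZ0.le
  have hp : ∑ s, p s = 1 := by
    simp only [hpdef, ← Finset.sum_div, sum_spinWeight]
    exact div_self hZ0.ne'
  have hμ : ∑ s, p s * (s : ℝ) = meanSpin b t := by
    rw [sum_signType]
    simp only [hpdef, spinWeight, SignType.coe_zero, SignType.coe_neg, SignType.coe_one, hZ,
      exp_logZ, meanSpin]
    have h1 : exp (-b * (-1) ^ 2 + t * -1) = exp (-b) * exp (-t) := by rw [← exp_add]; ring_nf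
    have h2 : exp (-b * 1 ^ 2 + t * 1) = exp (-b) * exp t := by rw [← exp_add]; ring_nf
    rw [h1, h2, sinh_eq]
    ring
  have hfar := sum_prod_far_le hp0 hp hμ hN hη
  have hprod : ∀ σ : Config N, ∏ j, p (σ j) = (∏ j, spinWeight b t (σ j)) / Z ^ N := by
    intro σ
    simp [hpdef, Finset.prod_div_distrib]
  have htot : ∑ σ : Config N, ∏ j, p (σ j) = 1 := by
    rw [← Fintype.sum_pow, hp, one_pow]
  have hhalf : 1 / 2 ≤ ∑ σ ∈ D, ∏ j, p (σ j) := by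
    have h1 : ∑ σ ∈ Dᶜ, ∏ j, p (σ j) ≤ 1 / (N * η ^ 2) := by
      refine le_trans (Finset.sum_le_sum_of_subset_of_nonneg (fun σ hσ => ?_)
        fun σ _ _ => Finset.prod_nonneg fun j _ => hp0 _) hfar
      rw [Finset.mem_filter]
      refine ⟨Finset.mem_univ _, ?_⟩
      by_contra! h
      exact Finset.mem_compl.1 hσ (hD σ h)
    have h2 : 1 / (N * η ^ 2) ≤ 1 / 2 := by
      exact one_div_le_one_div_of_le (by norm_num) hNη
    have h3 := Finset.sum_add_sum_compl D fun σ : Config N => ∏ j, p (σ j)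
    linarith
  refine le_trans ?_ (le_sum_exp_hamiltonian hN hK hb m D)
  simp only [hprod, ← Finset.sum_div] at hhalf
  rw [le_div_iff₀ (by positivity)] at hhalf
  have hexp : exp (N * freeEnergy K b m) = exp (-(N * (b * K * m ^ 2))) * Z ^ N := by
    rw [hZ, ← exp_nat_mul, ← exp_add]
    unfold freeEnergy
    rw [← ht]
    ring_nf
  rw [hexp]
  calc _ = exp (-(N * (b * K * m ^ 2))) * (1 / 2 * Z ^ N) := by ring
    _ ≤ _ := by gcongr

theorem sum_exp_pos {N : ℕ} (K b : ℝ) : 0 < ∑ σ : Config N, exp (b * hamiltonian K N σ) :=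
  Finset.sum_pos (fun _ _ => exp_pos _) Finset.univ_nonempty

/-- A set of magnetizations with a free-energy deficit has exponentially small probability. -/
theorem sum_gibbs_le {N : ℕ} (hN : 1 ≤ N) {K b c : ℝ} (hK : 0 ≤ K) (hb : 0 ≤ b)
    (D : Finset (Config N))
    (h : ∀ σ ∈ D, ∃ t m, b * K * (totalSpin σ / N) ^ 2 - t * (totalSpin σ / N) + logZ b t + c ≤
      freeEnergy K b m) :
    ∑ σ ∈ D, gibbs (hamiltonian K N) b σ ≤ (2 * N + 1) * exp (-c * N) := by
  have hN0 : (0 : ℝ) < N := by exact_mod_cast hN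
  have hZ := sum_exp_pos (N := N) K b
  unfold gibbs
  rw [← Finset.sum_div, div_le_iff₀ hZ]
  have h1 := sum_exp_hamiltonian_le hN (K := K) (b := b)
    (C := log (∑ σ : Config N, exp (b * hamiltonian K N σ)) - c * N) D fun σ hσ => by
      obtain ⟨t, m, htm⟩ := h σ hσ
      refine ⟨t, ?_⟩
      have h2 : N * freeEnergy K b m ≤ log (∑ σ : Config N, exp (b * hamiltonian K N σ)) :=
        (le_log_iff_exp_le hZ).2 (exp_freeEnergy_le hN hK hb m)
      have h3 := mul_le_mul_of_nonneg_left htm hN0.le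
      linarith
  rw [sub_eq_add_neg, exp_add, exp_log hZ] at h1
  refine h1.trans (le_of_eq ?_)
  ring_nf

/-- A neighbourhood of a maximizer of the free energy has at least polynomial probability. -/
theorem le_sum_gibbs {N : ℕ} (hN : 1 ≤ N) {K b η m : ℝ} (hK : 0 ≤ K) (hb : 0 ≤ b)
    (hm : ∀ m', |m'| ≤ 1 → freeEnergy K b m' ≤ freeEnergy K b m)
    (hη : 0 < η) (hNη : 2 ≤ N * η ^ 2) (D : Finset (Config N))
    (hD : ∀ σ, |totalSpin σ - N * meanSpin b (2 * b * K * m)| < N * η → σ ∈ D) :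
    1 / (2 * (2 * N + 1)) ≤ ∑ σ ∈ D, gibbs (hamiltonian K N) b σ := by
  have hN0 : (0 : ℝ) < N := by exact_mod_cast hN
  have hZ := sum_exp_pos (N := N) K b
  have h1 := half_exp_freeEnergy_le hN hK hb m hη hNη D hD
  -- With the field 2bK S/N the exponent in this bound is N F(S/N), hence at most N F(m): the
  -- partition function exceeds exp(N F(m)) by at most the factor 2N + 1.
  have h2 := sum_exp_hamiltonian_le hN (K := K) (b := b) (C := N * freeEnergy K b m)
    Finset.univ fun σ _ => by
      refine ⟨2 * b * K * (totalSpin σ / N), ?_⟩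
      have h3 := hm (totalSpin σ / N) (by
        rw [abs_div, abs_of_pos hN0, div_le_one hN0]; exact abs_totalSpin_le σ)
      refine mul_le_mul_of_nonneg_left (le_trans (le_of_eq ?_) h3) hN0.le
      unfold freeEnergy
      ring
  unfold gibbs
  rw [← Finset.sum_div, le_div_iff₀ hZ]
  refine le_trans ?_ h1
  rw [div_mul_eq_mul_div, one_mul, div_le_iff₀ (by positivity)]
  linarith

end Partition

end BEG

namespace BEG

/-! ### Elementary inequalities -/

section Elementary

open Real

theorem nonneg_of_hasDerivAt_nonneg {f f' : ℝ → ℝ} (hf : ∀ x, 0 ≤ x → HasDerivAt f (f' x) x)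
    (hf' : ∀ x, 0 ≤ x → 0 ≤ f' x) (h0 : 0 ≤ f 0) {x : ℝ} (hx : 0 ≤ x) : 0 ≤ f x := by
  have hmono : MonotoneOn f (Set.Ici 0) := by
    apply monotoneOn_of_hasDerivWithinAt_nonneg (f' := f') (convex_Ici 0)
    · exact fun y hy => (hf y hy).continuousAt.continuousWithinAt
    · intro y hy
      rw [interior_Ici] at hy
      exact (hf y (le_of_lt hy)).hasDerivWithinAt
    · intro y hy
      rw [interior_Ici] at hy
      exact hf' y (le_of_lt hy)
  exact h0.trans (hmono (Set.mem_Ici.2 le_rfl) hx hx)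

/-- The [2/1] Padé approximant at 0; the difference has derivative 4y³ over a positive denominator.
-/
theorem log_one_add_le_pade {y : ℝ} (hy : 0 ≤ y) :
    log (1 + y) ≤ y * (6 + y) / (6 + 4 * y) := by
  suffices 0 ≤ y * (6 + y) / (6 + 4 * y) - log (1 + y) by linarith
  refine nonneg_of_hasDerivAt_nonneg (f := fun y => y * (6 + y) / (6 + 4 * y) - log (1 + y))
    (f' := fun y => 4 * y ^ 3 / ((6 + 4 * y) ^ 2 * (1 + y))) ?_ ?_ (by simp) hy
  · intro x hx
    have h1 : 6 + 4 * x ≠ 0 := by positivity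
    have h2 : 1 + x ≠ 0 := by positivity
    have hN : HasDerivAt (fun y : ℝ => y * (6 + y)) (1 * (6 + x) + x * 1) x :=
      (hasDerivAt_id' x).mul ((hasDerivAt_id' x).const_add 6)
    have hD : HasDerivAt (fun y : ℝ => 6 + 4 * y) (4 * 1) x :=
      ((hasDerivAt_id' x).const_mul 4).const_add 6
    have hl : HasDerivAt (fun y : ℝ => log (1 + y)) (1 / (1 + x)) x :=
      ((hasDerivAt_id' x).const_add 1).log h2
    refine ((hN.fun_div hD h1).fun_sub hl).congr_deriv ?_
    field_simp
    ring
  · intro x hx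
    positivity

/-- The [2/2] Padé approximant at 0; the difference has derivative y⁴ over a positive denominator.
-/
theorem pade_le_log_one_add {y : ℝ} (hy : 0 ≤ y) :
    3 * y * (2 + y) / (6 + 6 * y + y ^ 2) ≤ log (1 + y) := by
  suffices 0 ≤ log (1 + y) - 3 * y * (2 + y) / (6 + 6 * y + y ^ 2) by linarith
  refine nonneg_of_hasDerivAt_nonneg
    (f := fun y => log (1 + y) - 3 * y * (2 + y) / (6 + 6 * y + y ^ 2))
    (f' := fun y => y ^ 4 / ((6 + 6 * y + y ^ 2) ^ 2 * (1 + y))) ?_ ?_ (by simp) hy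
  · intro x hx
    have h1 : 6 + 6 * x + x ^ 2 ≠ 0 := by positivity
    have h2 : 1 + x ≠ 0 := by positivity
    have hN : HasDerivAt (fun y : ℝ => 3 * y * (2 + y)) (3 * 1 * (2 + x) + 3 * x * 1) x :=
      ((hasDerivAt_id' x).const_mul 3).mul ((hasDerivAt_id' x).const_add 2)
    have hD : HasDerivAt (fun y : ℝ => 6 + 6 * y + y ^ 2) (6 * 1 + 2 * x) x := by
      refine ((((hasDerivAt_id' x).const_mul 6).const_add 6).fun_add (hasDerivAt_pow 2 x)).congr_deriv ?_
      simp
    have hl : HasDerivAt (fun y : ℝ => log (1 + y)) (1 / (1 + x)) x :=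
      ((hasDerivAt_id' x).const_add 1).log h2
    refine (hl.fun_sub (hN.fun_div hD h1)).congr_deriv ?_
    field_simp
    ring
  · intro x hx
    positivity

theorem sinh_le_mul_cosh {s : ℝ} (hs : 0 ≤ s) : sinh s ≤ s * cosh s := by
  suffices 0 ≤ s * cosh s - sinh s by linarith
  refine nonneg_of_hasDerivAt_nonneg (f := fun s => s * cosh s - sinh s)
    (f' := fun s => s * sinh s) ?_ ?_ (by simp) hs
  · intro x _
    refine (((hasDerivAt_id' x).fun_mul (hasDerivAt_cosh x)).fun_sub
      (hasDerivAt_sinh x)).congr_deriv ?_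
    ring
  · intro x hx
    exact mul_nonneg hx (sinh_nonneg_iff.2 hx)

/-- The rational lower bound `(15 + 6 s²) / (15 + s²) ≤ s coth s`. -/
theorem pade_mul_sinh_le {s : ℝ} (hs : 0 ≤ s) :
    (15 + 6 * s ^ 2) * sinh s ≤ (15 + s ^ 2) * (s * cosh s) := by
  have aux : ∀ x : ℝ, 0 ≤ x → 0 ≤ (3 + x ^ 2) * sinh x - 3 * x * cosh x := by
    intro x hx
    refine nonneg_of_hasDerivAt_nonneg (f := fun x => (3 + x ^ 2) * sinh x - 3 * x * cosh x)
      (f' := fun x => x * (x * cosh x - sinh x)) ?_ ?_ (by simp) hx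
    · intro x _
      have h1 : HasDerivAt (fun x : ℝ => 3 + x ^ 2) (2 * x) x := by
        simpa using (hasDerivAt_pow 2 x).const_add 3
      refine ((h1.fun_mul (hasDerivAt_sinh x)).fun_sub
        (((hasDerivAt_id' x).const_mul 3).fun_mul (hasDerivAt_cosh x))).congr_deriv ?_
      ring
    · intro x hx
      exact mul_nonneg hx (by linarith [sinh_le_mul_cosh hx])
  suffices 0 ≤ (15 + s ^ 2) * (s * cosh s) - (15 + 6 * s ^ 2) * sinh s by linarith
  refine nonneg_of_hasDerivAt_nonneg
    (f := fun s => (15 + s ^ 2) * (s * cosh s) - (15 + 6 * s ^ 2) * sinh s)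
    (f' := fun x => x * ((3 + x ^ 2) * sinh x - 3 * x * cosh x)) ?_ ?_ (by simp) hs
  · intro x _
    have h1 : HasDerivAt (fun x : ℝ => 15 + x ^ 2) (2 * x) x := by
      simpa using (hasDerivAt_pow 2 x).const_add 15
    have h2 : HasDerivAt (fun x : ℝ => 15 + 6 * x ^ 2) (6 * (2 * x)) x := by
      simpa using ((hasDerivAt_pow 2 x).const_mul 6).const_add 15
    refine ((h1.fun_mul ((hasDerivAt_id' x).fun_mul (hasDerivAt_cosh x))).fun_sub
        (h2.fun_mul (hasDerivAt_sinh x))).congr_deriv ?_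
    ring
  · intro x hx
    exact mul_nonneg hx (aux x hx)

/-- If `log X ≥ c (1 + 2 / X)` with `c ≥ 1`, then `X` exceeds `exp c` by a multiple of `c`. -/
theorem exp_add_le_of_mul_le {b c : ℝ} (hc : 1 ≤ c) (h : c * (exp b + 2) ≤ b * exp b) :
    exp c + 1.59 * c ≤ exp b := by
  by_contra! hlt
  have hX : 0 < exp b := exp_pos b
  have hE : 0 < exp c := exp_pos c
  -- Writing X0 = e^c (1 + u), one needs log(1 + u) ≤ 2c/X0. The coefficient must stay below 2; 1.59
  -- suffices, because c e^{-c} ≤ 1/e gives u ≤ 1.59/e.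
  set X0 := exp c + 1.59 * c with hX0
  have hX0pos : 0 < X0 := by positivity
  set u := 1.59 * c * exp (-c) with hu
  have hu0 : 0 ≤ u := by positivity
  have hEE : exp c * exp (-c) = 1 := by rw [← exp_add]; simp
  have hXu : X0 = exp c * (1 + u) := by
    rw [hX0, hu]; linear_combination (-1.59 * c) * hEE
  have hu1 : u ≤ 0.58495 := by
    have h1 : c ≤ exp (c - 1) := by linarith [add_one_le_exp (c - 1)]
    have h2 : c * exp (-c) ≤ exp (-1) := by
      calc c * exp (-c) ≤ exp (c - 1) * exp (-c) := by gcongr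
        _ = exp (-1) := by rw [← exp_add]; ring_nf
    have h3 : exp (-1 : ℝ) < 0.3678794412 := exp_neg_one_lt_d9
    rw [hu]; nlinarith
  have hlog : log X0 ≤ c + 2 * c / X0 := by
    rw [hXu, log_mul hE.ne' (by positivity), log_exp]
    have h1 := log_one_add_le_pade hu0
    have h2 : 2 * c / (exp c * (1 + u)) = 2 / 1.59 * u / (1 + u) := by
      rw [show 2 / 1.59 * u = 2 * c * exp (-c) by rw [hu]; ring, exp_neg]
      field_simp
    rw [h2]
    have h3 : u * (6 + u) / (6 + 4 * u) ≤ 2 / 1.59 * u / (1 + u) := by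
      rw [div_le_div_iff₀ (by positivity) (by positivity)]
      have : (6 + u) * (1 + u) ≤ 2 / 1.59 * (6 + 4 * u) := by nlinarith
      nlinarith
    linarith
  have h1 : b < log X0 := (lt_log_iff_exp_lt hX0pos).2 hlt
  have h2 : c + 2 * c / exp b ≤ b := by
    have : (c + 2 * c / exp b) * exp b ≤ b * exp b := by
      have : (c + 2 * c / exp b) * exp b = c * (exp b + 2) := by field_simp
      linarith
    exact le_of_mul_le_mul_right this hX
  have h3 : 2 * c / X0 ≤ 2 * c / exp b := by gcongr
  linarith

/-- The case `c ≤ 3 / 2` of `mul_log_lt_of_le`. -/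
theorem mul_log_lt_of_le_small {c σ P g : ℝ} (hc1 : 1 < c) (hc2 : c ≤ 3 / 2)
    (hσ : (6 - c) * σ ≤ 15 * (c - 1)) (hP0 : 0 < P)
    (hP : P * (c ^ 2 - σ) = 4 * σ) (hg : exp c + 1.59 * c + 2 ≤ g) :
    (1 + P / g) * log (1 + P / g) < c * (P / g) := by
  obtain ⟨x, rfl⟩ : ∃ x, c = 1 + x := ⟨c - 1, by ring⟩
  have hx0 : 0 < x := by linarith
  have hx1 : x ≤ 1 / 2 := by linarith
  -- Elimination of σ: `hσ` reads σ(5 - x) ≤ 15x, and the cubic is (1 + x)²(5 - x) - 15x.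
  have hPd : P * (5 - 6 * x + 3 * x ^ 2 - x ^ 3) ≤ 60 * x := by
    have h1 : P * ((1 + x) ^ 2 * (5 - x) - 15 * x) ≤ P * (((1 + x) ^ 2 - σ) * (5 - x)) := by
      gcongr; nlinarith
    have h2 : P * (((1 + x) ^ 2 - σ) * (5 - x)) = 4 * σ * (5 - x) := by
      rw [← hP]; ring
    nlinarith
  have hexp : 2.718 * (1 + x + x ^ 2 / 2) ≤ exp (1 + x) := by
    rw [exp_add]
    have h1 : 1 + x + x ^ 2 / 2 ≤ exp x := quadratic_le_exp_of_nonneg hx0.le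
    have h2 : (2.718 : ℝ) ≤ exp 1 := by linarith [exp_one_gt_d9]
    gcongr
  have hgx : 6.308 + 4.308 * x + 1.359 * x ^ 2 ≤ g := by linarith
  have hg0 : 0 < g := by nlinarith
  set Y := P / g with hY
  have hY0 : 0 < Y := div_pos hP0 hg0
  have hden : 0 < 5 - 6 * x + 3 * x ^ 2 - x ^ 3 := by nlinarith [mul_pos hx0 hx0]
  -- 31.54 - 16.9x is an affine minorant, on 0 ≤ x ≤ 1/2, of the cubic times the lower bound for g;
  -- its constant term is 5 · 6.308.
  have hYw : Y * (31.54 - 16.9 * x) ≤ 60 * x := by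
    have h1 : 31.54 - 16.9 * x ≤
        (5 - 6 * x + 3 * x ^ 2 - x ^ 3) * (6.308 + 4.308 * x + 1.359 * x ^ 2) := by
      nlinarith [mul_pos hx0 hx0, pow_pos hx0 3, pow_pos hx0 4, mul_nonneg hx0.le (sub_nonneg.2 hx1),
        mul_nonneg (pow_pos hx0 2).le (sub_nonneg.2 hx1),
        mul_nonneg (pow_pos hx0 3).le (sub_nonneg.2 hx1)]
    have h2 : (5 - 6 * x + 3 * x ^ 2 - x ^ 3) * (6.308 + 4.308 * x + 1.359 * x ^ 2) ≤
        (5 - 6 * x + 3 * x ^ 2 - x ^ 3) * g := by gcongr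
    have h3 : Y * g = P := by rw [hY]; field_simp
    calc Y * (31.54 - 16.9 * x) ≤ Y * ((5 - 6 * x + 3 * x ^ 2 - x ^ 3) * g) := by
          gcongr; linarith
      _ = P * (5 - 6 * x + 3 * x ^ 2 - x ^ 3) := by rw [← h3]; ring
      _ ≤ 60 * x := hPd
  have hw : 0 < 31.54 - 16.9 * x := by linarith
  have hYle : Y ≤ 60 * x / (31.54 - 16.9 * x) := (le_div_iff₀ hw).2 hYw
  -- This is the goal after log(1 + Y) is replaced by its Padé bound and denominators are cleared.
  have hquad : (3 - 4 * x) * Y + Y ^ 2 < 6 * x := by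
    set Z := 60 * x / (31.54 - 16.9 * x) with hZ
    have hZ0 : 0 < Z := by positivity
    have h1 : (3 - 4 * x) * Y + Y ^ 2 ≤ (3 - 4 * x) * Z + Z ^ 2 := by
      have : 0 ≤ 3 - 4 * x := by linarith
      gcongr
    have h2 : (3 - 4 * x) * Z + Z ^ 2 < 6 * x := by
      have : (3 - 4 * x) * Z + Z ^ 2 =
          ((3 - 4 * x) * (60 * x) * (31.54 - 16.9 * x) + (60 * x) ^ 2) /
            (31.54 - 16.9 * x) ^ 2 := by
        rw [hZ]; field_simp
      rw [this, div_lt_iff₀ (by positivity)]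
      have : (3 - 4 * x) * 60 * (31.54 - 16.9 * x) + 3600 * x <
          6 * (31.54 - 16.9 * x) ^ 2 := by nlinarith
      nlinarith
    linarith
  have hl := log_one_add_le_pade hY0.le
  have h1 : (1 + Y) * log (1 + Y) ≤ (1 + Y) * (Y * (6 + Y) / (6 + 4 * Y)) := by gcongr
  refine h1.trans_lt ?_
  rw [← mul_div_assoc, div_lt_iff₀ (by positivity)]
  have : (1 + Y) * (6 + Y) < (1 + x) * (6 + 4 * Y) := by nlinarith
  nlinarith

theorem exp_three_halves_gt : (4.4816 : ℝ) < exp (3 / 2) := by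
  have h1 : (2.7182818283 : ℝ) < exp 1 := exp_one_gt_d9
  have h2 : exp (3 / 2) ^ 2 = exp 1 ^ 3 := by
    rw [← exp_nat_mul, ← exp_nat_mul]; norm_num
  have h3 : (2.7182818283 : ℝ) ^ 3 ≤ exp 1 ^ 3 := by gcongr
  have h5 : (4.4816 : ℝ) ^ 2 < 2.7182818283 ^ 3 := by norm_num
  refine lt_of_pow_lt_pow_left₀ 2 (exp_pos _).le ?_
  rw [h2]; exact h5.trans_le h3

/-- Supplies the right end E = e^c - c - 0.62 of a chord of y log y. With y = (c + 0.62)/E one has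
log E = c - log(1 + y), and the claim becomes c/E < log(1 + y); the extra 0.62 pays for the
second-order loss in the logarithm. -/
theorem mul_log_lt_of_three_halves_le {c : ℝ} (hc : 3 / 2 ≤ c) :
    1 < exp c - c - 0.62 ∧
      (exp c - c - 0.62) * log (exp c - c - 0.62) < c * (exp c - c - 0.62 - 1) := by
  obtain ⟨z, rfl⟩ : ∃ z, c = 3 / 2 + z := ⟨c - 3 / 2, by ring⟩
  have hz : 0 ≤ z := by linarith
  have h32 := exp_three_halves_gt.le
  have hexp : 4.4816 * (1 + z + z ^ 2 / 2) ≤ exp (3 / 2 + z) := by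
    rw [exp_add]
    have h1 : 1 + z + z ^ 2 / 2 ≤ exp z := quadratic_le_exp_of_nonneg hz
    gcongr
  set c := 3 / 2 + z with hcz
  set E := exp c - c - 0.62 with hE
  have hEz : 2.3616 + 3.4816 * z + 2.24 * z ^ 2 ≤ E := by nlinarith
  have hE1 : 1 < E := by nlinarith
  refine ⟨hE1, ?_⟩
  have hE0 : 0 < E := by linarith
  set y := (c + 0.62) / E with hy
  have hy0 : 0 ≤ y := by positivity
  have hlogE : log E = c - log (1 + y) := by
    have : exp c = E * (1 + y) := by rw [hy]; field_simp; rw [hE]; ring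
    have h2 : c = log E + log (1 + y) := by
      rw [← log_mul hE0.ne' (by positivity), ← this, log_exp]
    linarith
  have hl := pade_le_log_one_add hy0
  have hyE : y * E = c + 0.62 := by rw [hy]; field_simp
  have hmain : c / E < 3 * y * (2 + y) / (6 + 6 * y + y ^ 2) := by
    rw [div_lt_div_iff₀ hE0 (by positivity)]
    have h1 : 3 * y * (2 + y) * E = 3 * (2 + y) * (c + 0.62) := by rw [← hyE]; ring
    rw [h1]
    have h2 : 3 * c * y + c * y ^ 2 < 6 * 0.62 + 3 * 0.62 * y := by
      have h3 : 3 * c * (c + 0.62) * E + c * (c + 0.62) ^ 2 <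
          6 * 0.62 * E ^ 2 + 3 * 0.62 * (c + 0.62) * E := by
        obtain ⟨d, hd⟩ : ∃ d, E = 2.3616 + 3.4816 * z + 2.24 * z ^ 2 + d :=
          ⟨E - (2.3616 + 3.4816 * z + 2.24 * z ^ 2), by ring⟩
        have hd0 : 0 ≤ d := by linarith
        rw [hd, hcz]
        have := mul_nonneg hz hd0
        have := mul_nonneg (mul_nonneg hz hz) hd0
        have : 0 ≤ z ^ 2 := by positivity
        have : 0 ≤ z ^ 3 := by positivity
        have : 0 ≤ z ^ 4 := by positivity
        nlinarith
      have h4 : 3 * c * y + c * y ^ 2 =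
          (3 * c * (c + 0.62) * E + c * (c + 0.62) ^ 2) / E ^ 2 := by
        rw [hy]; field_simp
      have h5 : 6 * 0.62 + 3 * 0.62 * y =
          (6 * 0.62 * E ^ 2 + 3 * 0.62 * (c + 0.62) * E) / E ^ 2 := by
        rw [hy]; field_simp
      rw [h4, h5]; gcongr
    nlinarith
  have : log E < c - c / E := by linarith
  calc E * log E < E * (c - c / E) := by gcongr
    _ = c * (E - 1) := by field_simp

/-- The numerical core of the case c ≥ 3/2. Since s - s² decreases for s ≥ 1/2, s may be replaced by
an upper bound S, which leaves polynomial inequalities in c. -/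
theorem quadratic_lt_mul_exp {s c : ℝ} (hs1 : 1.15 ≤ s) (hsc : s < c) (hc : 3 / 2 ≤ c)
    (hσ : (6 - c) * s ^ 2 ≤ 15 * (c - 1)) :
    (1.62 + c) * (1.59 * c + 2) <
      (0.59 * c + 0.38) * exp c + 1.89 + 2 * c + 2 * c ^ 2 + 2 * (s - s ^ 2) := by
  have hexpc : 4.48 * (1 + (c - 3 / 2) + (c - 3 / 2) ^ 2 / 2) ≤ exp c := by
    have h32 : (4.48 : ℝ) ≤ exp (3 / 2) := by linarith [exp_three_halves_gt]
    have h0 : exp c = exp (3 / 2) * exp (c - 3 / 2) := by rw [← exp_add]; ring_nf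
    rw [h0]
    have h1 := quadratic_le_exp_of_nonneg (x := c - 3 / 2) (by linarith)
    gcongr
  have h2 : (0.59 * c + 0.38) * (4.48 * (1 + (c - 3 / 2) + (c - 3 / 2) ^ 2 / 2)) ≤
      (0.59 * c + 0.38) * exp c := by gcongr
  suffices h : ∃ S, s ≤ S ∧ (1.62 + c) * (1.59 * c + 2) <
      (0.59 * c + 0.38) * (4.48 * (1 + (c - 3 / 2) + (c - 3 / 2) ^ 2 / 2)) + 1.89 + 2 * c +
        2 * c ^ 2 + 2 * (S - S ^ 2) by
    obtain ⟨S, h3, h5⟩ := h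
    have h4 : S - S ^ 2 ≤ s - s ^ 2 := by
      have : 0 ≤ (S - s) * (S + s - 1) := mul_nonneg (by linarith) (by linarith)
      linarith
    linarith
  obtain ⟨w, rfl⟩ : ∃ w, c = 3 / 2 + w := ⟨c - 3 / 2, by ring⟩
  have hw : 0 ≤ w := by linarith
  -- Near c = 3/2 the bound s < c is too weak, and `hσ` improves it to s ≤ c - 0.1; from c = 1.6 on,
  -- S = c is enough.
  rcases le_total w 0.1 with hw1 | hw1
  · refine ⟨3 / 2 + w - 0.1, ?_, ?_⟩
    · by_contra! h4
      have h5 : (6 - (3 / 2 + w)) * (3 / 2 + w - 0.1) ^ 2 ≤ (6 - (3 / 2 + w)) * s ^ 2 := by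
        have : (3 / 2 + w - 0.1) ^ 2 ≤ s ^ 2 := pow_le_pow_left₀ (by linarith) h4.le 2
        exact mul_le_mul_of_nonneg_left this (by linarith)
      have h6 : 0 ≤ w ^ 2 * (0.1 - w) := mul_nonneg (by positivity) (by linarith)
      have h7 := pow_nonneg hw 2
      clear hexpc h2 h4 hsc
      ring_nf at h5 hσ h6 h7
      linarith
    · have h7 := pow_nonneg hw 2
      have h8 := pow_nonneg hw 3
      clear hexpc h2 hσ
      ring_nf at h7 h8 ⊢
      linarith
  · refine ⟨3 / 2 + w, hsc.le, ?_⟩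
    obtain ⟨v, rfl⟩ : ∃ v, w = 0.1 + v := ⟨w - 0.1, by ring⟩
    have hv : 0 ≤ v := by linarith
    have h7 := pow_nonneg hv 2
    have h8 := pow_nonneg hv 3
    clear hexpc h2 hσ
    ring_nf at h7 h8 ⊢
    linarith

/-- The case `c ≥ 3 / 2` of `mul_log_lt_of_le`. -/
theorem mul_log_lt_of_le_large {s c P g : ℝ} (hs : 0 < s) (hsc : s < c) (hc : 3 / 2 ≤ c)
    (hσ : (6 - c) * s ^ 2 ≤ 15 * (c - 1)) (hd : (c - s) * (exp (2 * s) - 1) = 2 * s)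
    (hP0 : 0 < P) (hP : P = exp (2 * s) - 2 + exp (-(2 * s)))
    (hg : exp c + 1.59 * c + 2 ≤ g) :
    (1 + P / g) * log (1 + P / g) < c * (P / g) := by
  obtain ⟨hE1, hElog⟩ := mul_log_lt_of_three_halves_le hc
  have hc0 : 0 < c := by linarith
  have hg0 : 0 < g := lt_of_lt_of_le (by positivity) hg
  -- Quadratic Taylor bound for e^{2c} = e^{2s} e^{2(c-s)}; the products (c - s)e^{2s} are then
  -- eliminated exactly through `hd`, the relation c = s coth s.
  have he2c : P + 2 - exp (-(2 * s)) + 2 * c + 2 * s + 2 * c ^ 2 - 2 * s ^ 2 ≤ exp c ^ 2 := by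
    have h0 : exp c ^ 2 = exp (2 * s) * exp (2 * (c - s)) := by
      rw [← exp_nat_mul, ← exp_add]; norm_num; ring_nf
    have h1 := quadratic_le_exp_of_nonneg (x := 2 * (c - s)) (by linarith)
    have h2 : exp (2 * s) * (1 + 2 * (c - s) + (2 * (c - s)) ^ 2 / 2) ≤ exp c ^ 2 := by
      rw [h0]; gcongr
    have h3 : (c - s) * exp (2 * s) = 2 * s + (c - s) := by linarith
    have h4 : exp (2 * s) * (1 + 2 * (c - s) + (2 * (c - s)) ^ 2 / 2) =
        exp (2 * s) + 2 * (2 * s + (c - s)) + 2 * (c - s) * (2 * s + (c - s)) := by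
      rw [← h3]; ring
    rw [h4] at h2
    rw [hP]
    nlinarith
  -- For smaller s, `hd` with c ≥ 3/2 contradicts the cubic Taylor bound for e^{2s}.
  have hs1 : 1.15 ≤ s := by
    by_contra! h
    have hexp : 1 + 2 * s + (2 * s) ^ 2 / 2 + (2 * s) ^ 3 / 6 ≤ exp (2 * s) := by
      have := sum_le_exp_of_nonneg (x := 2 * s) (by linarith) 4
      simp [Finset.sum_range_succ, Nat.factorial] at this
      linarith
    have h1 : (3 / 2 - s) * (exp (2 * s) - 1) ≤ 2 * s := by
      have h0 : 0 ≤ exp (2 * s) - 1 := by linarith [add_one_le_exp (2 * s)]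
      have := mul_le_mul_of_nonneg_right (show 3 / 2 - s ≤ c - s by linarith) h0
      linarith
    have h2 : (3 / 2 - s) * (2 * s + (2 * s) ^ 2 / 2 + (2 * s) ^ 3 / 6) ≤ 2 * s :=
      le_trans (mul_le_mul_of_nonneg_left (by linarith) (by linarith)) h1
    have h3 : 2 * s * ((3 / 2 - s) * (1 + s + (2 / 3) * s ^ 2)) ≤ 2 * s * 1 := by linarith
    have h4 : (3 / 2 - s) * (1 + s + (2 / 3) * s ^ 2) ≤ 1 :=
      le_of_mul_le_mul_left h3 (by linarith)
    have h5 : s ^ 3 ≤ s ^ 2 * 1.15 := by rw [pow_succ]; gcongr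
    have h6 : s ^ 2 ≤ s * 1.15 := by rw [pow_two]; gcongr
    nlinarith
  have hem : exp (-(2 * s)) ≤ 0.11 := by
    have h1 : exp (-(2 * s)) ≤ exp (-2.3) := by gcongr; linarith
    have h3 : (9.1 : ℝ) ≤ exp 2.3 := by
      have := sum_le_exp_of_nonneg (x := (2.3 : ℝ)) (by norm_num) 7
      norm_num [Finset.sum_range_succ, Nat.factorial] at this
      linarith
    have h4 : exp (-2.3 : ℝ) ≤ 0.11 := by
      rw [exp_neg, inv_le_comm₀ (exp_pos _) (by norm_num)]
      norm_num at h3 ⊢; linarith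
    linarith
  have hkey : P < (exp c - c - 0.62 - 1) * (exp c + 1.59 * c + 2) := by
    have h1 := quadratic_lt_mul_exp hs1 hsc hc hσ
    have h6 : (exp c - c - 0.62 - 1) * (exp c + 1.59 * c + 2) =
        exp c ^ 2 + (0.59 * c + 0.38) * exp c - (1.62 + c) * (1.59 * c + 2) := by ring
    linarith
  have hEg : P / g < exp c - c - 0.62 - 1 := by
    rw [div_lt_iff₀ hg0]
    have : (exp c - c - 0.62 - 1) * (exp c + 1.59 * c + 2) ≤ (exp c - c - 0.62 - 1) * g := by
      apply mul_le_mul_of_nonneg_left hg; linarith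
    linarith
  set E := exp c - c - 0.62 with hE
  have hY0 : 0 < P / g := div_pos hP0 hg0
  -- Since 1 < 1 + P/g < E, convexity puts y log y at 1 + P/g below the chord from 1 to E; the chord
  -- has slope E log E/(E - 1) < c.
  have hconv := convexOn_mul_log
  have ha : 0 ≤ 1 - (P / g) / (E - 1) := by
    rw [sub_nonneg, div_le_one (by linarith)]; exact hEg.le
  have hb : 0 ≤ (P / g) / (E - 1) := div_nonneg hY0.le (by linarith)
  have hθ := hconv.2 (show (1 : ℝ) ∈ Set.Ici 0 by norm_num)
    (show E ∈ Set.Ici (0 : ℝ) from Set.mem_Ici.2 (by linarith)) ha hb (by ring)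
  have hne : E - 1 ≠ 0 := by linarith
  have hpt : (1 - (P / g) / (E - 1)) • (1 : ℝ) + ((P / g) / (E - 1)) • E = 1 + P / g := by
    simp only [smul_eq_mul]
    field_simp
    ring
  rw [hpt] at hθ
  simp only [smul_eq_mul, log_one, mul_zero, zero_add] at hθ
  refine hθ.trans_lt ?_
  calc (P / g) / (E - 1) * (E * log E) < (P / g) / (E - 1) * (c * (E - 1)) := by
        apply mul_lt_mul_of_pos_left hElog
        exact div_pos hY0 (by linarith)
    _ = c * (P / g) := by field_simp

/-- For `c = s coth s` and `c (e ^ b + 2) ≤ b e ^ b`, the function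
`t ↦ log (1 + 2 (cosh t - 1) / (e ^ b + 2)) / t ^ 2` is strictly increasing at `t = 2 s`. -/
theorem mul_log_lt_of_le {b s : ℝ} (hs : 0 < s)
    (h : s * cosh s * (exp b + 2) ≤ b * exp b * sinh s) :
    (1 + 4 * sinh s ^ 2 / (exp b + 2)) * log (1 + 4 * sinh s ^ 2 / (exp b + 2)) * sinh s <
      s * cosh s * (4 * sinh s ^ 2 / (exp b + 2)) := by
  have hS : 0 < sinh s := sinh_pos_iff.2 hs
  obtain ⟨c, hc⟩ : ∃ c, c * sinh s = s * cosh s := ⟨s * cosh s / sinh s, by field_simp⟩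
  have hcs := cosh_sq s
  have hσ : (6 - c) * s ^ 2 ≤ 15 * (c - 1) := by
    have h1 := pade_mul_sinh_le hs.le
    rw [← hc] at h1
    have : (15 + 6 * s ^ 2) ≤ (15 + s ^ 2) * c := by
      apply le_of_mul_le_mul_right _ hS; linarith
    linarith
  have hsc : s < c := by
    have : s * sinh s < c * sinh s := by
      rw [hc]; have := sinh_lt_cosh s; gcongr
    exact lt_of_mul_lt_mul_right this hS.le
  have hc1 : 1 < c := by
    by_contra! h
    nlinarith [mul_pos hs hs]
  have hP : 4 * sinh s ^ 2 * (c ^ 2 - s ^ 2) = 4 * s ^ 2 := by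
    have : c ^ 2 * sinh s ^ 2 = s ^ 2 * cosh s ^ 2 := by
      rw [← mul_pow, hc, mul_pow]
    rw [hcs] at this
    linarith
  have hg : exp c + 1.59 * c + 2 ≤ exp b + 2 := by
    have := exp_add_le_of_mul_le (b := b) hc1.le (by
      apply le_of_mul_le_mul_right _ hS
      calc c * (exp b + 2) * sinh s = c * sinh s * (exp b + 2) := by ring
        _ ≤ _ := by rw [hc]; exact h)
    linarith
  have hP0 : 0 < 4 * sinh s ^ 2 := by positivity
  have hfinal : (1 + 4 * sinh s ^ 2 / (exp b + 2)) * log (1 + 4 * sinh s ^ 2 / (exp b + 2)) <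
      c * (4 * sinh s ^ 2 / (exp b + 2)) := by
    rcases le_total c (3 / 2) with h32 | h32
    · exact mul_log_lt_of_le_small hc1 h32 hσ hP0 hP hg
    · refine mul_log_lt_of_le_large hs hsc h32 hσ ?_ hP0 ?_ hg
      · have h1 : exp (2 * s) = exp s * exp s := by rw [← exp_add]; ring_nf
        have h2 : exp s * exp (-s) = 1 := by rw [← exp_add]; simp
        rw [sinh_eq, cosh_eq] at hc
        rw [h1]
        linear_combination (2 * exp s) * hc + (c + s) * h2
      · have h1 : exp (2 * s) = exp s * exp s := by rw [← exp_add]; ring_nf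
        have h3 : exp (-(2 * s)) = exp (-s) * exp (-s) := by rw [← exp_add]; ring_nf
        have h2 : exp s * exp (-s) = 1 := by rw [← exp_add]; simp
        rw [sinh_eq, h1, h3]
        linear_combination (-2) * h2
  calc _ < c * (4 * sinh s ^ 2 / (exp b + 2)) * sinh s := by gcongr
    _ = _ := by rw [← hc]; ring

/-- `log (1 + q (cosh t - 1)) / t ^ 2` is strictly increasing for small `t` if `q < 1 / 3`,
uniformly for `q` away from `1 / 3`. -/
theorem exists_forall_log_lt {q₁ : ℝ} (hq₁ : q₁ < 1 / 3) :
    ∃ t₀ : ℝ, 0 < t₀ ∧ ∀ q t : ℝ, 0 < q → q ≤ q₁ → 0 < t → t ≤ t₀ →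
      2 * ((1 + q * (cosh t - 1)) * log (1 + q * (cosh t - 1))) < q * (t * sinh t) := by
  have hcont : Filter.Tendsto (fun t : ℝ => q₁ * cosh (t / 2) ^ 4) (nhds 0)
      (nhds (q₁ * cosh (0 / 2) ^ 4)) := by
    apply Continuous.tendsto; fun_prop
  have hev : ∀ᶠ t in nhds (0 : ℝ), q₁ * cosh (t / 2) ^ 4 < 1 / 3 :=
    hcont.eventually (gt_mem_nhds (by simpa using hq₁))
  obtain ⟨ε, hε, hball⟩ := Metric.eventually_nhds_iff.1 hev
  refine ⟨ε / 2, by positivity, fun q t hq hqq ht htt => ?_⟩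
  have hq3 : q * cosh (t / 2) ^ 4 < 1 / 3 := by
    refine lt_of_le_of_lt ?_ (hball (y := t) (by
      rw [Real.dist_eq, sub_zero, abs_of_pos ht]; linarith))
    gcongr
  have hC : cosh t - 1 = 2 * sinh (t / 2) ^ 2 := by
    have h1 := cosh_two_mul (t / 2)
    rw [show 2 * (t / 2) = t by ring] at h1
    have h2 := cosh_sq (t / 2)
    linarith
  have hS : sinh (t / 2) ≤ t / 2 * cosh (t / 2) := sinh_le_mul_cosh (by linarith)
  have hS0 : 0 < sinh (t / 2) := sinh_pos_iff.2 (by linarith)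
  have hx0 : 0 < cosh t - 1 := by rw [hC]; positivity
  have hx2 : (cosh t - 1) ^ 2 ≤ t ^ 4 / 4 * cosh (t / 2) ^ 4 := by
    rw [hC]
    calc (2 * sinh (t / 2) ^ 2) ^ 2 = 4 * sinh (t / 2) ^ 4 := by ring
      _ ≤ 4 * (t / 2 * cosh (t / 2)) ^ 4 := by gcongr
      _ = _ := by ring
  -- Both sides of the claim agree to second order in t. To fourth order this gain t⁴/12 competes
  -- with q(cosh t - 1)² ≈ q t⁴/4, whence the threshold q = 1/3.
  have htay : 2 * (cosh t - 1) + t ^ 4 / 12 ≤ t * sinh t := by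
    suffices 0 ≤ t * sinh t - 2 * (cosh t - 1) - t ^ 4 / 12 by linarith
    refine nonneg_of_hasDerivAt_nonneg
      (f := fun t => t * sinh t - 2 * (cosh t - 1) - t ^ 4 / 12)
      (f' := fun t => t * cosh t - sinh t - t ^ 3 / 3) ?_ ?_ (by simp) ht.le
    · intro x _
      refine ((((hasDerivAt_id' x).fun_mul (hasDerivAt_sinh x)).fun_sub
        (((hasDerivAt_cosh x).sub_const 1).const_mul 2)).fun_sub
        ((hasDerivAt_pow 4 x).div_const 12)).congr_deriv ?_
      push_cast; ring
    · intro x hx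
      refine nonneg_of_hasDerivAt_nonneg
        (f := fun t => t * cosh t - sinh t - t ^ 3 / 3)
        (f' := fun t => t * (sinh t - t)) ?_ ?_ (by simp) hx
      · intro x _
        refine ((((hasDerivAt_id' x).fun_mul (hasDerivAt_cosh x)).fun_sub
          (hasDerivAt_sinh x)).fun_sub ((hasDerivAt_pow 3 x).div_const 3)).congr_deriv ?_
        push_cast; ring
      · intro x hx
        exact mul_nonneg hx (sub_nonneg.2 (self_le_sinh_iff.2 hx))
  set x := cosh t - 1 with hx
  have hy0 : 0 < q * x := by positivity
  have hlog : (1 + q * x) * log (1 + q * x) ≤ q * x + (q * x) ^ 2 / 2 := by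
    have h1 := log_one_add_le_pade hy0.le
    calc (1 + q * x) * log (1 + q * x)
        ≤ (1 + q * x) * (q * x * (6 + q * x) / (6 + 4 * (q * x))) := by gcongr
      _ ≤ q * x + (q * x) ^ 2 / 2 := by
          rw [← mul_div_assoc, div_le_iff₀ (by positivity)]
          nlinarith [pow_pos hy0 3]
  have h4 : q * (cosh t - 1) ^ 2 < t ^ 4 / 12 := by
    calc q * (cosh t - 1) ^ 2 ≤ q * (t ^ 4 / 4 * cosh (t / 2) ^ 4) := by gcongr
      _ = t ^ 4 / 4 * (q * cosh (t / 2) ^ 4) := by ring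
      _ < t ^ 4 / 4 * (1 / 3) := by gcongr
      _ = _ := by ring
  have h5 : 2 * (q * x + (q * x) ^ 2 / 2) < q * (t * sinh t) := by
    have : 2 * x + q * x ^ 2 < t * sinh t := by linarith
    calc 2 * (q * x + (q * x) ^ 2 / 2) = q * (2 * x + q * x ^ 2) := by ring
      _ < _ := by gcongr
  linarith

end Elementary

end BEG

namespace BEG

/-! ### The free energy and the equilibrium macrostates -/

section Landscape

open Real

/-- The model is ordered if some nonzero magnetization is at least as favourable as zero. -/
def Ordered (K b : ℝ) : Prop := ∃ m : ℝ, m ≠ 0 ∧ freeEnergy K b 0 ≤ freeEnergy K b m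

theorem freeEnergy_zero (K b : ℝ) : freeEnergy K b 0 = logZ b 0 := by simp [freeEnergy]

theorem freeEnergy_neg (K b m : ℝ) : freeEnergy K b (-m) = freeEnergy K b m := by
  simp [freeEnergy, logZ]

theorem logZ_sub (b t : ℝ) :
    logZ b t - logZ b 0 = log (1 + 2 / (exp b + 2) * (cosh t - 1)) := by
  have h1 := one_add_pos b t
  have h2 := one_add_pos b 0
  have hb := exp_pos b
  unfold logZ
  rw [← log_div h1.ne' h2.ne', cosh_zero, exp_neg]
  congr 1
  field_simp
  ring

theorem cosh_sub_one (t : ℝ) : cosh t - 1 = 2 * sinh (t / 2) ^ 2 := by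
  have h1 := cosh_two_mul (t / 2)
  rw [show 2 * (t / 2) = t by ring] at h1
  have h2 := cosh_sq (t / 2)
  linarith

theorem meanSpin_eq (b t : ℝ) : meanSpin b t =
    2 / (exp b + 2) * sinh t / (1 + 2 / (exp b + 2) * (cosh t - 1)) := by
  have hb := exp_pos b
  have hc := cosh_pos t
  have h3 : 1 + 2 / (exp b + 2) * (cosh t - 1) = (exp b + 2 * cosh t) / (exp b + 2) := by
    field_simp; ring
  rw [h3]
  unfold meanSpin
  rw [exp_neg]
  field_simp

theorem abs_meanSpin_le (b t : ℝ) : |meanSpin b t| ≤ 1 := by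
  have hb := exp_pos (-b)
  have h1 := one_add_pos b t
  unfold meanSpin
  rw [abs_div, abs_of_pos h1, div_le_one h1, abs_mul, abs_of_pos (by positivity : 0 < 2 * exp (-b))]
  have h2 : |sinh t| ≤ cosh t := by
    rw [abs_le]
    constructor
    · have := exp_pos t
      rw [sinh_eq, cosh_eq]; linarith
    · exact (sinh_lt_cosh t).le
  have := mul_le_mul_of_nonneg_left h2 (by positivity : 0 ≤ 2 * exp (-b))
  linarith

theorem continuous_freeEnergy (K : ℝ) : Continuous fun x : ℝ × ℝ => freeEnergy K x.1 x.2 := by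
  unfold freeEnergy logZ
  refine Continuous.sub (Continuous.log (by fun_prop) fun x => (one_add_pos _ _).ne') (by fun_prop)

/-- The pointwise form of nonnegativity of relative entropy. The equality case is what makes the
maximizer at a given field unique. -/
theorem mul_log_sub_log_le {a p : ℝ} (ha : 0 ≤ a) (hp : 0 < p) :
    a * (log p - log a) ≤ p - a ∧ (a * (log p - log a) = p - a → a = p) := by
  rcases ha.eq_or_lt with rfl | ha
  · simp only [zero_mul, sub_zero]
    exact ⟨hp.le, fun h => h⟩
  · rw [← log_div hp.ne' ha.ne']
    have h1 := log_le_sub_one_of_pos (div_pos hp ha)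
    have h2 : a * (p / a - 1) = p - a := by field_simp
    refine ⟨by rw [← h2]; gcongr, fun h => ?_⟩
    by_contra hne
    have h3 : p / a ≠ 1 := fun h => hne ((div_eq_one_iff_eq ha.ne').1 h).symm
    have h4 := log_lt_sub_one_of_pos (div_pos hp ha) h3
    rw [← h2] at h
    exact h4.ne (mul_left_cancel₀ ha.ne' h)

/-- The normalized weights of a spin in the field `t`. -/
noncomputable def spinLaw (b t : ℝ) (s : SignType) : ℝ := spinWeight b t s / exp (logZ b t)

theorem spinLaw_pos (b t : ℝ) (s : SignType) : 0 < spinLaw b t s := div_pos (exp_pos _) (exp_pos _)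

theorem sum_spinLaw (b t : ℝ) : ∑ s, spinLaw b t s = 1 := by
  unfold spinLaw
  rw [← Finset.sum_div, sum_spinWeight]
  exact div_self (exp_pos _).ne'

theorem spinLaw_mem (b t : ℝ) : spinLaw b t ∈ stdSimplex ℝ SignType :=
  ⟨fun s => (spinLaw_pos b t s).le, sum_spinLaw b t⟩

theorem spinLaw_sub (b t : ℝ) : spinLaw b t 1 - spinLaw b t (-1) = meanSpin b t := by
  unfold spinLaw meanSpin spinWeight
  rw [exp_logZ, SignType.coe_neg, SignType.coe_one, sinh_eq]
  have h1 : exp (-b * (-1) ^ 2 + t * -1) = exp (-b) * exp (-t) := by rw [← exp_add]; ring_nf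
  have h2 : exp (-b * 1 ^ 2 + t * 1) = exp (-b) * exp t := by rw [← exp_add]; ring_nf
  rw [h1, h2]
  ring

/-- The Gibbs variational principle for the landscape. -/
theorem landscape_variational (b K t : ℝ) {a : SignType → ℝ} (ha : a ∈ stdSimplex ℝ SignType) :
    landscape b K a ≤ logZ b t - t * (a 1 - a (-1)) + b * K * (a 1 - a (-1)) ^ 2 ∧
      (landscape b K a = logZ b t - t * (a 1 - a (-1)) + b * K * (a 1 - a (-1)) ^ 2 →
        a = spinLaw b t) := by
  have h1 : ∀ s, log (spinLaw b t s) = -b * (s : ℝ) ^ 2 + t * (s : ℝ) - logZ b t := by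
    intro s
    unfold spinLaw spinWeight
    rw [log_div (exp_pos _).ne' (exp_pos _).ne', log_exp, log_exp]
  have hsum := ha.2
  have h2 : landscape b K a - (logZ b t - t * (a 1 - a (-1)) + b * K * (a 1 - a (-1)) ^ 2) =
      ∑ s, a s * (log (spinLaw b t s) - log (a s)) := by
    simp only [mul_sub, Finset.sum_sub_distrib, h1]
    unfold landscape
    rw [sum_signType] at hsum
    rw [sum_signType (fun s => a s * (-b * (s : ℝ) ^ 2 + t * (s : ℝ))),
      ← Finset.sum_mul, ha.2]
    simp only [SignType.coe_zero, SignType.coe_neg, SignType.coe_one]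
    ring
  have h3 : ∑ s, (spinLaw b t s - a s) = 0 := by
    rw [Finset.sum_sub_distrib, sum_spinLaw, hsum, sub_self]
  have h4 : ∀ s, a s * (log (spinLaw b t s) - log (a s)) ≤ spinLaw b t s - a s :=
    fun s => (mul_log_sub_log_le (ha.1 s) (spinLaw_pos b t s)).1
  constructor
  · have := Finset.sum_le_sum fun s (_ : s ∈ Finset.univ) => h4 s
    linarith
  · intro h
    rw [h, sub_self, ← h3] at h2
    have h5 := (Finset.sum_eq_sum_iff_of_le fun s _ => h4 s).1 h2.symm
    ext s
    exact (mul_log_sub_log_le (ha.1 s) (spinLaw_pos b t s)).2 (h5 s (Finset.mem_univ s))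

theorem landscape_le_freeEnergy (b K : ℝ) {a : SignType → ℝ} (ha : a ∈ stdSimplex ℝ SignType) :
    landscape b K a ≤ freeEnergy K b (a 1 - a (-1)) := by
  refine (landscape_variational b K (2 * b * K * (a 1 - a (-1))) ha).1.trans (le_of_eq ?_)
  unfold freeEnergy
  ring

theorem landscape_spinLaw (b K t : ℝ) : landscape b K (spinLaw b t) =
    logZ b t - t * meanSpin b t + b * K * meanSpin b t ^ 2 := by
  have h1 : ∀ s, log (spinLaw b t s) = -b * (s : ℝ) ^ 2 + t * (s : ℝ) - logZ b t := by
    intro s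
    unfold spinLaw spinWeight
    rw [log_div (exp_pos _).ne' (exp_pos _).ne', log_exp, log_exp]
  have h2 := sum_spinLaw b t
  rw [sum_signType] at h2
  have h3 := spinLaw_sub b t
  unfold landscape
  rw [sum_signType, h1, h1, h1, ← h3]
  simp only [SignType.coe_zero, SignType.coe_neg, SignType.coe_one]
  linear_combination logZ b t * h2

/-- One step of the mean-field iteration increases the free energy. -/
theorem freeEnergy_add_le (K b m : ℝ) :
    freeEnergy K b m + b * K * (meanSpin b (2 * b * K * m) - m) ^ 2 ≤
      landscape b K (spinLaw b (2 * b * K * m)) ∧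
    freeEnergy K b m + b * K * (meanSpin b (2 * b * K * m) - m) ^ 2 ≤
      freeEnergy K b (meanSpin b (2 * b * K * m)) := by
  have h1 := landscape_spinLaw b K (2 * b * K * m)
  have h2 := landscape_le_freeEnergy b K (spinLaw_mem b (2 * b * K * m))
  rw [spinLaw_sub] at h2
  have h3 : freeEnergy K b m + b * K * (meanSpin b (2 * b * K * m) - m) ^ 2 =
      landscape b K (spinLaw b (2 * b * K * m)) := by
    rw [h1]; unfold freeEnergy; ring
  exact ⟨h3.le, h3.le.trans h2⟩

/-- Replacing m by the mean spin m₁ in its field raises F by at least bK(m₁ - m)², so a maximizer is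
a fixed point. -/
theorem meanSpin_eq_of_max {K b m : ℝ} (hK : 0 < K) (hb : 0 < b)
    (h : ∀ m', freeEnergy K b m' ≤ freeEnergy K b m) : meanSpin b (2 * b * K * m) = m := by
  have h1 := (freeEnergy_add_le K b m).2.trans (h _)
  have h2 : b * K * (meanSpin b (2 * b * K * m) - m) ^ 2 ≤ 0 := by linarith
  have h3 : 0 < b * K := by positivity
  have h4 : (meanSpin b (2 * b * K * m) - m) ^ 2 ≤ 0 := by
    by_contra! h5
    nlinarith
  have := pow_eq_zero_iff (two_ne_zero) |>.1 (le_antisymm h4 (sq_nonneg _))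
  linarith

/-- One mean-field step does not lower F and lands in [-1, 1], so a maximum over this compact
interval is global. -/
theorem exists_max_freeEnergy {K b : ℝ} (hK : 0 < K) (hb : 0 < b) :
    ∃ m, ∀ m', freeEnergy K b m' ≤ freeEnergy K b m := by
  have hcont : Continuous fun m => freeEnergy K b m :=
    (continuous_freeEnergy K).comp (by fun_prop : Continuous fun m : ℝ => (b, m))
  obtain ⟨m, -, hm⟩ := isCompact_Icc.exists_isMaxOn (s := Set.Icc (-1 : ℝ) 1)
    ⟨0, by norm_num⟩ hcont.continuousOn
  refine ⟨m, fun m' => ?_⟩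
  have h1 := (freeEnergy_add_le K b m').2
  have h2 : 0 ≤ b * K * (meanSpin b (2 * b * K * m') - m') ^ 2 := by positivity
  have h3 : freeEnergy K b (meanSpin b (2 * b * K * m')) ≤ freeEnergy K b m :=
    hm (abs_le.1 (abs_meanSpin_le b _))
  linarith

theorem exists_pos_max_of_ordered {K b : ℝ} (hK : 0 < K) (hb : 0 < b) (h : Ordered K b) :
    ∃ m, 0 < m ∧ m ≤ 1 ∧ (∀ m', freeEnergy K b m' ≤ freeEnergy K b m) ∧
      meanSpin b (2 * b * K * m) = m := by
  have key : ∃ m, m ≠ 0 ∧ ∀ m', freeEnergy K b m' ≤ freeEnergy K b m := by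
    obtain ⟨m, hm⟩ := exists_max_freeEnergy hK hb
    by_cases h0 : m = 0
    · subst h0
      obtain ⟨m₁, h1, h2⟩ := h
      exact ⟨m₁, h1, fun m' => (hm m').trans h2⟩
    · exact ⟨m, h0, hm⟩
  obtain ⟨m, h0, hm⟩ := key
  have habs : freeEnergy K b |m| = freeEnergy K b m := by
    rcases abs_choice m with h1 | h1 <;> rw [h1]
    exact freeEnergy_neg K b m
  have hm' : ∀ m', freeEnergy K b m' ≤ freeEnergy K b |m| := fun m' => by
    rw [habs]; exact hm m'
  have hstat := meanSpin_eq_of_max hK hb hm'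
  refine ⟨|m|, abs_pos.2 h0, ?_, hm', hstat⟩
  rw [← hstat]
  exact (le_abs_self _).trans (abs_meanSpin_le b _)

theorem swap_mem_stdSimplex {a : SignType → ℝ} (ha : a ∈ stdSimplex ℝ SignType) :
    (fun s => a (-s)) ∈ stdSimplex ℝ SignType := by
  refine ⟨fun s => ha.1 _, ?_⟩
  have h := ha.2
  rw [sum_signType] at h ⊢
  simp only [neg_zero, neg_neg]
  linarith

theorem landscape_swap (b K : ℝ) (a : SignType → ℝ) :
    landscape b K (fun s => a (-s)) = landscape b K a := by
  unfold landscape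
  rw [sum_signType, sum_signType]
  simp only [neg_zero, neg_neg]
  ring

theorem continuous_landscape (b K : ℝ) : Continuous (landscape b K) := by
  unfold landscape
  refine Continuous.sub (by fun_prop) (continuous_finsetSum _ fun i _ => ?_)
  exact continuous_mul_log.comp (continuous_apply i)

/-- Without order, every macrostate has zero magnetization and is the zero-field law by the equality
case of the variational principle. With order, a macrostate of nonzero magnetization and its spin
flip are distinct; if instead the magnetization is zero, the law in the field of a nonzero maximizer
of F is a second macrostate. -/
theorem multimodal_iff_ordered {K b : ℝ} (hK : 0 < K) (hb : 0 < b) :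
    Multimodal b K ↔ Ordered K b := by
  have hzero : ∀ a ∈ stdSimplex ℝ SignType, a 1 - a (-1) = 0 →
      landscape b K a ≤ logZ b 0 ∧ (landscape b K a = logZ b 0 → a = spinLaw b 0) := by
    intro a ha h0
    have h := landscape_variational b K 0 ha
    simpa [h0] using h
  have hmean0 : meanSpin b 0 = 0 := by simp [meanSpin]
  have hval0 : landscape b K (spinLaw b 0) = logZ b 0 := by
    rw [landscape_spinLaw, hmean0]; ring
  constructor
  · rintro ⟨a₁, ha₁, a₂, ha₂, hne⟩
    by_contra hord
    have hall : ∀ a ∈ macrostates b K, a = spinLaw b 0 := by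
      intro a ha
      have hge : logZ b 0 ≤ landscape b K a := by
        rw [← hval0]; exact ha.2 (spinLaw_mem b 0)
      by_cases h0 : a 1 - a (-1) = 0
      · have h := hzero a ha.1 h0
        exact h.2 (le_antisymm h.1 hge)
      · refine absurd ⟨_, h0, ?_⟩ hord
        rw [freeEnergy_zero]
        exact hge.trans (landscape_le_freeEnergy b K ha.1)
    exact hne ((hall a₁ ha₁).trans (hall a₂ ha₂).symm)
  · intro hord
    obtain ⟨a, ha, hmax⟩ := (isCompact_stdSimplex ℝ SignType).exists_isMaxOn
      ⟨_, spinLaw_mem b 0⟩ (continuous_landscape b K).continuousOn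
    by_cases h0 : a 1 - a (-1) = 0
    · obtain ⟨m, hm0, -, hm, hstat⟩ := exists_pos_max_of_ordered hK hb hord
      have h1 := (freeEnergy_add_le K b m).1
      have h2 : 0 ≤ b * K * (meanSpin b (2 * b * K * m) - m) ^ 2 := by positivity
      have h3 : landscape b K a ≤ landscape b K (spinLaw b (2 * b * K * m)) := by
        have := (hzero a ha h0).1
        have h4 := hm 0
        rw [freeEnergy_zero] at h4
        linarith
      refine ⟨a, ⟨ha, hmax⟩, spinLaw b (2 * b * K * m), ⟨spinLaw_mem _ _, fun x hx => ?_⟩, ?_⟩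
      · exact (hmax hx).trans h3
      · intro he
        rw [he, spinLaw_sub, hstat] at h0
        exact hm0.ne' h0
    · refine ⟨a, ⟨ha, hmax⟩, fun s => a (-s), ⟨swap_mem_stdSimplex ha, fun x hx => ?_⟩, ?_⟩
      · change landscape b K x ≤ landscape b K fun s => a (-s)
        rw [landscape_swap]
        exact hmax hx
      · intro he
        have h1 : a 1 = a (-1) := congrFun he 1
        exact h0 (sub_eq_zero.2 h1)

end Landscape

end BEG

namespace BEG

/-! ### The ordered phase -/

section Critical

open Real

/-- In the variable t instead of m, the inverse temperature enters only through b(log Z_b(t) - log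
Z_b(0)), so b can be varied at fixed t. -/
theorem ordered_of_sq_le {K b t : ℝ} (hK : 0 < K) (hb : 0 < b) (ht : t ≠ 0)
    (h : t ^ 2 ≤ 4 * K * (b * (logZ b t - logZ b 0))) : Ordered K b := by
  refine ⟨t / (2 * b * K), by positivity, ?_⟩
  rw [freeEnergy_zero]
  unfold freeEnergy
  have h1 : 2 * b * K * (t / (2 * b * K)) = t := by field_simp
  have h2 : b * K * (t / (2 * b * K)) ^ 2 = t ^ 2 / (4 * K * b) := by field_simp; ring
  rw [h1, h2]
  have h3 : t ^ 2 / (4 * K * b) ≤ logZ b t - logZ b 0 := by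
    rw [div_le_iff₀ (by positivity)]; linarith
  linarith

theorem sq_le_of_freeEnergy_le {K b m : ℝ} (hK : 0 < K) (hb : 0 < b)
    (h : freeEnergy K b 0 ≤ freeEnergy K b m) :
    (2 * b * K * m) ^ 2 ≤ 4 * K * (b * (logZ b (2 * b * K * m) - logZ b 0)) := by
  rw [freeEnergy_zero] at h
  unfold freeEnergy at h
  have h1 : b * K * m ^ 2 ≤ logZ b (2 * b * K * m) - logZ b 0 := by linarith
  have := mul_le_mul_of_nonneg_left h1 (by positivity : 0 ≤ 4 * K * b)
  linarith

/-- At a nonzero maximizer of the free energy, `log (logZ b t - logZ b 0)` grows at most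
quadratically in the field. -/
theorem mul_sinh_le_of_stationary {K b m : ℝ}
    (h0 : freeEnergy K b 0 ≤ freeEnergy K b m) (hstat : meanSpin b (2 * b * K * m) = m) :
    2 / (exp b + 2) * (2 * b * K * m * sinh (2 * b * K * m)) ≤
      2 * ((1 + 2 / (exp b + 2) * (cosh (2 * b * K * m) - 1)) *
        log (1 + 2 / (exp b + 2) * (cosh (2 * b * K * m) - 1))) := by
  rw [freeEnergy_zero] at h0
  unfold freeEnergy at h0
  rw [meanSpin_eq] at hstat
  rw [← logZ_sub]
  set t := 2 * b * K * m with ht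
  have hx : 0 ≤ cosh t - 1 := by linarith [one_le_cosh t]
  have hpos : 0 < 1 + 2 / (exp b + 2) * (cosh t - 1) := by
    have := exp_pos b
    positivity
  rw [div_eq_iff hpos.ne'] at hstat
  have h1 : t * m ≤ 2 * (logZ b t - logZ b 0) := by
    have : t * m = 2 * (b * K * m ^ 2) := by rw [ht]; ring
    linarith
  calc 2 / (exp b + 2) * (t * sinh t) = t * (2 / (exp b + 2) * sinh t) := by ring
    _ = (1 + 2 / (exp b + 2) * (cosh t - 1)) * (t * m) := by rw [hstat]; ring
    _ ≤ (1 + 2 / (exp b + 2) * (cosh t - 1)) * (2 * (logZ b t - logZ b 0)) := by gcongr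
    _ = _ := by ring

/-- At fixed field, `b (logZ b t - logZ b 0)` is increasing in `b` at a nonzero maximizer. -/
theorem exists_pos_hasDerivAt {K b m : ℝ} (hK : 0 < K) (hb : 0 < b) (hm : 0 < m)
    (h0 : freeEnergy K b 0 ≤ freeEnergy K b m) (hstat : meanSpin b (2 * b * K * m) = m) :
    ∃ D : ℝ, 0 < D ∧
      HasDerivAt (fun x => x * (logZ x (2 * b * K * m) - logZ x 0)) D b := by
  have hcr := mul_sinh_le_of_stationary h0 hstat
  obtain ⟨s, hs⟩ : ∃ s, 2 * b * K * m = 2 * s := ⟨b * K * m, by ring⟩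
  have hs0 : 0 < s := by
    have : 0 < 2 * b * K * m := by positivity
    linarith
  rw [hs] at hcr ⊢
  have hE := exp_pos b
  have hS : 0 < sinh s := sinh_pos_iff.2 hs0
  have hC : cosh (2 * s) - 1 = 2 * sinh s ^ 2 := by
    rw [cosh_sub_one]; ring_nf
  set y := 4 * sinh s ^ 2 / (exp b + 2) with hy
  have hy0 : 0 < y := by positivity
  have hqy : 2 / (exp b + 2) * (cosh (2 * s) - 1) = y := by rw [hC, hy]; ring
  rw [hqy, sinh_two_mul] at hcr
  have hcr' : s * cosh s * y ≤ (1 + y) * log (1 + y) * sinh s := by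
    have h1 : s * cosh s * y = 2 / (exp b + 2) * (2 * s * (2 * sinh s * cosh s)) / 2 * sinh s := by
      rw [hy]; ring
    rw [h1]
    gcongr
    linarith
  -- Maximality says that log(1 + q(cosh t - 1))/t² is not strictly increasing at t = 2s, so the
  -- hypothesis of `mul_log_lt_of_le` must fail.
  have hlt : b * exp b * sinh s < s * cosh s * (exp b + 2) := by
    by_contra! h
    exact absurd (mul_log_lt_of_le hs0 h) (not_lt.2 hcr')
  have hfun : (fun x => x * (logZ x (2 * s) - logZ x 0)) =
      fun x => x * log (1 + 4 * sinh s ^ 2 / (exp x + 2)) := by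
    ext x
    rw [logZ_sub, hC]
    ring_nf
  refine ⟨1 * log (1 + y) + b * ((-(4 * sinh s ^ 2 * exp b) / (exp b + 2) ^ 2) / (1 + y)), ?_, ?_⟩
  · have h1 : b * ((-(4 * sinh s ^ 2 * exp b) / (exp b + 2) ^ 2) / (1 + y)) =
        -(b * exp b * y / (exp b + 2) / (1 + y)) := by
      rw [hy]; field_simp
    rw [h1, one_mul, ← sub_eq_add_neg, sub_pos, div_lt_iff₀ (by positivity),
      div_lt_iff₀ (by positivity)]
    have h2 : b * exp b * sinh s * y < s * cosh s * (exp b + 2) * y := by gcongr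
    have h3 : s * cosh s * y * (exp b + 2) ≤ (1 + y) * log (1 + y) * sinh s * (exp b + 2) := by
      gcongr
    have h4 : b * exp b * y * sinh s < log (1 + y) * (1 + y) * (exp b + 2) * sinh s := by linarith
    exact lt_of_mul_lt_mul_right h4 hS.le
  · rw [hfun]
    have h1 : HasDerivAt (fun x => exp x + 2) (exp b) b := (hasDerivAt_exp b).add_const 2
    have h2 : HasDerivAt (fun x => 1 + 4 * sinh s ^ 2 / (exp x + 2))
        (-(4 * sinh s ^ 2 * exp b) / (exp b + 2) ^ 2) b := by
      refine (((hasDerivAt_const b (4 * sinh s ^ 2)).fun_div h1 (by positivity)).const_add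
        1).congr_deriv ?_
      ring
    exact (hasDerivAt_id' b).fun_mul (h2.log (by positivity))

/-- The first-order nature of the transition: above log 4 one has q = 2/(e^b + 2) < 1/3, and the
strict increase for small t given by `exists_forall_log_lt` is incompatible with stationarity. -/
theorem exists_field_bound {b₀ : ℝ} (hb₀ : log 4 < b₀) :
    ∃ t₀ : ℝ, 0 < t₀ ∧ ∀ K b m : ℝ, 0 < K → b₀ ≤ b → 0 < m →
      freeEnergy K b 0 ≤ freeEnergy K b m → meanSpin b (2 * b * K * m) = m →
        t₀ < 2 * b * K * m := by
  have hlog4 : 0 < log 4 := log_pos (by norm_num)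
  have h4 : 4 < exp b₀ := (log_lt_iff_lt_exp (by norm_num)).1 hb₀
  obtain ⟨t₀, ht₀, h⟩ := exists_forall_log_lt (q₁ := 2 / (exp b₀ + 2)) (by
    rw [div_lt_div_iff₀ (by positivity) (by norm_num)]; linarith)
  refine ⟨t₀, ht₀, fun K b m hK hb hm h0 hstat => ?_⟩
  by_contra! hle
  have hb' : 0 < b := by linarith
  refine absurd (h (2 / (exp b + 2)) (2 * b * K * m) (by positivity) ?_ (by positivity) hle)
    (not_lt.2 (mul_sinh_le_of_stationary h0 hstat))
  gcongr

/-- The ordered phase persists as the temperature is lowered. -/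
theorem Ordered.mono {K b₁ b₂ : ℝ} (hK : 0 < K) (hb₁ : log 4 < b₁) (hle : b₁ ≤ b₂)
    (h : Ordered K b₁) : Ordered K b₂ := by
  have hlog4 : 0 < log 4 := log_pos (by norm_num)
  have hb₁0 : 0 < b₁ := hlog4.trans hb₁
  have hb₂0 : 0 < b₂ := hb₁0.trans_le hle
  obtain ⟨t₀, ht₀, hfield⟩ := exists_field_bound hb₁
  set δ := t₀ / (2 * b₂ * K) with hδ
  have hδ0 : 0 < δ := by positivity
  -- Keeping m ≥ δ makes S compact without losing any ordered b in [b₁, b₂], so there is a largest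
  -- one.
  set S : Set (ℝ × ℝ) := (Set.Icc b₁ b₂ ×ˢ Set.Icc δ 1) ∩
    {x | freeEnergy K x.1 0 ≤ freeEnergy K x.1 x.2} with hS
  have hcomp : IsCompact S := by
    refine (isCompact_Icc.prod isCompact_Icc).inter_right (isClosed_le ?_ (continuous_freeEnergy K))
    exact (continuous_freeEnergy K).comp (by fun_prop : Continuous fun x : ℝ × ℝ => (x.1, (0 : ℝ)))
  have hmem : ∀ b, b₁ ≤ b → b ≤ b₂ → Ordered K b → b ∈ Prod.fst '' S := by
    intro b h1 h2 hord
    have hb0 : 0 < b := hb₁0.trans_le h1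
    obtain ⟨m, hm0, hm1, hmax, hstat⟩ := exists_pos_max_of_ordered hK hb0 hord
    refine ⟨(b, m), ⟨⟨⟨h1, h2⟩, ?_, hm1⟩, hmax 0⟩, rfl⟩
    have h3 := hfield K b m hK h1 hm0 (hmax 0) hstat
    change δ ≤ m
    rw [hδ, div_le_iff₀ (by positivity)]
    have : 2 * b * K * m ≤ 2 * b₂ * K * m := by gcongr
    linarith
  obtain ⟨b, ⟨hbS, hbmax⟩⟩ := (hcomp.image continuous_fst).exists_isGreatest
    ⟨b₁, hmem b₁ le_rfl hle h⟩
  obtain ⟨⟨b', m₀⟩, ⟨⟨hbI, hmI⟩, hfe⟩, hbb⟩ := hbS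
  simp only at hbb
  subst hbb
  have hb0 : 0 < b' := hb₁0.trans_le hbI.1
  have hord : Ordered K b' := ⟨m₀, (hδ0.trans_le hmI.1).ne', hfe⟩
  rcases hbI.2.eq_or_lt with heq | hlt
  · exact heq ▸ hord
  exfalso
  -- If the largest ordered b' were below b₂, the positive derivative at fixed field t would make
  -- some x slightly above b' ordered with the same t.
  obtain ⟨m, hm0, hm1, hmax, hstat⟩ := exists_pos_max_of_ordered hK hb0 hord
  obtain ⟨D, hD, hder⟩ := exists_pos_hasDerivAt hK hb0 hm0 (hmax 0) hstat
  have hsq := sq_le_of_freeEnergy_le hK hb0 (hmax 0)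
  set t := 2 * b' * K * m with ht
  have ht0 : t ≠ 0 := by positivity
  have hslope := (hasDerivAt_iff_tendsto_slope.1 hder).eventually (lt_mem_nhds hD)
  have hslope' := hslope.filter_mono (nhdsWithin_mono b' (s := Set.Ioi b') (t := {b'}ᶜ)
    fun x hx => (Set.mem_Ioi.1 hx).ne')
  obtain ⟨x, hx1, hx2⟩ := (hslope'.and (Ioo_mem_nhdsGT hlt)).exists
  rw [slope_def_field, div_pos_iff_of_pos_right (by linarith [hx2.1])] at hx1
  have hx0 : 0 < x := hb0.trans hx2.1
  have hordx : Ordered K x := by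
    refine ordered_of_sq_le hK hx0 ht0 (hsq.trans ?_)
    have := sub_pos.1 hx1
    gcongr
  have := hbmax (hmem x (hbI.1.trans hx2.1.le) hx2.2.le hordx)
  linarith [hx2.1]

/-! ### Disorder at high temperature and the critical values -/

theorem three_mul_sinh_le {t : ℝ} (ht : 0 ≤ t) : 3 * sinh t ≤ t * (2 + cosh t) := by
  suffices 0 ≤ t * (2 + cosh t) - 3 * sinh t by linarith
  refine nonneg_of_hasDerivAt_nonneg (f := fun t => t * (2 + cosh t) - 3 * sinh t)
    (f' := fun t => t * sinh t - 2 * (cosh t - 1)) ?_ ?_ (by simp) ht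
  · intro x _
    refine (((hasDerivAt_id' x).fun_mul ((hasDerivAt_cosh x).const_add 2)).fun_sub
      ((hasDerivAt_sinh x).const_mul 3)).congr_deriv ?_
    ring
  · intro x hx
    have h1 := sinh_two_mul (x / 2)
    rw [show 2 * (x / 2) = x by ring] at h1
    have h2 := sinh_le_mul_cosh (s := x / 2) (by linarith)
    have h3 : 0 ≤ sinh (x / 2) := sinh_nonneg_iff.2 (by linarith)
    rw [cosh_sub_one, h1]
    nlinarith

/-- For q ≥ 1/3 the second-order Taylor term at 0 is a global upper bound; the derivatives compare
by sinh t ≤ t(1 + (cosh t - 1)/3). -/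
theorem log_le_half_mul_sq {q t : ℝ} (hq : 1 / 3 ≤ q) :
    log (1 + q * (cosh t - 1)) ≤ q * t ^ 2 / 2 := by
  wlog ht : 0 ≤ t generalizing t
  · have := this (t := -t) (by linarith)
    simpa using this
  suffices 0 ≤ q * t ^ 2 / 2 - log (1 + q * (cosh t - 1)) by linarith
  have hq0 : 0 < q := by linarith
  have hpos : ∀ x : ℝ, 0 < 1 + q * (cosh x - 1) := fun x => by
    have : 0 ≤ cosh x - 1 := by linarith [one_le_cosh x]
    positivity
  refine nonneg_of_hasDerivAt_nonneg
    (f := fun t => q * t ^ 2 / 2 - log (1 + q * (cosh t - 1)))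
    (f' := fun t => q * t - q * sinh t / (1 + q * (cosh t - 1))) ?_ ?_ (by simp) ht
  · intro x _
    have h1 : HasDerivAt (fun x => 1 + q * (cosh x - 1)) (q * sinh x) x :=
      (((hasDerivAt_cosh x).sub_const 1).const_mul q).const_add 1
    refine ((((hasDerivAt_pow 2 x).const_mul q).div_const 2).fun_sub
      (h1.log (hpos x).ne')).congr_deriv ?_
    simp; ring
  · intro x hx
    rw [sub_nonneg, div_le_iff₀ (hpos x)]
    have h1 := three_mul_sinh_le hx
    have h2 : 0 ≤ x * (cosh x - 1) := mul_nonneg hx (by linarith [one_le_cosh x])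
    have h3 : sinh x ≤ x * (1 + q * (cosh x - 1)) := by nlinarith
    calc q * sinh x ≤ q * (x * (1 + q * (cosh x - 1))) := by gcongr
      _ = _ := by ring

theorem Kc_eq : Kc = 3 / (2 * log 4) := by
  unfold Kc secondOrderK
  rw [exp_neg, exp_log (by norm_num)]
  have : log 4 ≠ 0 := (log_pos (by norm_num)).ne'
  field_simp
  norm_num

theorem log_four_lt : log 4 < 3 / 2 := by
  rw [log_lt_iff_lt_exp (by norm_num)]
  linarith [exp_three_halves_gt]

/-- The model is disordered at high temperature. -/
theorem not_ordered_of_lt {K b : ℝ} (hK : 0 < K) (hKc : K < Kc) (hb : 0 < b)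
    (hbK : b < 3 / (2 * K)) : ¬Ordered K b := by
  rintro ⟨m, hm, h⟩
  have hsq := sq_le_of_freeEnergy_le hK hb h
  set t := 2 * b * K * m with ht
  have ht0 : 0 < t ^ 2 := by positivity
  rw [logZ_sub] at hsq
  have hx : 0 ≤ cosh t - 1 := by linarith [one_le_cosh t]
  have hE := exp_pos b
  rw [Kc_eq] at hKc
  have hl4 : 0 < log 4 := log_pos (by norm_num)
  -- q = 2/(e^b + 2) crosses 1/3 at b = log 4. Above, q is replaced by 1/3 and bK < 3/2 suffices;
  -- below, one needs 4Kb < e^b + 2.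
  rcases le_total (log 4) b with hlb | hlb
  · have h4 : 4 ≤ exp b := (log_le_iff_le_exp (by norm_num)).1 hlb
    have h1 : log (1 + 2 / (exp b + 2) * (cosh t - 1)) ≤ log (1 + 1 / 3 * (cosh t - 1)) := by
      have : 2 / (exp b + 2) ≤ 1 / 3 := by
        rw [div_le_div_iff₀ (by positivity) (by norm_num)]; linarith
      gcongr
    have h2 := log_le_half_mul_sq (q := 1 / 3) (t := t) le_rfl
    have h3 : b * K < 3 / 2 := by
      rw [lt_div_iff₀ (by positivity)] at hbK; linarith
    have h4 : 4 * K * (b * log (1 + 2 / (exp b + 2) * (cosh t - 1))) ≤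
        4 * K * (b * (1 / 3 * t ^ 2 / 2)) := by
      gcongr; exact h1.trans h2
    nlinarith
  · have h4 : exp b ≤ 4 := by
      rw [← exp_log (show (0 : ℝ) < 4 by norm_num)]; exact exp_le_exp.2 hlb
    have h2 := log_le_half_mul_sq (q := 2 / (exp b + 2)) (t := t) (by
      rw [div_le_div_iff₀ (by norm_num) (by positivity)]; linarith)
    have h3 : 4 * K * (b * log (1 + 2 / (exp b + 2) * (cosh t - 1))) ≤
        4 * K * (b * (2 / (exp b + 2) * t ^ 2 / 2)) := by gcongr
    have h5 : 4 * K * (b * (2 / (exp b + 2) * t ^ 2 / 2)) = 4 * K * b / (exp b + 2) * t ^ 2 := by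
      ring
    -- Tangent of the exponential at log 4. With K < 3/(2 log 4) the claim becomes (6 - 4 log 4)(b -
    -- log 4) ≤ 0, which uses log 4 < 3/2.
    have h6 : 4 * K * b < exp b + 2 := by
      have h7 : 4 * (b - log 4 + 1) ≤ exp b := by
        have := add_one_le_exp (b - log 4)
        rw [exp_sub, exp_log (by norm_num)] at this
        linarith
      have h8 : K * (2 * log 4) < 3 := (lt_div_iff₀ (by positivity)).1 hKc
      have h9 := log_four_lt
      have h10 : 4 * K * b * log 4 < 6 * b := by nlinarith
      have h11 : 6 * b ≤ (exp b + 2) * log 4 := by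
        have : (4 * (b - log 4 + 1) + 2) * log 4 ≤ (exp b + 2) * log 4 := by gcongr
        nlinarith
      exact lt_of_mul_lt_mul_right (h10.trans_le h11) hl4.le
    have h12 : 4 * K * b / (exp b + 2) < 1 := (div_lt_one (by positivity)).2 h6
    nlinarith

theorem logZ_zero_le {b : ℝ} (hb : 0 ≤ b) : logZ b 0 ≤ log 3 := by
  unfold logZ
  have : exp (-b) ≤ 1 := by rw [exp_le_one_iff]; linarith
  have := exp_pos (-b)
  rw [cosh_zero]
  gcongr
  linarith

theorem le_freeEnergy_one (K b : ℝ) : b * (K - 1) ≤ freeEnergy K b 1 := by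
  unfold freeEnergy logZ
  have h1 : -b + 2 * b * K ≤ log (1 + 2 * exp (-b) * cosh (2 * b * K * 1)) := by
    rw [le_log_iff_exp_le (one_add_pos _ _), exp_add, cosh_eq, mul_one]
    have := exp_pos (-b)
    have := exp_pos (-(2 * b * K))
    nlinarith [mul_pos (exp_pos (-b)) (exp_pos (-(2 * b * K)))]
  linarith

theorem ordered_of_le {K b : ℝ} (hb : 0 ≤ b) (h : log 3 ≤ b * (K - 1)) : Ordered K b := by
  refine ⟨1, one_ne_zero, ?_⟩
  rw [freeEnergy_zero]
  exact (logZ_zero_le hb).trans (h.trans (le_freeEnergy_one K b))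

/-- Properties of the critical inverse temperature. -/
theorem criticalBeta_properties {K : ℝ} (hK : 1 < K) (hKc : K < Kc) :
    log 4 < criticalBeta K ∧ (∀ b, criticalBeta K < b → Ordered K b) ∧
      ∀ b, 0 < b → b < criticalBeta K → ¬Ordered K b := by
  have hK0 : 0 < K := by linarith
  have hl3 : 0 < log 3 := log_pos (by norm_num)
  have hl4 : 0 < log 4 := log_pos (by norm_num)
  set S := {β : ℝ | 0 < β ∧ Multimodal β K} with hS
  have hne : S.Nonempty := by
    have hb : 0 < log 3 / (K - 1) := div_pos hl3 (by linarith)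
    refine ⟨log 3 / (K - 1), hb, (multimodal_iff_ordered hK0 hb).2 (ordered_of_le hb.le ?_)⟩
    rw [div_mul_cancel₀ _ (by linarith)]
  have hbdd : BddBelow S := ⟨0, fun x hx => hx.1.le⟩
  have hgt : log 4 < criticalBeta K := by
    have h1 : 3 / (2 * K) ≤ criticalBeta K := by
      refine le_csInf hne fun b hb => ?_
      by_contra! hlt
      exact not_ordered_of_lt hK0 hKc hb.1 hlt ((multimodal_iff_ordered hK0 hb.1).1 hb.2)
    refine lt_of_lt_of_le ?_ h1
    rw [Kc_eq, lt_div_iff₀ (by positivity)] at hKc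
    rw [lt_div_iff₀ (by positivity)]
    linarith
  refine ⟨hgt, fun b hb => ?_, fun b hb0 hb hord => ?_⟩
  · obtain ⟨b₁, hb₁, hlt⟩ := exists_lt_of_csInf_lt hne hb
    exact Ordered.mono hK0 (hgt.trans_le (csInf_le hbdd hb₁)) hlt.le
      ((multimodal_iff_ordered hK0 hb₁.1).1 hb₁.2)
  · exact absurd (csInf_le hbdd ⟨hb0, (multimodal_iff_ordered hK0 hb0).2 hord⟩) (not_le.2 hb)

/-- The lower bound for K_low. For t ≤ b, log Z grows by at most log 2, which forces t ≤ b/2, where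
the growth is exponentially small. For t ≥ b it grows by at most t - b + log 2, too little when K ≤
1 - ε. -/
theorem not_ordered_of_le_one_sub {ε b K : ℝ} (hε : 0 < ε) (hb16 : 16 ≤ b) (hbε : 1 ≤ b * ε)
    (hK0 : 0 < K) (hK : K ≤ 1 - ε) : ¬Ordered K b := by
  intro hord
  have hb : 0 < b := by linarith
  obtain ⟨m, hm0, -, hmax, -⟩ := exists_pos_max_of_ordered hK0 hb hord
  have hsq := sq_le_of_freeEnergy_le hK0 hb (hmax 0)
  set t := 2 * b * K * m with ht
  have ht0 : 0 < t := by positivity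
  have hE := exp_pos b
  have hx : 0 ≤ cosh t - 1 := by linarith [one_le_cosh t]
  have hlog2 : log 2 < 1 := by linarith [log_two_lt_d9]
  have hL0 : 0 ≤ logZ b t - logZ b 0 := by
    rw [logZ_sub]
    exact log_nonneg (by linarith [mul_nonneg (by positivity : 0 ≤ 2 / (exp b + 2)) hx])
  have hL : logZ b t - logZ b 0 ≤ log (1 + exp (t - b)) := by
    rw [logZ_sub]
    refine log_le_log (by positivity) ?_
    have h1 : exp (t - b) = exp t / exp b := exp_sub t b
    have h2 : 2 / (exp b + 2) * (cosh t - 1) ≤ exp t / exp b := by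
      rw [div_mul_eq_mul_div, div_le_div_iff₀ (by positivity) hE, cosh_eq]
      have h3 : exp (-t) ≤ 1 := by rw [exp_le_one_iff]; linarith
      have := exp_pos t
      nlinarith
    linarith
  rcases le_total t b with htb | htb
  · have hL2 : logZ b t - logZ b 0 ≤ 1 := by
      have h1 : log (1 + exp (t - b)) ≤ log 2 := by
        have : exp (t - b) ≤ 1 := by rw [exp_le_one_iff]; linarith
        have := exp_pos (t - b)
        gcongr
        linarith
      linarith
    have ht2 : t ^ 2 ≤ 4 * b := by
      have : 4 * K * (b * (logZ b t - logZ b 0)) ≤ 4 * 1 * (b * 1) := by gcongr; linarith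
      linarith
    have htb2 : t ≤ b / 2 := by
      by_contra! h
      have : (b / 2) ^ 2 < t ^ 2 := by gcongr
      nlinarith
    have hL3 : logZ b t - logZ b 0 ≤ t ^ 2 * exp (t - b) := by
      rw [logZ_sub]
      have h1 : log (1 + 2 / (exp b + 2) * (cosh t - 1)) ≤ 2 / (exp b + 2) * (cosh t - 1) := by
        have := log_le_sub_one_of_pos (x := 1 + 2 / (exp b + 2) * (cosh t - 1)) (by positivity)
        linarith
      have h2 : cosh t - 1 ≤ t ^ 2 / 2 * exp t := by
        rw [cosh_sub_one]
        have h3 := sinh_le_mul_cosh (s := t / 2) (by linarith)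
        have h4 : 0 ≤ sinh (t / 2) := sinh_nonneg_iff.2 (by linarith)
        have h5 : cosh (t / 2) ≤ exp (t / 2) := by
          rw [cosh_eq]
          have : exp (-(t / 2)) ≤ exp (t / 2) := exp_le_exp.2 (by linarith)
          linarith
        have h6 : exp t = exp (t / 2) ^ 2 := by rw [← exp_nat_mul]; ring_nf
        have h7 : sinh (t / 2) ≤ t / 2 * exp (t / 2) := h3.trans (by gcongr)
        rw [h6]
        calc 2 * sinh (t / 2) ^ 2 ≤ 2 * (t / 2 * exp (t / 2)) ^ 2 := by gcongr
          _ = _ := by ring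
      have h8 : 2 / (exp b + 2) ≤ 2 / exp b := by gcongr; linarith
      calc _ ≤ 2 / (exp b + 2) * (cosh t - 1) := h1
        _ ≤ 2 / exp b * (t ^ 2 / 2 * exp t) := by gcongr
        _ = t ^ 2 * exp (t - b) := by rw [exp_sub]; ring
    have h1 : t ^ 2 * 1 ≤ t ^ 2 * (4 * b * exp (t - b)) := by
      have : 4 * K * (b * (logZ b t - logZ b 0)) ≤ 4 * 1 * (b * (t ^ 2 * exp (t - b))) := by
        gcongr; linarith
      linarith
    have h2 : 1 ≤ 4 * b * exp (t - b) := le_of_mul_le_mul_left h1 (by positivity)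
    have h3 : exp (t - b) ≤ exp (-(b / 2)) := exp_le_exp.2 (by linarith)
    have h4 : 4 * b < exp (b / 2) := by
      have h5 := sum_le_exp_of_nonneg (x := b / 2) (by linarith) 4
      simp [Finset.sum_range_succ, Nat.factorial] at h5
      nlinarith [mul_nonneg hb.le hb.le, mul_nonneg (mul_nonneg hb.le hb.le) (sub_nonneg.2 hb16)]
    have h5 : exp (b / 2) * exp (-(b / 2)) = 1 := by rw [← exp_add]; simp
    have h6 : 4 * b * exp (t - b) ≤ 4 * b * exp (-(b / 2)) := by gcongr
    have h7 : 4 * b * exp (-(b / 2)) < exp (b / 2) * exp (-(b / 2)) := by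
      have := exp_pos (-(b / 2)); gcongr
    linarith
  · have hL2 : logZ b t - logZ b 0 ≤ t - b + log 2 := by
      refine hL.trans ?_
      have h1 : 1 + exp (t - b) ≤ exp (t - b) * 2 := by
        have : 1 ≤ exp (t - b) := by rw [one_le_exp_iff]; linarith
        linarith
      have := log_le_log (by positivity) h1
      rwa [log_mul (exp_pos _).ne' (by norm_num), log_exp] at this
    have hε1 : 0 < 1 - ε := by linarith
    have h1 : t ^ 2 ≤ 4 * (1 - ε) * (b * (t - b + log 2)) := by
      refine hsq.trans ?_
      have h2 : 0 ≤ t - b + log 2 := by linarith [log_pos (show (1 : ℝ) < 2 by norm_num)]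
      gcongr
    -- Completing the square in t at 2(1 - ε)b; the outcome bε ≤ log 2 < 1 contradicts `hbε`.
    have h2 : 4 * (1 - ε) * b * (b * ε) ≤ 4 * (1 - ε) * b * log 2 := by
      nlinarith [sq_nonneg (t - 2 * (1 - ε) * b)]
    have h3 : b * ε ≤ log 2 := le_of_mul_le_mul_left h2 (by positivity)
    linarith

theorem tendsto_criticalK : Filter.Tendsto criticalK Filter.atTop (nhds 1) := by
  have hl3 : 0 < log 3 := log_pos (by norm_num)
  rw [Metric.tendsto_atTop]
  intro ε hε
  set ε' := min (ε / 2) (1 / 2) with hε'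
  have hε'0 : 0 < ε' := by positivity
  have hε'1 : ε' ≤ 1 / 2 := min_le_right _ _
  have hε'2 : ε' ≤ ε / 2 := min_le_left _ _
  refine ⟨max 16 (max (1 / ε') (log 3 / ε')), fun b hb => ?_⟩
  have hb16 : 16 ≤ b := (le_max_left _ _).trans hb
  have hb1 : 1 / ε' ≤ b := ((le_max_left _ _).trans (le_max_right _ _)).trans hb
  have hb3 : log 3 / ε' ≤ b := ((le_max_right _ _).trans (le_max_right _ _)).trans hb
  rw [div_le_iff₀ hε'0] at hb1 hb3
  have hb0 : 0 < b := by linarith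
  have hmem : 1 + ε' ∈ {K : ℝ | 0 < K ∧ Multimodal b K} := by
    refine ⟨by linarith, (multimodal_iff_ordered (by linarith) hb0).2 (ordered_of_le hb0.le ?_)⟩
    linarith
  have hup : criticalK b ≤ 1 + ε' := csInf_le ⟨0, fun x hx => hx.1.le⟩ hmem
  have hlow : 1 - ε' ≤ criticalK b := by
    refine le_csInf ⟨_, hmem⟩ fun K hK => ?_
    by_contra! hlt
    exact not_ordered_of_le_one_sub hε'0 hb16 hb1 hK.1 hlt.le
      ((multimodal_iff_ordered hK.1 hb0).1 hK.2)
  rw [Real.dist_eq, abs_lt]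
  constructor <;> linarith

theorem Klow_eq : Klow = 1 := tendsto_criticalK.limUnder_eq

end Critical

end BEG

namespace BEG

/-! ### A magnetization shell avoided at all temperatures -/

section Shell

open Real

/-- The index i may vary with x, so no single continuous function can be minimized; a lower bound
holds locally and passes to finite unions. -/
theorem exists_pos_le_of_isCompact {X ι : Type*} [TopologicalSpace X] {S : Set X}
    (hS : IsCompact S) {F : ι → X → ℝ} (hF : ∀ i, Continuous (F i))
    (h : ∀ x ∈ S, ∃ i, 0 < F i x) : ∃ c : ℝ, 0 < c ∧ ∀ x ∈ S, ∃ i, c ≤ F i x := by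
  refine hS.induction_on (p := fun S => ∃ c : ℝ, 0 < c ∧ ∀ x ∈ S, ∃ i, c ≤ F i x)
    ⟨1, one_pos, by simp⟩ ?_ ?_ ?_
  · rintro S T hST ⟨c, hc, h⟩
    exact ⟨c, hc, fun x hx => h x (hST hx)⟩
  · rintro S T ⟨c₁, hc₁, h₁⟩ ⟨c₂, hc₂, h₂⟩
    refine ⟨min c₁ c₂, lt_min hc₁ hc₂, fun x hx => ?_⟩
    rcases hx with hx | hx
    · obtain ⟨i, h⟩ := h₁ x hx
      exact ⟨i, (min_le_left _ _).trans h⟩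
    · obtain ⟨i, h⟩ := h₂ x hx
      exact ⟨i, (min_le_right _ _).trans h⟩
  · intro x hx
    obtain ⟨i, hi⟩ := h x hx
    have hev := (hF i).continuousAt.eventually (lt_mem_nhds (half_lt_self hi))
    exact ⟨_, mem_nhdsWithin_of_mem_nhds hev, F i x / 2, half_pos hi,
      fun y hy => ⟨i, le_of_lt hy⟩⟩

/-- Below the critical value m = 0 beats every other m strictly; from it on, no m in (0, 2δ] is a
maximizer. The deficit is uniform by compactness for b ≤ B, and by comparison with m = 1 for b ≥ B.
-/
theorem exists_shell {K : ℝ} (hK : 1 < K) (hKc : K < Kc) :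
    ∃ δ c : ℝ, 0 < δ ∧ 0 < c ∧
      (∀ b m : ℝ, 0 ≤ b → δ ≤ |m| → |m| ≤ 2 * δ →
        ∃ t m', b * K * m ^ 2 - t * m + logZ b t + c ≤ freeEnergy K b m') ∧
      (∀ b, criticalBeta K < b → ∃ m, 2 * δ ≤ m ∧
        (∀ m', freeEnergy K b m' ≤ freeEnergy K b m) ∧ meanSpin b (2 * b * K * m) = m) ∧
      ∀ b, 0 ≤ b → b < criticalBeta K → ∀ m', freeEnergy K b m' ≤ freeEnergy K b 0 := by
  obtain ⟨hβ4, hord, hdis⟩ := criticalBeta_properties hK hKc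
  have hK0 : 0 < K := by linarith
  have hl3 : 0 < log 3 := log_pos (by norm_num)
  have hβ0 : 0 < criticalBeta K := (log_pos (by norm_num)).trans hβ4
  obtain ⟨t₀, ht₀, hfield⟩ := exists_field_bound hβ4
  -- From B on, F(1) ≥ b(K - 1) ≥ log 3 + 1.
  set B := (log 3 + 1) / (K - 1) with hB
  have hB0 : 0 < B := div_pos (by linarith) (by linarith)
  -- The first bound keeps the field of any m ≤ 2δ at most t₀ for b ≤ B; the second keeps it at most
  -- b, so that F(m) ≤ log 3.
  set δ := min (t₀ / (4 * B * K)) (1 / (4 * K)) with hδ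
  have hδ0 : 0 < δ := by positivity
  have hδ1 : 4 * B * K * δ ≤ t₀ := by
    have : δ ≤ t₀ / (4 * B * K) := min_le_left _ _
    rw [le_div_iff₀ (by positivity)] at this
    linarith
  have hδ2 : 4 * K * δ ≤ 1 := by
    have : δ ≤ 1 / (4 * K) := min_le_right _ _
    rw [le_div_iff₀ (by positivity)] at this
    linarith
  have hlarge : ∀ b m : ℝ, B ≤ b → 0 ≤ m → m ≤ 2 * δ →
      freeEnergy K b m + 1 ≤ freeEnergy K b 1 := by
    intro b m hb hm0 hm
    have hb0 : 0 < b := hB0.trans_le hb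
    have h1 := le_freeEnergy_one K b
    have h2 : log 3 + 1 ≤ b * (K - 1) := by
      rw [hB, div_le_iff₀ (by linarith)] at hb; exact hb
    have h3 : freeEnergy K b m ≤ log 3 := by
      unfold freeEnergy
      have h4 : logZ b (2 * b * K * m) ≤ log 3 := by
        unfold logZ
        refine log_le_log (one_add_pos _ _) ?_
        have h5 : 2 * b * K * m ≤ b := by
          have : 2 * K * m ≤ 1 := by nlinarith
          nlinarith
        have h6 : cosh (2 * b * K * m) ≤ exp b := by
          rw [cosh_eq]
          have h7 : exp (2 * b * K * m) ≤ exp b := exp_le_exp.2 h5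
          have h8 : exp (-(2 * b * K * m)) ≤ exp b :=
            exp_le_exp.2 (by have : 0 ≤ 2 * b * K * m := by positivity
                             linarith)
          linarith
        have h9 : exp (-b) * exp b = 1 := by rw [← exp_add]; simp
        have h10 : exp (-b) * cosh (2 * b * K * m) ≤ exp (-b) * exp b := by gcongr
        linarith
      have h5 : 0 ≤ b * K * m ^ 2 := by positivity
      linarith
    linarith
  have hnomax : ∀ b m : ℝ, criticalBeta K ≤ b → 0 < m → m ≤ 2 * δ →
      ¬∀ m', freeEnergy K b m' ≤ freeEnergy K b m := by
    intro b m hb hm0 hm hmax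
    have hb0 : 0 < b := hβ0.trans_le hb
    rcases le_total B b with h | h
    · linarith [hlarge b m h hm0.le hm, hmax 1]
    · have h1 := hfield K b m hK0 hb hm0 (hmax 0) (meanSpin_eq_of_max hK0 hb0 hmax)
      have h2 : 2 * b * K * m ≤ 2 * B * K * (2 * δ) := by gcongr
      linarith
  have hpoint : ∀ b m : ℝ, 0 ≤ b → 0 < m → m ≤ 2 * δ →
      ∃ t m', b * K * m ^ 2 - t * m + logZ b t < freeEnergy K b m' := by
    intro b m hb hm0 hm
    have hself : b * K * m ^ 2 - 2 * b * K * m * m + logZ b (2 * b * K * m) =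
        freeEnergy K b m := by unfold freeEnergy; ring
    -- At b = 0 the free energy is constant in m, and the mean-field choice of t gives no deficit.
    -- The field t = m gains m²/2, because cosh m ≤ exp(m²/2).
    rcases hb.eq_or_lt with rfl | hb
    · refine ⟨m, 0, ?_⟩
      rw [freeEnergy_zero]
      have h1 : logZ 0 m ≤ log 3 + m ^ 2 / 2 := by
        unfold logZ
        have hc := one_le_cosh m
        rw [neg_zero, exp_zero, log_le_iff_le_exp (by positivity), exp_add,
          exp_log (by norm_num)]
        have := cosh_le_exp_half_sq m
        linarith
      have h2 : logZ 0 0 = log 3 := by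
        unfold logZ
        norm_num
      rw [h2]
      nlinarith
    · rcases lt_or_ge b (criticalBeta K) with hlt | hge
      · refine ⟨2 * b * K * m, 0, ?_⟩
        rw [hself]
        by_contra! h
        exact hdis b hb hlt ⟨m, hm0.ne', h⟩
      · have := hnomax b m hge hm0 hm
        push Not at this
        obtain ⟨m', hm'⟩ := this
        exact ⟨2 * b * K * m, m', by rw [hself]; exact hm'⟩
  have hcompact : ∃ c : ℝ, 0 < c ∧ ∀ x ∈ Set.Icc 0 B ×ˢ Set.Icc δ (2 * δ),
      ∃ t m', x.1 * K * x.2 ^ 2 - t * x.2 + logZ x.1 t + c ≤ freeEnergy K x.1 m' := by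
    obtain ⟨c, hc, h⟩ := exists_pos_le_of_isCompact (isCompact_Icc.prod isCompact_Icc)
      (F := fun (i : ℝ × ℝ) (x : ℝ × ℝ) =>
        freeEnergy K x.1 i.2 - (x.1 * K * x.2 ^ 2 - i.1 * x.2 + logZ x.1 i.1))
      (fun i => by
        refine Continuous.sub ?_ (Continuous.add (by fun_prop) ?_)
        · exact (continuous_freeEnergy K).comp
            (by fun_prop : Continuous fun x : ℝ × ℝ => (x.1, i.2))
        · exact Continuous.log (by fun_prop) fun x => (one_add_pos _ _).ne')
      (fun x (hx : x ∈ Set.Icc 0 B ×ˢ Set.Icc δ (2 * δ)) => by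
        obtain ⟨t, m', h⟩ := hpoint x.1 x.2 hx.1.1 (hδ0.trans_le hx.2.1) hx.2.2
        exact ⟨(t, m'), sub_pos.2 h⟩)
    refine ⟨c, hc, fun x hx => ?_⟩
    obtain ⟨i, hi⟩ := h x hx
    exact ⟨i.1, i.2, by linarith⟩
  obtain ⟨c, hc, hc'⟩ := hcompact
  refine ⟨δ, min c 1, hδ0, by positivity, fun b m hb hm1 hm2 => ?_, fun b hb => ?_,
    fun b hb hlt m' => ?_⟩
  · have key : ∃ t m', b * K * |m| ^ 2 - t * |m| + logZ b t + min c 1 ≤ freeEnergy K b m' := by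
      rcases le_total b B with h | h
      · obtain ⟨t, m', h1⟩ := hc' (b, |m|) ⟨⟨hb, h⟩, ⟨hm1, hm2⟩⟩
        simp only at h1
        exact ⟨t, m', by linarith [min_le_left c 1]⟩
      · refine ⟨2 * b * K * |m|, 1, ?_⟩
        have h1 := hlarge b |m| h (abs_nonneg m) hm2
        unfold freeEnergy at h1 ⊢
        linarith [min_le_right c 1]
    obtain ⟨t, m', h⟩ := key
    rcases abs_choice m with h1 | h1
    · rw [h1] at h
      exact ⟨t, m', h⟩
    · rw [h1] at h
      refine ⟨-t, m', ?_⟩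
      have : logZ b (-t) = logZ b t := by simp [logZ]
      rw [this]
      linarith [neg_sq m]
  · obtain ⟨m, hm0, -, hmax, hstat⟩ :=
      exists_pos_max_of_ordered hK0 (hβ0.trans hb) (hord b hb)
    refine ⟨m, ?_, hmax, hstat⟩
    by_contra! h
    exact hnomax b m hb.le hm0 h.le hmax
  · rcases hb.eq_or_lt with rfl | hb
    · simp [freeEnergy]
    · by_cases h0 : m' = 0
      · rw [h0]
      · by_contra! h
        exact hdis b hb hlt ⟨m', h0, h.le⟩

end Shell

/-! ### Averages over the temperatures -/

section Averages

/-- The indices i ≤ Mθ number ⌊Mθ⌋ + 1, at least half of θ(M + 1), with no lower bound on M. -/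
theorem le_average_of_le {M : ℕ} {θ a : ℝ} (hθ0 : 0 ≤ θ) (hθ1 : θ ≤ 1) (ha : 0 ≤ a)
    {g : Fin (M + 1) → ℝ} (hg : ∀ i, 0 ≤ g i)
    (h : ∀ i : Fin (M + 1), ((i : ℕ) : ℝ) ≤ M * θ → a ≤ g i) :
    θ / 2 * a ≤ ∑ i, g i / ((M : ℝ) + 1) := by
  have hlt : ⌊(M : ℝ) * θ⌋₊ < M + 1 := by
    refine Nat.lt_succ_of_le (Nat.floor_le_of_le ?_)
    exact mul_le_of_le_one_right (Nat.cast_nonneg M) hθ1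
  have h1 : ∑ i ∈ Finset.Iic (⟨⌊(M : ℝ) * θ⌋₊, hlt⟩ : Fin (M + 1)), a ≤ ∑ i, g i := by
    refine le_trans (Finset.sum_le_sum fun i hi => h i ?_)
      (Finset.sum_le_sum_of_subset_of_nonneg (Finset.subset_univ _) fun i _ _ => hg i)
    have h2 : (i : ℕ) ≤ ⌊(M : ℝ) * θ⌋₊ := by
      have := Finset.mem_Iic.1 hi
      exact this
    exact (Nat.cast_le.2 h2).trans (Nat.floor_le (by positivity))
  rw [Finset.sum_const, Fin.card_Iic, nsmul_eq_mul] at h1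
  rw [← Finset.sum_div, le_div_iff₀ (by positivity)]
  refine le_trans ?_ h1
  have h3 := (Nat.lt_floor_add_one ((M : ℝ) * θ)).le
  have h4 : (0 : ℝ) ≤ ⌊(M : ℝ) * θ⌋₊ := Nat.cast_nonneg _
  push_cast
  have h5 : θ / 2 * ((M : ℝ) + 1) ≤ (⌊(M : ℝ) * θ⌋₊ : ℝ) + 1 := by linarith
  calc θ / 2 * a * ((M : ℝ) + 1) = θ / 2 * ((M : ℝ) + 1) * a := by ring
    _ ≤ _ := by gcongr

theorem sum_filter_begMeasure (K β : ℝ) (M N : ℕ) (p : Config N → Prop) [DecidablePred p] :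
    ∑ x ∈ Finset.univ.filter (fun x : Config N × Fin (M + 1) => p x.1), begMeasure K β M N x =
      ∑ i : Fin (M + 1), (∑ σ ∈ Finset.univ.filter p,
        gibbs (hamiltonian K N) (temp β M i) σ) / ((M : ℝ) + 1) := by
  rw [Finset.sum_filter, Fintype.sum_prod_type_right]
  refine Finset.sum_congr rfl fun i _ => ?_
  rw [Finset.sum_div, Finset.sum_filter]
  rfl

/-- The cut at total spin `δ N`: both sides have polynomial weight and the flow is exponentially
small. -/
theorem exists_cut {K : ℝ} (hK : 1 < K) (hKc : K < Kc) :
    ∃ c : ℝ, 0 < c ∧ ∀ β : ℝ, criticalBeta K < β → 0 < β ∧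
      ∃ κ : ℝ, 0 < κ ∧ κ ≤ 1 ∧ ∃ N₀ : ℕ, ∀ N : ℕ, N₀ ≤ N → ∀ M : ℕ, 1 ≤ M →
        ∃ A : Finset (Config N × Fin (M + 1)),
          κ / (2 * N + 1) ≤ ∑ x ∈ A, begMeasure K β M N x ∧
          κ / (2 * N + 1) ≤ ∑ x ∈ Aᶜ, begMeasure K β M N x ∧
          cutFlow (begChain K β M N) (begMeasure K β M N) A ≤
            (2 * N + 1) * Real.exp (-c * N) := by
  obtain ⟨δ, c, hδ, hc, hshell, hcold, hhot⟩ := exists_shell hK hKc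
  have hK0 : 0 ≤ K := by linarith
  refine ⟨c, hc, fun β hβ => ?_⟩
  have hβc : 0 < criticalBeta K :=
    (Real.log_pos (by norm_num)).trans (criticalBeta_properties hK hKc).1
  have hβ0 : 0 < β := hβc.trans hβ
  refine ⟨hβ0, ?_⟩
  set r := criticalBeta K / β with hr
  have hr0 : 0 < r := div_pos hβc hβ0
  have hr1 : r < 1 := (div_lt_one hβ0).2 hβ
  have hrβ : r * β = criticalBeta K := by rw [hr]; field_simp
  -- Levels with i/M ≤ r/2 are hot, those with 1 - i/M ≤ (1 - r)/2 are cold; halving keeps the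
  -- inequalities strict. One factor 1/2 in r/8 comes from the average over levels and one from
  -- Chebyshev. N₀ ensures Nδ + 2 ≤ 2Nδ, Nδ² ≥ 2 and N ≥ 1.
  refine ⟨min (r / 8) ((1 - r) / 8), by
    refine lt_min (by positivity) ?_
    linarith, (min_le_left _ _).trans (by linarith), ⌈2 / δ + 2 / δ ^ 2 + 1⌉₊,
    fun N hN M hM => ?_⟩
  have hN' : 2 / δ + 2 / δ ^ 2 + 1 ≤ N := (Nat.le_ceil _).trans (by exact_mod_cast hN)
  have hd1 : 0 < 2 / δ := by positivity
  have hd2 : 0 < 2 / δ ^ 2 := by positivity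
  have hN1 : 1 ≤ N := by
    have : (1 : ℝ) ≤ N := by linarith
    exact_mod_cast this
  have hN0 : (0 : ℝ) < N := by exact_mod_cast hN1
  have hNδ : 2 ≤ N * δ := by
    have : 2 / δ ≤ N := by linarith
    rwa [div_le_iff₀ hδ] at this
  have hNδ2 : 2 ≤ N * δ ^ 2 := by
    have : 2 / δ ^ 2 ≤ N := by linarith
    rwa [div_le_iff₀ (by positivity)] at this
  have hM0 : (0 : ℝ) < M := by exact_mod_cast hM
  have hgibbs : ∀ (b : ℝ) (D : Finset (Config N)), 0 ≤ ∑ σ ∈ D, gibbs (hamiltonian K N) b σ :=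
    fun b D => Finset.sum_nonneg fun σ _ => (gibbs_pos _ _ _).le
  have ha : (0 : ℝ) ≤ 1 / (2 * (2 * N + 1)) := by positivity
  refine ⟨Finset.univ.filter fun x => |totalSpin x.1| ≤ N * δ, ?_, ?_, ?_⟩
  · rw [sum_filter_begMeasure K β M N fun σ => |totalSpin σ| ≤ N * δ]
    have h1 := le_average_of_le (M := M) (θ := r / 2) (by positivity) (by linarith) ha
      (fun i => hgibbs (temp β M i) (Finset.univ.filter fun σ => |totalSpin σ| ≤ N * δ))
      fun i hi => by
        have htemp0 := temp_nonneg hβ0.le M i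
        have htemp : temp β M i < criticalBeta K := by
          unfold temp
          rw [← hrβ]
          have : ((i : ℕ) : ℝ) / M ≤ r / 2 := by
            rw [div_le_iff₀ hM0]; linarith
          have : ((i : ℕ) : ℝ) / M < r := by linarith
          gcongr
        refine le_sum_gibbs hN1 hK0 htemp0 (m := 0)
          (fun m' _ => hhot _ htemp0 htemp m') hδ hNδ2 _ fun σ hσ => ?_
        have hm0 : meanSpin (temp β M i) (2 * temp β M i * K * 0) = 0 := by simp [meanSpin]
        rw [hm0, mul_zero, sub_zero] at hσ
        exact Finset.mem_filter.2 ⟨Finset.mem_univ _, hσ.le⟩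
    refine le_trans ?_ h1
    calc min (r / 8) ((1 - r) / 8) / (2 * N + 1) ≤ (r / 8) / (2 * N + 1) := by
          gcongr; exact min_le_left _ _
      _ = r / 2 / 2 * (1 / (2 * (2 * N + 1))) := by field_simp; norm_num
  · have hcompl : (Finset.univ.filter fun x : Config N × Fin (M + 1) =>
        |totalSpin x.1| ≤ N * δ)ᶜ =
        Finset.univ.filter fun x : Config N × Fin (M + 1) => N * δ < |totalSpin x.1| := by
      ext x; simp
    -- The levels are reversed so that the cold ones become an initial segment.
    rw [hcompl, sum_filter_begMeasure K β M N fun σ => N * δ < |totalSpin σ|,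
      ← Equiv.sum_comp Fin.revPerm]
    have h1 := le_average_of_le (M := M) (θ := (1 - r) / 2) (by linarith) (by linarith) ha
      (fun i => hgibbs (temp β M (Fin.revPerm i))
        (Finset.univ.filter fun σ => N * δ < |totalSpin σ|))
      fun i hi => by
        have htemp : criticalBeta K < temp β M (Fin.revPerm i) := by
          unfold temp
          rw [← hrβ]
          have h2 : (((Fin.revPerm i : Fin (M + 1)) : ℕ) : ℝ) = M - (i : ℕ) := by
            rw [Fin.revPerm_apply, Fin.val_rev]
            have : (i : ℕ) ≤ M := Nat.lt_succ_iff.1 i.2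
            rw [show M + 1 - ((i : ℕ) + 1) = M - i by omega, Nat.cast_sub this]
          rw [h2]
          have : r < ((M : ℝ) - (i : ℕ)) / M := by
            rw [lt_div_iff₀ hM0]
            nlinarith
          gcongr
        obtain ⟨m, hm, hmax, hstat⟩ := hcold _ htemp
        refine le_sum_gibbs hN1 hK0 (temp_nonneg hβ0.le M _) (m := m)
          (fun m' _ => hmax m') hδ hNδ2 _ fun σ hσ => ?_
        rw [hstat] at hσ
        refine Finset.mem_filter.2 ⟨Finset.mem_univ _, ?_⟩
        have h3 := (abs_lt.1 hσ).1
        have h4 : N * (2 * δ) ≤ N * m := by gcongr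
        have h5 := le_abs_self (totalSpin σ)
        linarith
    refine le_trans ?_ h1
    calc min (r / 8) ((1 - r) / 8) / (2 * N + 1) ≤ ((1 - r) / 8) / (2 * N + 1) := by
          gcongr; exact min_le_right _ _
      _ = (1 - r) / 2 / 2 * (1 / (2 * (2 * N + 1))) := by field_simp; norm_num
  · refine (begChain_cutFlow_le K hβ0.le M N (N * δ)).trans ?_
    rw [sum_filter_begMeasure K β M N fun σ =>
      N * δ ≤ |totalSpin σ| ∧ |totalSpin σ| ≤ N * δ + 2]
    have h1 : ∀ i : Fin (M + 1), (∑ σ ∈ Finset.univ.filter fun σ : Config N =>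
        N * δ ≤ |totalSpin σ| ∧ |totalSpin σ| ≤ N * δ + 2,
        gibbs (hamiltonian K N) (temp β M i) σ) / ((M : ℝ) + 1) ≤
        (2 * N + 1) * Real.exp (-c * N) / ((M : ℝ) + 1) := by
      intro i
      refine div_le_div_of_nonneg_right ?_ (by positivity)
      refine sum_gibbs_le hN1 hK0 (temp_nonneg hβ0.le M i) _ fun σ hσ => ?_
      obtain ⟨-, hσ1, hσ2⟩ := Finset.mem_filter.1 hσ
      refine hshell _ _ (temp_nonneg hβ0.le M i) ?_ ?_
      · rw [abs_div, abs_of_pos hN0, le_div_iff₀ hN0]; linarith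
      · rw [abs_div, abs_of_pos hN0, div_le_iff₀ hN0]; linarith
    refine (Finset.sum_le_sum fun i _ => h1 i).trans (le_of_eq ?_)
    rw [Finset.sum_const, Finset.card_univ, Fintype.card_fin, nsmul_eq_mul]
    have : (M : ℝ) + 1 ≠ 0 := by positivity
    push_cast
    field_simp

end Averages

/-! ### Torpid mixing -/

section Main

theorem eventually_eval_lt_exp (q : Polynomial ℝ) {c : ℝ} (hc : 0 < c) :
    ∀ᶠ N : ℕ in Filter.atTop, q.eval (N : ℝ) < Real.exp (c * N) := by
  have h1 := (q.comp (Polynomial.C (1 / c) * Polynomial.X)).tendsto_div_exp_atTop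
  have h2 : Filter.Tendsto (fun N : ℕ => c * (N : ℝ)) Filter.atTop Filter.atTop :=
    tendsto_natCast_atTop_atTop.const_mul_atTop hc
  filter_upwards [(h1.comp h2).eventually (gt_mem_nhds one_pos)] with N hN
  simp only [Function.comp, Polynomial.eval_comp, Polynomial.eval_mul, Polynomial.eval_C,
    Polynomial.eval_X] at hN
  rw [div_lt_one (Real.exp_pos _)] at hN
  have h3 : 1 / c * (c * (N : ℝ)) = N := by field_simp
  rwa [h3] at hN

end Main

end BEG

/-! ### From the cut to the gap and the mixing time -/

theorem mainTheorem2 (K : ℝ) (hKlow : BEG.Klow < K) (hKc : K < BEG.Kc) :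
    ∃ c : ℝ, 0 < c ∧ ∀ β : ℝ, BEG.criticalBeta K < β →
      (∃ N₀ : ℕ, ∀ N : ℕ, N₀ ≤ N → ∀ M : ℕ, 1 ≤ M →
        BEG.spectralGap (BEG.begChain K β M N) ≤ Real.exp (-c * (N : ℝ))) ∧
      (∀ M : ℕ → ℕ, (∀ N, 1 ≤ M N) →
        BEG.TorpidlyMixing (Ω := fun N => BEG.Config N × Fin (M N + 1))
          (fun N => BEG.begChain K β (M N) N) (fun N => BEG.begMeasure K β (M N) N)) := by
  rw [BEG.Klow_eq] at hKlow
  obtain ⟨c, hc, hcut⟩ := BEG.exists_cut hKlow hKc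
  -- The other half of the exponent absorbs the factor (2N + 1)³/κ².
  refine ⟨c / 2, by positivity, fun β hβ => ?_⟩
  obtain ⟨hβ0, κ, hκ0, hκ1, N₀, hcut⟩ := hcut β hβ
  constructor
  · obtain ⟨N₁, hN₁⟩ := Filter.eventually_atTop.1 (BEG.eventually_eval_lt_exp
      (Polynomial.C (1 / κ ^ 2) * (2 * Polynomial.X + 1) ^ 3) (half_pos hc))
    refine ⟨max N₀ N₁, fun N hN M hM => ?_⟩
    obtain ⟨A, hA, hAc, hflow⟩ := hcut N ((le_max_left _ _).trans hN) M hM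
    have hexp := hN₁ N ((le_max_right _ _).trans hN)
    simp only [Polynomial.eval_mul, Polynomial.eval_C, Polynomial.eval_pow, Polynomial.eval_add,
      Polynomial.eval_X, Polynomial.eval_one, Polynomial.eval_ofNat] at hexp
    have hgap := (BEG.spectralGap_mul_le_cutFlow (BEG.begChain_isReversible K hβ0.le M N)
      (BEG.eq_of_begChain_mulVec_eq K hβ0.le M N) A).trans hflow
    set g := BEG.spectralGap (BEG.begChain K β M N) with hg
    rcases le_or_gt g 0 with hg0 | hg0
    · exact hg0.trans (Real.exp_pos _).le
    · have hw : (0 : ℝ) < 2 * N + 1 := by positivity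
      have h1 : g * (κ / (2 * N + 1) * (κ / (2 * N + 1))) ≤
          (2 * N + 1) * Real.exp (-c * N) := by
        refine le_trans (mul_le_mul_of_nonneg_left ?_ hg0.le) hgap
        exact mul_le_mul hA hAc (by positivity) (le_trans (by positivity) hA)
      have h2 : g * (κ / (2 * N + 1) * (κ / (2 * N + 1))) = g * κ ^ 2 / (2 * N + 1) ^ 2 := by
        field_simp
      rw [h2, div_le_iff₀ (by positivity)] at h1
      have h3 : Real.exp (-c * N) = Real.exp (-(c / 2) * N) * Real.exp (-(c / 2) * N) := by
        rw [← Real.exp_add]; ring_nf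
      have h4 : Real.exp (-(c / 2) * N) * Real.exp (c / 2 * N) = 1 := by
        rw [← Real.exp_add]; ring_nf; exact Real.exp_zero
      have h5 : (2 * (N : ℝ) + 1) ^ 3 * Real.exp (-(c / 2) * N) ≤ κ ^ 2 := by
        rw [one_div, inv_mul_lt_iff₀ (by positivity)] at hexp
        calc (2 * (N : ℝ) + 1) ^ 3 * Real.exp (-(c / 2) * N)
            ≤ κ ^ 2 * Real.exp (c / 2 * N) * Real.exp (-(c / 2) * N) := by gcongr
          _ = κ ^ 2 := by linear_combination κ ^ 2 * h4
      have h6 : g * κ ^ 2 ≤ Real.exp (-(c / 2) * N) * κ ^ 2 := by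
        calc g * κ ^ 2 ≤ (2 * N + 1) * Real.exp (-c * N) * (2 * N + 1) ^ 2 := h1
          _ = Real.exp (-(c / 2) * N) * ((2 * (N : ℝ) + 1) ^ 3 * Real.exp (-(c / 2) * N)) := by
            rw [h3]; ring
          _ ≤ _ := by gcongr
      exact le_of_mul_le_mul_right h6 (by positivity)
  · rintro M hM ⟨p, hp⟩
    -- With ε⁻¹ = (2/κ)(2N + 1), the bound p(ε⁻¹, N) becomes a polynomial in N alone.
    set q : Polynomial ℝ := MvPolynomial.aeval
      ![Polynomial.C (2 / κ) * (2 * Polynomial.X + 1), Polynomial.X] p with hq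
    obtain ⟨N, ⟨hN, hN1⟩, hNN⟩ := (((BEG.eventually_eval_lt_exp
      (q * (Polynomial.C (2 / κ ^ 2) * (2 * Polynomial.X + 1) ^ 3)) hc).and
      (Filter.eventually_ge_atTop 1)).and (Filter.eventually_ge_atTop N₀)).exists
    obtain ⟨A, hA, hAc, hflow⟩ := hcut N hNN (M N) (hM N)
    have hw : (0 : ℝ) < 2 * N + 1 := by positivity
    -- The accuracy depends on N: it is half of the lower bound for π(Aᶜ), so mixing to accuracy ε
    -- forces a crossing probability of at least ε.
    set ε := κ / (2 * N + 1) / 2 with hε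
    have hε0 : 0 < ε := by positivity
    have hε1 : ε < 1 := by
      have : κ / (2 * N + 1) ≤ 1 := by
        rw [div_le_one hw]
        have : (0 : ℝ) ≤ N := Nat.cast_nonneg N
        linarith
      rw [hε]; linarith
    obtain ⟨n, hn, hnp⟩ := hp N hN1 ε hε0 hε1
    have hqeval : MvPolynomial.eval ![ε⁻¹, (N : ℝ)] p = q.eval (N : ℝ) := by
      rw [hq, ← Polynomial.coe_aeval_eq_eval, MvPolynomial.comp_aeval_apply,
        ← MvPolynomial.coe_aeval_eq_eval]
      simp only [RingHom.coe_coe]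
      congr 2
      ext i
      fin_cases i
      · simp [hε]
        field_simp
      · simp
    rw [hqeval] at hnp
    simp only [Polynomial.eval_mul, Polynomial.eval_C, Polynomial.eval_pow, Polynomial.eval_add,
      Polynomial.eval_X, Polynomial.eval_one, Polynomial.eval_ofNat] at hN
    have hmix := BEG.mul_sub_le_of_dTV_le (BEG.begChain_isReversible K hβ0.le (M N) N) A
      (BEG.dTV_le_of_mixingTime_eq hn)
    have h1 : κ / (2 * N + 1) * ε ≤ q.eval (N : ℝ) * ((2 * N + 1) * Real.exp (-c * N)) := by
      calc κ / (2 * N + 1) * ε ≤ (∑ x ∈ A, BEG.begMeasure K β (M N) N x) *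
            (∑ x ∈ Aᶜ, BEG.begMeasure K β (M N) N x - ε) := by
            have : ε ≤ ∑ x ∈ Aᶜ, BEG.begMeasure K β (M N) N x - ε := by
              have : κ / (2 * N + 1) = ε + ε := by rw [hε]; ring
              linarith
            have h0 : 0 ≤ κ / (2 * (N : ℝ) + 1) := by positivity
            exact mul_le_mul hA this hε0.le (h0.trans hA)
        _ ≤ n * BEG.cutFlow (BEG.begChain K β (M N) N) (BEG.begMeasure K β (M N) N) A := hmix
        _ ≤ n * ((2 * N + 1) * Real.exp (-c * N)) := by gcongr
        _ ≤ _ := by gcongr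
    have h2 : κ / (2 * N + 1) * ε = κ ^ 2 / (2 * (2 * N + 1) ^ 2) := by rw [hε]; field_simp
    rw [h2, div_le_iff₀ (by positivity)] at h1
    have h4 : Real.exp (-c * N) * Real.exp (c * N) = 1 := by
      rw [← Real.exp_add]; ring_nf; exact Real.exp_zero
    have h5 : q.eval (N : ℝ) * (2 * (2 * (N : ℝ) + 1) ^ 3) < κ ^ 2 * Real.exp (c * N) := by
      have h6 : q.eval (N : ℝ) * (2 / κ ^ 2 * (2 * (N : ℝ) + 1) ^ 3) =
          q.eval (N : ℝ) * (2 * (2 * (N : ℝ) + 1) ^ 3) / κ ^ 2 := by field_simp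
      rw [h6, div_lt_iff₀ (by positivity)] at hN
      linarith
    have h7 : κ ^ 2 * Real.exp (c * N) ≤
        q.eval (N : ℝ) * ((2 * N + 1) * Real.exp (-c * N)) * (2 * (2 * N + 1) ^ 2) *
          Real.exp (c * N) := by gcongr
    have h8 : q.eval (N : ℝ) * ((2 * N + 1) * Real.exp (-c * N)) * (2 * (2 * N + 1) ^ 2) *
          Real.exp (c * N) = q.eval (N : ℝ) * (2 * (2 * (N : ℝ) + 1) ^ 3) := by
      linear_combination q.eval (N : ℝ) * (2 * (2 * (N : ℝ) + 1) ^ 3) * h4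
    linarith
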